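/- Let $d\ge 1$, let $0\le a\in L^1(\mathbb R^d)$ and let $z\ge 0$ be a constant. Let $\Gamma$ be the space of locally finite subsets $\gamma$ of $\mathbb R^d$ with the Borel $\sigma$-algebra of the vague topology (the coarsest one making $\gamma\mapsto\sum_{x\in\gamma}f(x)$ continuous for every $f\in C_c(\mathbb R^d)$), and let $\pi_z$ be the Poisson measure on $\Gamma$ with intensity $z\,dx$, i.e. the probability measure with $$\int_\Gamma e^{\sum_{x\in\gamma}\varphi(x)}\,\pi_z(d\gamma)=\exp\Big(\int_{\mathbb R^d}(e^{\varphi(x)}-1)\,z\,dx\Big),\qquad \varphi\in C_c^\infty(\mathbb R^d).$$ For functions $F:\Gamma\to\mathbb C$ put $$(LF)(\gamma)=\sum_{x\in\gamma}\int_{\mathbb R^d}a(x-y)\big(F(\gamma\setminus x\cup y)-F(\gamma)\big)\,dy ,$$ and for functions $f$ on $\mathbb R^d$ put $e_B(f,\gamma)=\prod_{x\in\gamma}(1+f(x))$ and $(Af)(x)=\int_{\mathbb R^d}a(x-y)(f(y)-f(x))\,dy$. Let $\Gamma_a$ be the set of all $\gamma\in\Gamma$ for which $y\mapsto\sum_{x\in\gamma}a(x-y)$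 is locally integrable. A measurable $F:\Gamma\to\mathbb C$ is called cylinder and exponentially bounded if there are an open set $\Lambda$ with compact closure and $C,c>0$ with $F(\gamma)=F(\gamma\cap\Lambda)$ and $|F(\gamma)|\le Ce^{c|\gamma\cap\Lambda|}$ for all $\gamma\in\Gamma$. Let $\mathcal F=\bigoplus_{n\ge0}n!\,L^2(z\,dx)^{\hat\otimes n}$ be the symmetric Fock space. Let $I:L^2(\pi_z)\to\mathcal F$ be the unitary isomorphism (of complex Hilbert spaces) that maps the Charlier polynomial $\langle C^n_z,\varphi^{\otimes n}\rangle$ to $\varphi^{\otimes n}$ in the $n$-th summand for all $n\ge 0$ and $\varphi\in C_c^\infty(\mathbb R^d;\mathbb C)$, where $$e^{-\int s\varphi\, z\,dx}\,e_B(s\varphi,\gamma)=\sum_{n\ge0}\frac{s^n}{n!}\langle C^n_z(\gamma),\varphi^{\otimes n}\rangle ,\qquad s\in\mathbb C .$$ Let $\mathrm{Exp}(T)$ be the bounded operator on $\mathcal F$ acting as $T\otimes\cdots\otimes T$ on each $L^2(z\,dx)^{\hat\otimes n}$, for a contraction $T$ on $L^2(z\,dx)$, and put $\mathrm{Exp}_{\pi_z}(T)=I^{-1}\,\mathrm{Exp}(T)\,I$.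 Then the following holds. 1. For all $\varphi\in L^1(z\,dx)\cap L^2(z\,dx)$, the product defining $e_B(\varphi,\gamma)$ converges absolutely for $\pi_z$-a.e. $\gamma$ (that is, $\sum_{x\in\gamma}|\varphi(x)|<\infty$), and $e_B(\varphi)\in L^2(\pi_z)$. Moreover $\pi_z(\Gamma_a)=1$, and for every cylinder exponentially bounded $F$ the sum and integrals in $(LF)(\gamma)$ converge absolutely for every $\gamma\in\Gamma_a$. 2. Let $\mathcal D_{\mathrm{coh}}\subset L^2(\pi_z)$ be the linear span of the functions $e_B(\varphi)$, $\varphi\in L^1(z\,dx)\cap L^2(z\,dx)$. For every $F\in\mathcal D_{\mathrm{coh}}$ (and any representative of it) the expression $(LF)(\gamma)$ converges absolutely for $\pi_z$-a.e. $\gamma$, and $F\mapsto LF$ is a linear operator $\mathcal D_{\mathrm{coh}}\to L^2(\pi_z)$. This operator is closable in $L^2(\pi_z)$. 3. Its closure $\bar L$ extends $L$ on cylinder exponentially bounded functions: every such $F$ belongs to the domain of $\bar L$, and $\bar LF=LF$ $\pi_z$-a.e. 4. The operator $A$ is bounded on $L^2(z\,dx)$, the isomorphism $I$ and the operators $\mathrm{Exp}(e^{tA})$,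 $t\ge0$, exist, and $\bar L$ is the generator of the semigroup $$e^{t\bar L}=\mathrm{Exp}_{\pi_z}(e^{tA}),\qquad t\ge 0,$$ on $L^2(\pi_z)$. This semigroup is a Markov semigroup: it is a strongly continuous contraction semigroup $(S_t)_{t\ge0}$ such that $0\le F\le1$ implies $0\le S_tF\le1$ for all $t\ge0$, and there is a sequence $F_n\nearrow1$ a.e. with $S_tF_n\nearrow1$ a.e. for all $t\ge0$. -/

import Mathlib

open MeasureTheory Filter Topology Set
open scoped ENNReal NNReal ContDiff

noncomputable section

namespace FreeKawasaki

/-- The space `ℝ^d`. -/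
abbrev E (d : ℕ) : Type := EuclideanSpace ℝ (Fin d)

/-! ### Configuration space -/

/-- The configuration space `Γ` over `ℝ^d`: locally finite subsets of `ℝ^d`. -/
@[ext]
structure Config (d : ℕ) where
  carrier : Set (E d)
  finite_inter : ∀ K : Set (E d), IsCompact K → (carrier ∩ K).Finite

namespace Config

variable {d : ℕ}

/-- The pairing `⟨f, γ⟩ = ∑_{x ∈ γ} f(x)`. -/
def pairing (f : E d → ℝ) (γ : Config d) : ℝ := ∑' x : γ.carrier, f x

/-- The vague topology: the weakest one making all `γ ↦ ⟨f, γ⟩`, `f ∈ C_c(ℝ^d)`, continuous. -/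
instance : TopologicalSpace (Config d) :=
  TopologicalSpace.induced
    (fun (γ : Config d) (f : {f : E d → ℝ // Continuous f ∧ HasCompactSupport f}) =>
      pairing f.1 γ) inferInstance

instance : MeasurableSpace (Config d) := borel (Config d)

instance : BorelSpace (Config d) := ⟨rfl⟩

/-- The configuration `γ_Λ = γ ∩ Λ`. -/
def restrict (γ : Config d) (Λ : Set (E d)) : Config d where
  carrier := γ.carrier ∩ Λ
  finite_inter K hK := (γ.finite_inter K hK).subset fun _ hx => ⟨hx.1.1, hx.2⟩

/-- The configuration `γ \ x ∪ y`. -/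
def move (γ : Config d) (x y : E d) : Config d where
  carrier := (γ.carrier \ {x}) ∪ {y}
  finite_inter K hK := by
    refine ((γ.finite_inter K hK).union (Set.finite_singleton y)).subset ?_
    rintro w ⟨hw | hw, hwK⟩
    · exact Or.inl ⟨hw.1, hwK⟩
    · exact Or.inr hw

end Config

/-- `π` is the Poisson measure on `Γ` with intensity measure `ν`: the probability measure with
Laplace transform `∫ exp ⟨φ, γ⟩ π(dγ) = exp (∫ (exp φ - 1) dν)`, `φ ∈ C_c^∞(ℝ^d)`. (If the left
integrand were not integrable, the left side would be `0` and the identity would fail.) -/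
structure IsPoissonMeasure {d : ℕ} (ν : Measure (E d)) (π : Measure (Config d)) : Prop where
  isProbability : IsProbabilityMeasure π
  laplace : ∀ φ : E d → ℝ, ContDiff ℝ ∞ φ → HasCompactSupport φ →
    ∫ γ, Real.exp (γ.pairing φ) ∂π = Real.exp (∫ x, (Real.exp (φ x) - 1) ∂ν)

/-- The measure `z dx` for a constant `z ≥ 0`. -/
def intensity (d : ℕ) (z : ℝ≥0) : Measure (E d) := z • volume

instance (d : ℕ) (z : ℝ≥0) : SigmaFinite (intensity d z) := by
  unfold intensity; infer_instance

instance (d : ℕ) (z : ℝ≥0) : IsFiniteMeasureOnCompacts (intensity d z) := by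
  unfold intensity; infer_instance

/-! ### The generator on functions of configurations -/

section Generator

variable {d : ℕ}

/-- The set `Γ_a` of all `γ` for which `y ↦ ∑_{x ∈ γ} a(x - y)` is locally integrable
(for `a ≥ 0`). -/
def admissible (a : E d → ℝ) : Set (Config d) :=
  {γ | ∀ K : Set (E d), IsCompact K →
    ∫⁻ y in K, ∑' x : γ.carrier, ENNReal.ofReal (a (x - y)) < ⊤}

/-- The summand `a(x - y) (F(γ \ x ∪ y) - F(γ))`. -/
def jumpTerm (a : E d → ℝ) (F : Config d → ℂ) (γ : Config d) (x y : E d) : ℂ :=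
  (a (x - y) : ℂ) * (F (γ.move x y) - F γ)

/-- `(L F)(γ) = ∑_{x ∈ γ} ∫ a(x - y) (F(γ \ x ∪ y) - F(γ)) dy`. -/
def kawasaki (a : E d → ℝ) (F : Config d → ℂ) (γ : Config d) : ℂ :=
  ∑' x : γ.carrier, ∫ y, jumpTerm a F γ x y

/-- The sum and the integrals in `(L F)(γ)` converge absolutely. -/
def KawasakiConverges (a : E d → ℝ) (F : Config d → ℂ) (γ : Config d) : Prop :=
  (∀ x ∈ γ.carrier, Integrable (fun y => jumpTerm a F γ x y)) ∧
    Summable fun x : γ.carrier => ∫ y, ‖jumpTerm a F γ x y‖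

/-- Measurable, cylinder, exponentially bounded functions on `Γ`. -/
def IsCylinderExpBounded (F : Config d → ℂ) : Prop :=
  Measurable F ∧ ∃ Λ : Set (E d), IsOpen Λ ∧ IsCompact (closure Λ) ∧
    (∀ γ, F γ = F (γ.restrict Λ)) ∧
    ∃ C c : ℝ, 0 < C ∧ 0 < c ∧
      ∀ γ, ‖F γ‖ ≤ C * Real.exp (c * ((γ.restrict Λ).carrier.ncard : ℝ))

/-- The Bogoliubov exponential `e_B(f, γ) = ∏_{x ∈ γ} (1 + f(x))`. -/
def bogoliubov (f : E d → ℂ) (γ : Config d) : ℂ := ∏' x : γ.carrier, (1 + f x)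

/-- The coherent state `e_{π_z}(f) = exp (-∫ f z dx) e_B(f)`. -/
def coherent (z : ℝ≥0) (f : E d → ℂ) (γ : Config d) : ℂ :=
  Complex.exp (-∫ x, f x ∂(intensity d z)) * bogoliubov f γ

/-- The Charlier polynomial `⟨C_z^n(γ), φ^{⊗ n}⟩`, defined by the generating function
`e_{π_z}(s φ, γ) = ∑ₙ (s ^ n / n!) ⟨C_z^n(γ), φ^{⊗ n}⟩`. -/
def charlier (z : ℝ≥0) (n : ℕ) (φ : E d → ℂ) (γ : Config d) : ℂ :=
  iteratedDeriv n (fun s : ℂ => coherent z (fun x => s * φ x) γ) 0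

/-- The subspace of `L²(π)` spanned by the `e_B(φ)`, `φ ∈ L¹(z dx) ∩ L²(z dx)`. -/
def coherentSpan (z : ℝ≥0) (π : Measure (Config d)) : Submodule ℂ (Lp ℂ 2 π) :=
  Submodule.span ℂ {F | ∃ φ : E d → ℂ, MemLp φ 1 (intensity d z) ∧ MemLp φ 2 (intensity d z) ∧
    F =ᵐ[π] bogoliubov φ}

end Generator

/-! ### The one particle operator -/

/-- The one particle Hilbert space `L²(ℝ^d, z dx)`. -/
abbrev OneParticle (d : ℕ) (z : ℝ≥0) : Type := Lp ℂ 2 (intensity d z)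

/-- `A` is the bounded operator `(A f)(x) = ∫ a(x - y) (f(y) - f(x)) dy` on `L²(ℝ^d, z dx)`. -/
def IsOneParticleOperator {d : ℕ} {z : ℝ≥0} (a : E d → ℝ)
    (A : OneParticle d z →L[ℂ] OneParticle d z) : Prop :=
  ∀ f : OneParticle d z, ∀ᵐ x ∂(intensity d z),
    Integrable (fun y => (a (x - y) : ℂ) * (f y - f x)) ∧
      A f x = ∫ y, (a (x - y) : ℂ) * (f y - f x)

/-! ### Symmetric Fock space and second quantization -/

section Fock

variable {d : ℕ} {z : ℝ≥0}

/-- The measure `n! (z dx)^n` on `(ℝ^d)^n`, so that the norm of `L²((ℝ^d)^n, n! (z dx)^n)` is that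
of `n! L²(z dx)^{⊗ n}`. -/
def levelMeasure (d : ℕ) (z : ℝ≥0) (n : ℕ) : Measure (Fin n → E d) :=
  (n.factorial : ℝ≥0∞) • Measure.pi fun _ => intensity d z

/-- `f₁ ⊗̂ ⋯ ⊗̂ fₙ` as a function: the symmetrization of `∏ᵢ fᵢ(xᵢ)`. -/
def symTensorFun {n : ℕ} (f : Fin n → OneParticle d z) (x : Fin n → E d) : ℂ :=
  (n.factorial : ℂ)⁻¹ * ∑ σ : Equiv.Perm (Fin n), ∏ i, f (σ i) (x i)

theorem memLp_tensor_aux {d n : ℕ} {ν : Measure (E d)} [SigmaFinite ν] (f : Fin n → E d → ℂ)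
    (hf : ∀ i, MemLp (f i) 2 ν) :
    MemLp (fun x : Fin n → E d => ∏ i, f i (x i)) 2 (Measure.pi fun _ => ν) := by
  have hm : AEStronglyMeasurable (fun x : Fin n → E d => ∏ i, f i (x i))
      (Measure.pi fun _ => ν) := by
    refine Finset.aestronglyMeasurable_fun_prod _ fun i _ => ?_
    exact (hf i).1.comp_quasiMeasurePreserving
      (Measure.quasiMeasurePreserving_eval (fun _ : Fin n => ν) i)
  rw [memLp_two_iff_integrable_sq_norm hm]
  have h := Integrable.fintype_prod (μ := fun _ : Fin n => ν)
    (f := fun i x => ‖f i x‖ ^ 2) (fun i =>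
      (memLp_two_iff_integrable_sq_norm (hf i).1).1 (hf i))
  refine h.congr (ae_of_all _ fun x => ?_)
  simp only [norm_prod, Finset.prod_pow]

theorem memLp_tensor {n : ℕ} (f : Fin n → OneParticle d z) :
    MemLp (fun x : Fin n → E d => ∏ i, f i (x i)) 2 (Measure.pi fun _ => intensity d z) :=
  memLp_tensor_aux (fun i => f i) fun i => Lp.memLp (f i)

theorem memLp_symTensorFun {n : ℕ} (f : Fin n → OneParticle d z) :
    MemLp (symTensorFun f) 2 (levelMeasure d z n) := by
  have h : MemLp (fun x : Fin n → E d => ∑ σ : Equiv.Perm (Fin n), ∏ i, f (σ i) (x i)) 2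
      (Measure.pi fun _ => intensity d z) :=
    memLp_finsetSum Finset.univ fun σ _ => memLp_tensor fun i => f (σ i)
  have h' : MemLp (symTensorFun f) 2 (Measure.pi fun _ => intensity d z) :=
    h.const_mul ((n.factorial : ℂ)⁻¹)
  exact h'.smul_measure (ENNReal.natCast_ne_top _)

/-- The symmetric tensor `f₁ ⊗̂ ⋯ ⊗̂ fₙ` as an element of `L²((ℝ^d)^n, n! (z dx)^n)`. -/
def symTensorLp {n : ℕ} (f : Fin n → OneParticle d z) : Lp ℂ 2 (levelMeasure d z n) :=
  (memLp_symTensorFun f).toLp _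

/-- `n! L²(z dx)^{⊗̂ n}`: the closed linear span of the symmetric tensors. -/
def symPower (d : ℕ) (z : ℝ≥0) (n : ℕ) : Submodule ℂ (Lp ℂ 2 (levelMeasure d z n)) :=
  (Submodule.span ℂ (Set.range symTensorLp)).topologicalClosure

/-- The symmetric tensor `f₁ ⊗̂ ⋯ ⊗̂ fₙ` in the `n`-th symmetric power. -/
def symTensor {n : ℕ} (f : Fin n → OneParticle d z) : symPower d z n :=
  ⟨symTensorLp f, Submodule.le_topologicalClosure _ (Submodule.subset_span ⟨f, rfl⟩)⟩

/-- The symmetric Fock space: the Hilbert sum of the spaces `n! L²(z dx)^{⊗̂ n}`. -/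
abbrev Fock (d : ℕ) (z : ℝ≥0) : Type := lp (fun n : ℕ => symPower d z n) 2

/-- `U` is the second quantization `Exp(T)`: the bounded operator on Fock space which acts as
`T ⊗ ⋯ ⊗ T` on each symmetric power. -/
def IsSecondQuantization (T : OneParticle d z →L[ℂ] OneParticle d z)
    (U : Fock d z →L[ℂ] Fock d z) : Prop :=
  ∀ (n : ℕ) (f : Fin n → OneParticle d z),
    U (lp.single 2 n (symTensor f)) = lp.single 2 n (symTensor fun i => T (f i))

/-- The class in `L²(z dx)` of a test function. -/
def testLp (z : ℝ≥0) (φ : E d → ℂ) (hφ : Continuous φ) (hc : HasCompactSupport φ) :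
    OneParticle d z :=
  (hφ.memLp_of_hasCompactSupport hc).toLp φ

/-- `I` is the canonical unitary isomorphism between `L²(π_z)` and Fock space: it maps the Charlier
polynomial `⟨C_z^n, φ^{⊗ n}⟩` to `φ^{⊗ n}` in the `n`-th symmetric power, `φ ∈ C_c^∞(ℝ^d)`. -/
def IsPoissonFockIso (π : Measure (Config d)) (I : Lp ℂ 2 π ≃ₗᵢ[ℂ] Fock d z) : Prop :=
  ∀ (φ : E d → ℂ) (hφ : ContDiff ℝ ∞ φ) (hc : HasCompactSupport φ) (n : ℕ),
    I.symm (lp.single 2 n (symTensor fun _ : Fin n => testLp z φ hφ.continuous hc))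
      =ᵐ[π] charlier z n φ

end Fock

/-! ### Semigroups and generators -/

/-- A strongly continuous contraction semigroup `(S t)_{t ≥ 0}` (negative times are ignored). -/
structure IsContractionSemigroup {X : Type*} [NormedAddCommGroup X] [NormedSpace ℂ X]
    (S : ℝ → X →L[ℂ] X) : Prop where
  zero : S 0 = ContinuousLinearMap.id ℂ X
  add : ∀ s t, 0 ≤ s → 0 ≤ t → S (s + t) = (S s).comp (S t)
  continuous : ∀ f, ContinuousOn (fun t => S t f) (Set.Ici 0)
  contraction : ∀ t, 0 ≤ t → ‖S t‖ ≤ 1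

/-- `B`, with its domain, is the generator of `(S t)_{t ≥ 0}`. -/
def IsGenerator {X : Type*} [NormedAddCommGroup X] [NormedSpace ℂ X]
    (S : ℝ → X →L[ℂ] X) (B : X →ₗ.[ℂ] X) : Prop :=
  ∀ f g : X, (f, g) ∈ B.graph ↔
    Tendsto (fun t : ℝ => ((t⁻¹ : ℝ) : ℂ) • (S t f - f)) (𝓝[>] 0) (𝓝 g)

section Markov

variable {Ω : Type*} [MeasurableSpace Ω] {μ : Measure Ω}

/-- `0 ≤ f ≤ 1` almost everywhere. -/
def IsUnitValued (f : Lp ℂ 2 μ) : Prop :=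
  ∀ᵐ x ∂μ, (f x).im = 0 ∧ 0 ≤ (f x).re ∧ (f x).re ≤ 1

/-- `fₙ ↗ 1` almost everywhere. -/
def IncreasesToOne (f : ℕ → Lp ℂ 2 μ) : Prop :=
  ∀ᵐ x ∂μ, (∀ n, (f n x).im = 0) ∧ Monotone (fun n => (f n x).re) ∧
    Tendsto (fun n => (f n x).re) atTop (𝓝 1)

/-- A Markov semigroup on `L²(μ)`: a strongly continuous contraction semigroup with
`0 ≤ S t f ≤ 1` whenever `0 ≤ f ≤ 1`, and `S t fₙ ↗ 1` for some sequence `fₙ ↗ 1`. -/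
structure IsMarkovSemigroup (S : ℝ → Lp ℂ 2 μ →L[ℂ] Lp ℂ 2 μ) : Prop
    extends IsContractionSemigroup S where
  subMarkov : ∀ t, 0 ≤ t → ∀ f, IsUnitValued f → IsUnitValued (S t f)
  conservative : ∃ f : ℕ → Lp ℂ 2 μ, IncreasesToOne f ∧
    ∀ t, 0 ≤ t → IncreasesToOne fun n => S t (f n)

end Markov

end FreeKawasaki

end

open FreeKawasaki

/-! The normalised exponentials `e(f) = exp(-∫ f z dx) e_B(f)` satisfy `⟨e(f), e(g)⟩ = exp ⟨f, g⟩`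
in `L²(π_z)`. The exponential vectors `∑ₙ f^{⊗n} / n!` of Fock space have the same inner products
(`inner_expState`, `inner_expVector`). Both families are total, so `I` is the unitary that matches
them, and comparing powers of `s` in `e(sφ)` shows that it sends Charlier polynomials to tensor
powers. A contraction `T` on the one-particle space acts by `e(f) ↦ e(Tf)`. This extends to a
contraction because, by the Schur product theorem, the entrywise exponential preserves the order
between the Gram matrices of `f` and of `Tf` (`exists_contraction_exp`). The operator `A` is
convolution with `a` minus the scalar `∫ a`, and the convolution has norm at most `∫ a`. So `e^{tA}`
is a contraction, and its second quantization is the semigroup `S`.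

The link with `L` is the Mecke identity `E ∑_{x ∈ γ} h(γ, x) = E ∫ h(γ ∪ x, x) z dx`, obtained by
differentiating the Laplace transform of `π_z`. Moving a point changes one factor of the product, so
`L e_B(φ)` is `∑_{x ∈ γ} (Aφ)(x) e_B(φ, γ \ x)`. By the Mecke identity and `∫ Aφ z dx = 0`, its
inner products with the `e(g)` are the derivatives of `exp ⟨g, e^{tA} f⟩`, up to normalisation.
Hence every `e_B(φ)` lies in the domain of the generator, with the right image. As `e^{tA}`
preserves `L¹ ∩ L²`, the span of these vectors is dense and invariant, hence a core, and the closure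
of `L` is the generator (`exists_linearPMap`).

For a cylinder function `F` and fixed `γ`, the jump of a point is the one-particle jump operator
applied to `y ↦ F(γ ∪ y) - F(γ)`, a bounded function with bounded support. The Mecke identity and
the one-particle adjoint relation between `a(x)` and `a(-x)` show that `L F` is the weak derivative
of `S_t F` against the `e(g)`, since the adjoint semigroup is the one built from `a(-x)`.

Positivity follows from the energy inequality `Re ⟨(Re u)⁺, L u⟩ ≤ 0` on the core. The Mecke
identity freezes `γ` and reduces it to the one-particle inequality `∫ Re(Af) (Re(c + f))⁺ z dx ≤ 0`.
That holds by convexity, because the two marginals of the jump measure `a(x - y) z dx dy` coincide.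
Together with `S_t 1 = 1` this gives the Markov property. -/

set_option linter.unusedSectionVars false

noncomputable section

namespace FreeKawasaki

/-! ### Total families in Hilbert spaces -/

section TotalFamily

open scoped ComplexOrder

variable {ι X Y : Type*} [NormedAddCommGroup X] [InnerProductSpace ℂ X] [CompleteSpace X]
  [NormedAddCommGroup Y] [InnerProductSpace ℂ Y] [CompleteSpace Y]

/-- A family whose linear span is dense. -/
def IsTotal (u : ι → X) : Prop := Dense (Submodule.span ℂ (range u) : Set X)

theorem IsTotal.denseRange {u : ι → X} (hu : IsTotal u) :
    DenseRange (Finsupp.linearCombination ℂ u) := by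
  unfold IsTotal at hu
  rw [← Finsupp.range_linearCombination] at hu
  exact hu

theorem IsTotal.of_inner {u : ι → X} (h : ∀ x : X, (∀ i, inner ℂ (u i) x = 0) → x = 0) :
    IsTotal u := by
  unfold IsTotal
  rw [Submodule.dense_iff_topologicalClosure_eq_top, Submodule.topologicalClosure_eq_top_iff,
    Submodule.eq_bot_iff]
  intro x hx
  refine h x fun i => ?_
  exact (Submodule.mem_orthogonal _ x).1 hx _ (Submodule.subset_span ⟨i, rfl⟩)

theorem IsTotal.ext_inner {u : ι → X} (hu : IsTotal u) {x y : X}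
    (h : ∀ i, inner ℂ (u i) x = inner ℂ (u i) y) : x = y := by
  refine hu.eq_of_inner_right (𝕜 := ℂ) fun v hv => ?_
  induction hv using Submodule.span_induction with
  | mem v hv => obtain ⟨i, rfl⟩ := hv; exact h i
  | zero => simp
  | add v w _ _ hv hw => simp only [inner_add_left, hv, hw]
  | smul c v _ hv => simp only [inner_smul_left, hv]

theorem IsTotal.ext_clm {Z : Type*} [NormedAddCommGroup Z] [NormedSpace ℂ Z] {u : ι → X}
    (hu : IsTotal u) {S T : X →L[ℂ] Z}
    (h : ∀ i, S (u i) = T (u i)) : S = T := by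
  refine ContinuousLinearMap.ext_on hu ?_
  rintro _ ⟨i, rfl⟩
  exact h i

/-- The norm bound makes the assignment well defined on linear combinations even if the vectors `u
i` are linearly dependent; density then extends it. -/
theorem exists_contraction_of_norm_le {u : ι → X} (hu : IsTotal u) (w : ι → Y)
    (h : ∀ c : ι →₀ ℂ, ‖Finsupp.linearCombination ℂ w c‖ ≤ ‖Finsupp.linearCombination ℂ u c‖) :
    ∃ T : X →L[ℂ] Y, ‖T‖ ≤ 1 ∧ ∀ i, T (u i) = w i := by
  have h' : ∀ c : ι →₀ ℂ, ‖Finsupp.linearCombination ℂ w c‖ ≤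
      1 * ‖Finsupp.linearCombination ℂ u c‖ := by simpa using h
  refine ⟨(Finsupp.linearCombination ℂ w).extendOfNorm (Finsupp.linearCombination ℂ u),
    LinearMap.opNorm_extendOfNorm_le hu.denseRange zero_le_one h', fun i => ?_⟩
  simpa using LinearMap.extendOfNorm_eq hu.denseRange ⟨1, h'⟩ (Finsupp.single i (1 : ℂ))

theorem inner_linearCombination (u : ι → X) (c : ι →₀ ℂ) :
    inner ℂ (Finsupp.linearCombination ℂ u c) (Finsupp.linearCombination ℂ u c) =
      c.sum fun i ci => c.sum fun j cj => star ci * inner ℂ (u i) (u j) * cj := by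
  simp only [Finsupp.linearCombination_apply, Finsupp.sum, sum_inner, inner_sum]
  rw [Finset.sum_comm]
  refine Finset.sum_congr rfl fun i _ => Finset.sum_congr rfl fun j _ => ?_
  simp only [RCLike.star_def, inner_smul_left, inner_smul_right]; ring

theorem norm_linearCombination_eq {u : ι → X} {w : ι → Y}
    (h : ∀ i j, inner ℂ (u i) (u j) = inner ℂ (w i) (w j)) (c : ι →₀ ℂ) :
    ‖Finsupp.linearCombination ℂ w c‖ = ‖Finsupp.linearCombination ℂ u c‖ := by
  have : (‖Finsupp.linearCombination ℂ w c‖ : ℂ) ^ 2 = ‖Finsupp.linearCombination ℂ u c‖ ^ 2 := by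
    have h1 := inner_self_eq_norm_sq_to_K (𝕜 := ℂ) (Finsupp.linearCombination ℂ w c)
    have h2 := inner_self_eq_norm_sq_to_K (𝕜 := ℂ) (Finsupp.linearCombination ℂ u c)
    rw [inner_linearCombination] at h1 h2
    simp only [h] at h2
    exact h1.symm.trans h2
  have h3 : ‖Finsupp.linearCombination ℂ w c‖ ^ 2 = ‖Finsupp.linearCombination ℂ u c‖ ^ 2 := by
    exact_mod_cast this
  exact (pow_left_inj₀ (norm_nonneg _) (norm_nonneg _) two_ne_zero).1 h3

/-- Equal Gram matrices give equal norms of all linear combinations, hence contractions in both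
directions. They are mutually inverse on total families, and mutually inverse contractions are
isometries. -/
theorem exists_isometryEquiv_of_inner {u : ι → X} (hu : IsTotal u) {w : ι → Y} (hw : IsTotal w)
    (h : ∀ i j, inner ℂ (u i) (u j) = inner ℂ (w i) (w j)) :
    ∃ V : X ≃ₗᵢ[ℂ] Y, ∀ i, V (u i) = w i := by
  obtain ⟨T, hT, hTu⟩ := exists_contraction_of_norm_le hu w fun c =>
    (norm_linearCombination_eq h c).le
  obtain ⟨R, hR, hRw⟩ := exists_contraction_of_norm_le hw u fun c =>
    (norm_linearCombination_eq (fun i j => (h i j).symm) c).le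
  have hRT : ∀ x, R (T x) = x := by
    have : R.comp T = ContinuousLinearMap.id ℂ X := hu.ext_clm fun i => by simp [hTu, hRw]
    exact fun x => DFunLike.congr_fun this x
  have hTR : ∀ y, T (R y) = y := by
    have : T.comp R = ContinuousLinearMap.id ℂ Y := hw.ext_clm fun i => by simp [hTu, hRw]
    exact fun y => DFunLike.congr_fun this y
  refine ⟨⟨LinearEquiv.ofLinearMap T.toLinearMap R.toLinearMap (LinearMap.ext hTR)
    (LinearMap.ext hRT), fun x => le_antisymm ?_ ?_⟩, hTu⟩
  · simpa using T.le_of_opNorm_le hT x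
  · have := R.le_of_opNorm_le hR (T x)
    rw [hRT] at this
    simpa using this

theorem inner_self_eq_ofReal (x : X) : inner ℂ x x = ((‖x‖ ^ 2 : ℝ) : ℂ) := by
  rw [inner_self_eq_norm_sq_to_K]
  simp

theorem posSemidef_gram_of_family (u : ι → X) : (Matrix.gram ℂ u).PosSemidef := by
  refine ⟨Matrix.isHermitian_gram ℂ _, fun c => ?_⟩
  have := inner_linearCombination u c
  simp only [Matrix.gram_apply]
  rw [← this, inner_self_eq_ofReal]
  rw [Complex.zero_le_real]
  positivity

theorem posSemidef_hadamard {A B : Matrix ι ι ℂ} (hA : A.PosSemidef) (hB : B.PosSemidef) :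
    (A.hadamard B).PosSemidef :=
  hA.hadamard hB

/-- Telescoping with Hadamard products: `Gⁿ⁺¹ - Mⁿ⁺¹ = Gⁿ ∘ (G - M) + (Gⁿ - Mⁿ) ∘ M`, where each
product is positive by the Schur product theorem. -/
theorem posSemidef_pow_sub_pow {G M : Matrix ι ι ℂ} (hM : M.PosSemidef)
    (hGM : (G - M).PosSemidef) (n : ℕ) :
    (Matrix.of fun i j => M i j ^ n).PosSemidef ∧
      (Matrix.of fun i j => G i j ^ n - M i j ^ n).PosSemidef := by
  have hG : G.PosSemidef := by simpa using hGM.add hM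
  have hGn : ∀ n, (Matrix.of fun i j => G i j ^ n).PosSemidef ∧
      (Matrix.of fun i j => M i j ^ n).PosSemidef := by
    intro n
    induction n with
    | zero =>
      have h1 : (Matrix.of fun _ _ : ι => (1 : ℂ)).PosSemidef := by
        have := posSemidef_gram_of_family (fun _ : ι => (1 : ℂ))
        have e : Matrix.gram ℂ (fun _ : ι => (1 : ℂ)) = Matrix.of fun _ _ : ι => (1 : ℂ) := by
          ext i j
          simp [Matrix.gram_apply]
        rwa [e] at this
      simp only [pow_zero]
      exact ⟨h1, h1⟩
    | succ n ih => exact ⟨posSemidef_hadamard ih.1 hG, posSemidef_hadamard ih.2 hM⟩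
  refine ⟨(hGn n).2, ?_⟩
  induction n with
  | zero =>
    have e : (Matrix.of fun i j => G i j ^ 0 - M i j ^ 0) = 0 := by
      ext i j
      simp
    rw [e]
    exact Matrix.PosSemidef.zero
  | succ n ih =>
    have e : (Matrix.of fun i j => G i j ^ (n + 1) - M i j ^ (n + 1)) =
        (Matrix.of fun i j => G i j ^ n).hadamard (G - M) +
          (Matrix.of fun i j => G i j ^ n - M i j ^ n).hadamard M := by
      ext i j
      simp only [Matrix.of_apply, Matrix.add_apply, Matrix.hadamard_apply, Matrix.sub_apply]
      ring
    rw [e]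
    exact (posSemidef_hadamard (hGn n).1 hGM).add (posSemidef_hadamard ih hM)

/-- The exponential series has nonnegative coefficients, so the inequality for entrywise powers sums
up. -/
theorem sum_exp_le_sum_exp {G M : Matrix ι ι ℂ} (hM : M.PosSemidef)
    (hGM : (G - M).PosSemidef) (c : ι →₀ ℂ) :
    0 ≤ c.sum fun i ci => c.sum fun j cj =>
      star ci * (Complex.exp (G i j) - Complex.exp (M i j)) * cj := by
  have hs : HasSum (fun n : ℕ => ((n.factorial : ℝ)⁻¹ : ℂ) * c.sum fun i ci => c.sum fun j cj =>
      star ci * (G i j ^ n - M i j ^ n) * cj)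
      (c.sum fun i ci => c.sum fun j cj =>
        star ci * (Complex.exp (G i j) - Complex.exp (M i j)) * cj) := by
    simp only [Finsupp.sum, Finset.mul_sum]
    refine hasSum_sum fun i _ => hasSum_sum fun j _ => ?_
    have he : ∀ w : ℂ, HasSum (fun n : ℕ => w ^ n / n.factorial) (Complex.exp w) := fun w => by
      rw [Complex.exp_eq_exp_ℂ]
      exact NormedSpace.expSeries_div_hasSum_exp w
    refine ((((he (G i j)).sub (he (M i j))).mul_left (star (c i))).mul_right (c j)).congr_fun ?_
    intro n
    push_cast
    ring
  refine hs.nonneg fun n => ?_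
  refine mul_nonneg (by exact_mod_cast (by positivity : (0 : ℝ) ≤ (n.factorial : ℝ)⁻¹)) ?_
  exact (posSemidef_pow_sub_pow hM hGM n).2.2 c

/-- A contraction induces a contraction on vectors with inner products `exp ⟨f, g⟩`. -/
theorem exists_contraction_exp {H : Type*} [NormedAddCommGroup H] [InnerProductSpace ℂ H]
    [CompleteSpace H] {u : H → X} (hu : IsTotal u)
    (h : ∀ f g, inner ℂ (u f) (u g) = Complex.exp (inner ℂ f g)) (T : H →L[ℂ] H) (hT : ‖T‖ ≤ 1) :
    ∃ U : X →L[ℂ] X, ‖U‖ ≤ 1 ∧ ∀ f, U (u f) = u (T f) := by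
  refine exists_contraction_of_norm_le hu (fun f => u (T f)) fun c => ?_
  have hM : (Matrix.gram ℂ (fun f : H => T f)).PosSemidef := posSemidef_gram_of_family _
  -- For `v = ∑ c_f f` the quadratic form of this difference is `‖v‖² - ‖T v‖²`.
  have hGM : (Matrix.gram ℂ (fun f : H => f) - Matrix.gram ℂ (fun f : H => T f)).PosSemidef := by
    refine ⟨(Matrix.isHermitian_gram ℂ _).sub (Matrix.isHermitian_gram ℂ _), fun c => ?_⟩
    have e : (c.sum fun i ci => c.sum fun j cj => star ci *
        (Matrix.gram ℂ (fun f : H => f) - Matrix.gram ℂ (fun f : H => T f)) i j * cj) =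
        inner ℂ (Finsupp.linearCombination ℂ (fun f : H => f) c)
          (Finsupp.linearCombination ℂ (fun f : H => f) c) -
        inner ℂ (Finsupp.linearCombination ℂ (fun f : H => T f) c)
          (Finsupp.linearCombination ℂ (fun f : H => T f) c) := by
      rw [inner_linearCombination, inner_linearCombination]
      simp only [Finsupp.sum, ← Finset.sum_sub_distrib, Matrix.sub_apply, Matrix.gram_apply]
      refine Finset.sum_congr rfl fun i _ => Finset.sum_congr rfl fun j _ => ?_
      ring
    have e2 : Finsupp.linearCombination ℂ (fun f : H => T f) c =
        T (Finsupp.linearCombination ℂ (fun f : H => f) c) := by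
      simp [Finsupp.linearCombination_apply, Finsupp.sum]
    rw [e, e2, inner_self_eq_ofReal, inner_self_eq_ofReal]
    have h3 := T.le_of_opNorm_le hT (Finsupp.linearCombination ℂ (fun f : H => f) c)
    rw [one_mul] at h3
    have h4 := pow_le_pow_left₀ (norm_nonneg _) h3 2
    have h5 := sub_nonneg.2 h4
    rw [← Complex.ofReal_sub,
      Complex.zero_le_real]
    exact h5
  have key := sum_exp_le_sum_exp hM hGM c
  have e : (c.sum fun i ci => c.sum fun j cj => star ci *
      (Complex.exp (Matrix.gram ℂ (fun f : H => f) i j) -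
        Complex.exp (Matrix.gram ℂ (fun f : H => T f) i j)) * cj) =
      inner ℂ (Finsupp.linearCombination ℂ u c) (Finsupp.linearCombination ℂ u c) -
      inner ℂ (Finsupp.linearCombination ℂ (fun f => u (T f)) c)
        (Finsupp.linearCombination ℂ (fun f => u (T f)) c) := by
    rw [inner_linearCombination, inner_linearCombination]
    simp only [Finsupp.sum, ← Finset.sum_sub_distrib, Matrix.gram_apply, h]
    refine Finset.sum_congr rfl fun i _ => Finset.sum_congr rfl fun j _ => ?_
    ring
  rw [e, inner_self_eq_ofReal, inner_self_eq_ofReal] at key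
  rw [← Complex.ofReal_sub,
    Complex.zero_le_real] at key
  have key' : (0 : ℝ) ≤ ‖Finsupp.linearCombination ℂ u c‖ ^ 2 -
      ‖Finsupp.linearCombination ℂ (fun f => u (T f)) c‖ ^ 2 := key
  exact le_of_sq_le_sq (by linarith) (norm_nonneg _)

end TotalFamily

/-! ### Uniqueness of power series -/

/-- This separates the degrees: an identity between exponential vectors of `s f`, valid for all `s`,
holds level by level. -/
theorem coeff_eq_of_hasSum {X : Type*} [NormedAddCommGroup X] [NormedSpace ℂ X] {v w : ℕ → X}
    {f : ℂ → X} (hv : ∀ s : ℂ, HasSum (fun n => s ^ n • v n) (f s))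
    (hw : ∀ s : ℂ, HasSum (fun n => s ^ n • w n) (f s)) (n : ℕ) : v n = w n := by
  let p : (ℕ → X) → FormalMultilinearSeries ℂ ℂ X := fun v n =>
    ContinuousMultilinearMap.mkPiRing ℂ (Fin n) (v n)
  have hp : ∀ v n, (p v).coeff n = v n := fun v n => by
    simp [p, FormalMultilinearSeries.coeff]
  have h : ∀ v, (∀ s : ℂ, HasSum (fun n => s ^ n • v n) (f s)) → HasFPowerSeriesAt f (p v) 0 := by
    intro v hv
    rw [hasFPowerSeriesAt_iff]
    refine Eventually.of_forall fun s => ?_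
    simpa [hp] using hv s
  have := (h v hv).eq_formalMultilinearSeries (h w hw)
  rw [← hp v n, ← hp w n, this]

end FreeKawasaki

namespace FreeKawasaki

/-! ### Generators of contraction semigroups on Hilbert spaces -/

section Semigroup

variable {X : Type*} [NormedAddCommGroup X] [InnerProductSpace ℂ X] [CompleteSpace X]
  {S : ℝ → X →L[ℂ] X}

/-- The graph of the generator of a semigroup. -/
def generatorGraph (S : ℝ → X →L[ℂ] X) : Submodule ℂ (X × X) where
  carrier := {p | Tendsto (fun t : ℝ => ((t⁻¹ : ℝ) : ℂ) • (S t p.1 - p.1)) (𝓝[>] 0) (𝓝 p.2)}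
  zero_mem' := by simp
  add_mem' {p q} hp hq := by
    refine (Tendsto.add hp hq).congr fun t => ?_
    simp only [Prod.fst_add, map_add]
    module
  smul_mem' c p hp := by
    refine (Tendsto.const_smul hp c).congr fun t => ?_
    simp only [Prod.smul_fst, map_smul]
    module

theorem mem_generatorGraph {p : X × X} : p ∈ generatorGraph S ↔
    Tendsto (fun t : ℝ => ((t⁻¹ : ℝ) : ℂ) • (S t p.1 - p.1)) (𝓝[>] 0) (𝓝 p.2) := Iff.rfl

theorem generatorGraph_snd_eq {f g h : X} (hg : (f, g) ∈ generatorGraph S)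
    (hh : (f, h) ∈ generatorGraph S) : g = h :=
  tendsto_nhds_unique hg hh

namespace IsContractionSemigroup

variable (hS : IsContractionSemigroup S)
include hS

theorem norm_apply_le {t : ℝ} (ht : 0 ≤ t) (f : X) : ‖S t f‖ ≤ ‖f‖ := by
  simpa using (S t).le_of_opNorm_le (hS.contraction t ht) f

theorem intervalIntegrable (f : X) {t : ℝ} (ht : 0 ≤ t) :
    IntervalIntegrable (fun r => S r f) volume 0 t := by
  refine ContinuousOn.intervalIntegrable ((hS.continuous f).mono ?_)
  rw [uIcc_of_le ht]
  exact fun x hx => hx.1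

theorem mem_graph_apply {f g : X} (h : (f, g) ∈ generatorGraph S) {t : ℝ} (ht : 0 ≤ t) :
    (S t f, S t g) ∈ generatorGraph S := by
  rw [mem_generatorGraph] at h ⊢
  refine (((S t).continuous.tendsto g).comp h).congr' ?_
  filter_upwards [self_mem_nhdsWithin] with r hr
  have e : S t (S r f) = S r (S t f) := by
    have h1 := DFunLike.congr_fun (hS.add t r ht (le_of_lt hr)) f
    have h2 := DFunLike.congr_fun (hS.add r t (le_of_lt hr) ht) f
    rw [add_comm] at h1
    exact h1.symm.trans h2
  simp [e]

theorem hasDerivWithinAt {f g : X} (h : (f, g) ∈ generatorGraph S) {t : ℝ} (ht : 0 ≤ t) :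
    HasDerivWithinAt (fun r => S r f) (S t g) (Ioi t) t := by
  rw [hasDerivWithinAt_iff_tendsto_slope' (by simp)]
  have h1 := mem_generatorGraph.1 (hS.mem_graph_apply h ht)
  have h2 : Tendsto (fun r : ℝ => r - t) (𝓝[>] t) (𝓝[>] 0) := by
    refine tendsto_nhdsWithin_iff.2 ⟨?_, ?_⟩
    · have : Tendsto (fun r : ℝ => r - t) (𝓝 t) (𝓝 (t - t)) := by
        exact (continuous_id.sub continuous_const).tendsto t
      rw [sub_self] at this
      exact this.mono_left nhdsWithin_le_nhds
    · filter_upwards [self_mem_nhdsWithin] with r hr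
      exact sub_pos.2 (mem_Ioi.1 hr)
  refine (h1.comp h2).congr' ?_
  filter_upwards [self_mem_nhdsWithin] with r hr
  have h3 := DFunLike.congr_fun (hS.add (r - t) t (sub_nonneg.2 (le_of_lt hr)) ht) f
  rw [sub_add_cancel] at h3
  simp only [Function.comp_apply, slope, vsub_eq_sub, h3, ContinuousLinearMap.comp_apply]
  exact Complex.coe_smul _ _

/-- Only right derivatives of orbits are at hand, and the fundamental theorem of calculus needs no
more. With its converse below, this turns membership in the generator into an integral equation. -/
theorem apply_sub_eq_integral {f g : X} (h : (f, g) ∈ generatorGraph S) {t : ℝ} (ht : 0 ≤ t) :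
    S t f - f = ∫ r in (0 : ℝ)..t, S r g := by
  rw [intervalIntegral.integral_eq_sub_of_hasDeriv_right_of_le ht
    ((hS.continuous f).mono fun x hx => hx.1)
    (fun x hx => hS.hasDerivWithinAt h hx.1.le) (hS.intervalIntegrable g ht), hS.zero]
  simp

theorem mem_graph_of_integral {f g : X}
    (h : ∀ t, 0 ≤ t → S t f - f = ∫ r in (0 : ℝ)..t, S r g) : (f, g) ∈ generatorGraph S := by
  have h1 : HasDerivWithinAt (fun t => ∫ r in (0 : ℝ)..t, S r g) (S 0 g) (Ici 0) 0 := by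
    have hc : ContinuousOn (fun r => S r g) (Icc 0 1) :=
      (hS.continuous g).mono fun x hx => hx.1
    refine intervalIntegral.integral_hasDerivWithinAt_right (s := Ici 0) (t := Ioi 0)
      (by simp) ?_ ?_
    · refine ⟨Ioc 0 1, Ioc_mem_nhdsGT one_pos, ?_⟩
      exact (hc.mono Ioc_subset_Icc_self).aestronglyMeasurable measurableSet_Ioc
    · exact ((hS.continuous g) 0 (mem_Ici.2 le_rfl)).mono Ioi_subset_Ici_self
  replace h1 := h1.Ioi_of_Ici
  rw [hasDerivWithinAt_iff_tendsto_slope' (by simp), hS.zero] at h1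
  rw [mem_generatorGraph]
  refine h1.congr' ?_
  filter_upwards [self_mem_nhdsWithin] with r hr
  simp only [slope, vsub_eq_sub, intervalIntegral.integral_same, sub_zero, h r (le_of_lt hr)]
  exact (Complex.coe_smul _ _).symm

/-- For each `t` the integral equation is a closed condition on `(f, g)`, because `g ↦ ∫₀ᵗ S_r g dr`
is Lipschitz with constant `t`. -/
theorem isClosed_graph : IsClosed (generatorGraph S : Set (X × X)) := by
  have e : (generatorGraph S : Set (X × X)) =
      ⋂ t : {t : ℝ // 0 ≤ t}, {p | S t p.1 - p.1 = ∫ r in (0 : ℝ)..t, S r p.2} := by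
    ext ⟨f, g⟩
    simp only [SetLike.mem_coe, mem_iInter, mem_ofPred_eq, Subtype.forall]
    exact ⟨fun h t ht => hS.apply_sub_eq_integral h ht, hS.mem_graph_of_integral⟩
  rw [e]
  refine isClosed_iInter fun t => isClosed_eq (by fun_prop) ?_
  suffices h : Continuous fun g : X => ∫ r in (0 : ℝ)..t, S r g from h.comp continuous_snd
  have hl : LipschitzWith ⟨t, t.2⟩ fun g : X => ∫ r in (0 : ℝ)..t, S r g := by
    refine LipschitzWith.of_dist_le_mul fun g h => ?_
    rw [dist_eq_norm, dist_eq_norm, ← intervalIntegral.integral_sub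
      (hS.intervalIntegrable g t.2) (hS.intervalIntegrable h t.2)]
    refine (intervalIntegral.norm_integral_le_of_norm_le_const (C := ‖g - h‖) ?_).trans ?_
    · intro r hr
      rw [uIoc_of_le t.2] at hr
      rw [← map_sub]
      exact hS.norm_apply_le hr.1.le _
    · rw [sub_zero, abs_of_nonneg t.2, mul_comm]
      rfl
  exact hl.continuous

/-- Integrating the scalar right derivatives yields the integral equation tested against a total
family, hence the integral equation itself. Thus membership in the domain needs only inner products
with exponential vectors. -/
theorem mem_graph_of_weak {ι : Type*} {v : ι → X} (hv : IsTotal v) {F H : X}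
    (h : ∀ i t, 0 ≤ t → HasDerivWithinAt (fun r => inner ℂ (v i) (S r F))
      (inner ℂ (v i) (S t H)) (Ioi t) t) : (F, H) ∈ generatorGraph S := by
  refine hS.mem_graph_of_integral fun t ht => hv.ext_inner fun i => ?_
  have hc : ∀ F : X, ContinuousOn (fun r => inner ℂ (v i) (S r F)) (Ici 0) := fun F =>
    ContinuousOn.inner continuousOn_const (hS.continuous F)
  have h1 := intervalIntegral.integral_eq_sub_of_hasDeriv_right_of_le ht
    ((hc F).mono fun x hx => hx.1) (fun x hx => h i x hx.1.le)
    (ContinuousOn.intervalIntegrable ((hc H).mono (by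
      rw [uIcc_of_le ht]; exact fun x hx => hx.1)))
  have h2 := (innerSL ℂ (v i)).intervalIntegral_comp_comm (hS.intervalIntegrable H ht)
  simp only [innerSL_apply_apply] at h2
  rw [inner_sub_right, ← h2, h1, hS.zero]
  simp

/-- Dissipativity: contractivity gives `Re ⟨f, S_t f - f⟩ ≤ 0`, so `Re ⟨f, g⟩ ≤ 0` in the limit;
then Cauchy–Schwarz is applied to `⟨f, f - g⟩`. -/
theorem norm_le_norm_sub {f g : X} (h : (f, g) ∈ generatorGraph S) : ‖f‖ ≤ ‖f - g‖ := by
  have h1 : (inner ℂ f g).re ≤ 0 := by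
    have h2 : Tendsto (fun t : ℝ => (inner ℂ f (((t⁻¹ : ℝ) : ℂ) • (S t f - f))).re) (𝓝[>] 0)
        (𝓝 (inner ℂ f g).re) :=
      (Complex.continuous_re.tendsto _).comp
        (((continuous_const.inner continuous_id).tendsto g).comp (mem_generatorGraph.1 h))
    refine le_of_tendsto h2 ?_
    filter_upwards [self_mem_nhdsWithin] with t ht
    rw [inner_smul_right, Complex.re_ofReal_mul, inner_sub_right]
    refine mul_nonpos_of_nonneg_of_nonpos (inv_nonneg.2 (le_of_lt ht)) ?_
    rw [Complex.sub_re, inner_self_eq_ofReal, Complex.ofReal_re]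
    have h3 : (inner ℂ f (S t f)).re ≤ ‖f‖ * ‖S t f‖ := re_inner_le_norm (𝕜 := ℂ) _ _
    nlinarith [hS.norm_apply_le (le_of_lt ht) f, norm_nonneg f]
  have h2 : ‖f‖ ^ 2 ≤ ‖f‖ * ‖f - g‖ := by
    have h3 : (inner ℂ f (f - g)).re ≤ ‖f‖ * ‖f - g‖ := re_inner_le_norm (𝕜 := ℂ) _ _
    rw [inner_sub_right, Complex.sub_re, inner_self_eq_ofReal, Complex.ofReal_re] at h3
    linarith
  rcases (norm_nonneg f).eq_or_lt with h3 | h3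
  · rw [← h3]; exact norm_nonneg _
  · nlinarith

/-- A dense invariant subspace of the domain is a core. -/
theorem mem_closure_of_core {D : Submodule ℂ X} (hD : Dense (D : Set X))
    (hDS : ∀ t, 0 ≤ t → ∀ u ∈ D, S t u ∈ D) (hDB : ∀ u ∈ D, ∃ g, (u, g) ∈ generatorGraph S)
    {p : X × X} (hp : p ∈ generatorGraph S) :
    p ∈ closure {q : X × X | q ∈ generatorGraph S ∧ q.1 ∈ D} := by
  set G : Submodule ℂ (X × X) := generatorGraph S ⊓ D.comap (LinearMap.fst ℂ X X) with hG
  -- The range of `1 - B` on `D` is dense: if `h` is orthogonal to it, then `e^{-t} ⟨h, S_t u⟩` is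
  -- constant in `t` for `u ∈ D`. It also tends to `0`, so `h` is orthogonal to `D`.
  have hR : Dense ((G.map (LinearMap.fst ℂ X X - LinearMap.snd ℂ X X) : Submodule ℂ X) : Set X) := by
    rw [Submodule.dense_iff_topologicalClosure_eq_top, Submodule.topologicalClosure_eq_top_iff,
      Submodule.eq_bot_iff]
    intro h hh
    refine hD.eq_zero_of_inner_left (𝕜 := ℂ) fun u hu => ?_
    have hh' : ∀ u g, u ∈ D → (u, g) ∈ generatorGraph S → inner ℂ h u = inner ℂ h g := by
      intro u g hu hg
      have := (Submodule.mem_orthogonal' _ _).1 hh (u - g) ⟨(u, g), ⟨hg, hu⟩, rfl⟩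
      rwa [inner_sub_right, sub_eq_zero] at this
    obtain ⟨g, hg⟩ := hDB u hu
    have hd : ∀ t, 0 ≤ t → HasDerivWithinAt (fun r : ℝ => Complex.exp (-r) * inner ℂ h (S r u)) 0
        (Ioi t) t := by
      intro t ht
      have h1 : HasDerivWithinAt (fun r => inner ℂ h (S r u)) (inner ℂ h (S t g)) (Ioi t) t := by
        have := (hS.hasDerivWithinAt hg ht)
        have h2 := (((innerSL ℂ h).restrictScalars ℝ).hasFDerivAt
          (x := S t u)).comp_hasDerivWithinAt t this
        simpa [Function.comp_def] using h2
      have h2 : HasDerivAt (fun r : ℝ => Complex.exp (-r)) (-Complex.exp (-t)) t := by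
        have := ((Complex.ofRealCLM.hasDerivAt (x := t)).neg).cexp
        simpa using this
      refine (h2.hasDerivWithinAt.mul h1).congr_deriv ?_
      rw [← hh' _ _ (hDS t ht u hu) (hS.mem_graph_apply hg ht)]
      ring
    have hbound : ∀ t : ℝ, 0 ≤ t → ‖inner ℂ h u‖ ≤ Real.exp (-t) * (‖h‖ * ‖u‖) := by
      intro t ht
      have hcont : ContinuousOn (fun r : ℝ => Complex.exp (-r) * inner ℂ h (S r u)) (Icc 0 t) := by
        refine ContinuousOn.mul (by fun_prop) (ContinuousOn.inner continuousOn_const ?_)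
        exact (hS.continuous u).mono fun x hx => hx.1
      have h1 := constant_of_has_deriv_right_zero hcont
        (fun x hx => (hd x hx.1).Ici_of_Ioi) t (right_mem_Icc.2 ht)
      have h2 : inner ℂ h u = Complex.exp (-t) * inner ℂ h (S t u) := by
        simpa [hS.zero] using h1.symm
      rw [h2, norm_mul, Complex.norm_exp]
      simp only [Complex.neg_re, Complex.ofReal_re]
      gcongr
      exact (norm_inner_le_norm _ _).trans (by gcongr; exact hS.norm_apply_le ht u)
    have hlim : Tendsto (fun t : ℝ => Real.exp (-t) * (‖h‖ * ‖u‖)) atTop (𝓝 0) := by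
      simpa using (Real.tendsto_exp_neg_atTop_nhds_zero).mul_const (‖h‖ * ‖u‖)
    have h3 : ‖inner ℂ h u‖ ≤ 0 :=
      ge_of_tendsto hlim (by filter_upwards [eventually_ge_atTop 0] with t ht using hbound t ht)
    exact norm_le_zero_iff.1 h3
  rw [Metric.mem_closure_iff]
  intro ε hε
  obtain ⟨f, g⟩ := p
  -- Approximating `f - g` by `u - w` controls `f - u` by dissipativity, and then `g - w` by the
  -- triangle inequality.
  obtain ⟨_, ⟨⟨u, w⟩, ⟨huw, hu⟩, rfl⟩, hlt⟩ :=
    Metric.mem_closure_iff.1 (hR (f - g)) (ε / 2) (half_pos hε)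
  have h1 : ‖f - u‖ ≤ ‖(f - g) - (u - w)‖ := by
    have := hS.norm_le_norm_sub ((generatorGraph S).sub_mem hp huw)
    simpa only [Prod.fst_sub, Prod.snd_sub, sub_sub_sub_comm] using this
  simp only [LinearMap.sub_apply, LinearMap.fst_apply, LinearMap.snd_apply, dist_eq_norm] at hlt
  have h2 : ‖g - w‖ ≤ ‖f - u‖ + ‖(f - g) - (u - w)‖ := by
    have : g - w = (f - u) - ((f - g) - (u - w)) := by abel
    rw [this]
    exact norm_sub_le _ _
  refine ⟨(u, w), ⟨huw, hu⟩, ?_⟩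
  rw [Prod.dist_eq, max_lt_iff, dist_eq_norm, dist_eq_norm]
  constructor <;> dsimp only <;> linarith

/-- If `P` is (half) the gradient of `‖P ·‖²` and the generator is dispersive with respect to `P` on
an invariant dense subspace, then `‖P ·‖` decreases along the semigroup. -/
theorem norm_comp_apply_le {D : Submodule ℂ X} (hD : Dense (D : Set X))
    (hDS : ∀ t, 0 ≤ t → ∀ u ∈ D, S t u ∈ D) (hDB : ∀ u ∈ D, ∃ g, (u, g) ∈ generatorGraph S)
    {P : X → X} (hP : Continuous P)
    (hconv : ∀ u v, ‖P u‖ ^ 2 - ‖P v‖ ^ 2 ≤ 2 * (inner ℂ (P u) (u - v)).re)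
    (hdisp : ∀ u g, u ∈ D → (u, g) ∈ generatorGraph S → (inner ℂ (P u) g).re ≤ 0)
    {t : ℝ} (ht : 0 ≤ t) (u : X) : ‖P (S t u)‖ ≤ ‖P u‖ := by
  suffices h : ∀ u ∈ D, ‖P (S t u)‖ ≤ ‖P u‖ by
    have hcl : IsClosed {u : X | ‖P (S t u)‖ ≤ ‖P u‖} :=
      isClosed_le (by fun_prop) (by fun_prop)
    exact hcl.closure_subset_iff.2 h (hD u)
  intro u hu
  obtain ⟨g, hg⟩ := hDB u hu
  have hcont : ContinuousOn (fun r => ‖P (S r u)‖ ^ 2) (Icc 0 t) := by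
    have h1 : ContinuousOn (fun r => S r u) (Icc 0 t) := (hS.continuous u).mono fun x hx => hx.1
    exact (hP.comp_continuousOn h1).norm.pow 2
  -- `P` need not be differentiable: `hconv` bounds the difference quotients of `‖P (S_r u)‖²` by `2
  -- Re ⟨P (S_z u), slope⟩`, whose limit is nonpositive by `hdisp`.
  have key := image_le_of_liminf_slope_right_le_deriv_boundary hcont
    (B := fun _ => ‖P u‖ ^ 2) (B' := fun _ => 0) (by simp [hS.zero]) continuousOn_const
    (fun x _ => hasDerivWithinAt_const _ _ _) (fun x hx r hr => ?_) (right_mem_Icc.2 ht)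
  · exact (pow_le_pow_iff_left₀ (norm_nonneg _) (norm_nonneg _) two_ne_zero).1 key
  · have hSx := hS.mem_graph_apply hg hx.1
    have h1 : Tendsto (fun z => 2 * (inner ℂ (P (S z u)) (slope (fun r => S r u) x z)).re) (𝓝[>] x)
        (𝓝 (2 * (inner ℂ (P (S x u)) (S x g)).re)) := by
      have h2 := hS.hasDerivWithinAt hg hx.1
      rw [hasDerivWithinAt_iff_tendsto_slope' (by simp)] at h2
      have h3 : Tendsto (fun z => P (S z u)) (𝓝[>] x) (𝓝 (P (S x u))) :=
        (hP.tendsto _).comp (((hS.continuous u) x hx.1).mono_left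
          (nhdsWithin_mono _ fun y hy => hx.1.trans (le_of_lt hy)))
      exact ((Complex.continuous_re.tendsto _).comp (h3.inner h2)).const_mul 2
    have h4 : 2 * (inner ℂ (P (S x u)) (S x g)).re < r :=
      lt_of_le_of_lt (by linarith [hdisp _ _ (hDS x hx.1 u hu) hSx]) hr
    refine Eventually.frequently ?_
    filter_upwards [h1.eventually (gt_mem_nhds h4), self_mem_nhdsWithin] with z hz hzx
    refine lt_of_le_of_lt ?_ hz
    have hpos : 0 < z - x := sub_pos.2 hzx
    rw [slope_def_field, div_le_iff₀ hpos]
    refine (hconv _ _).trans (le_of_eq ?_)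
    have e : slope (fun r => S r u) x z = (((z - x)⁻¹ : ℝ) : ℂ) • (S z u - S x u) := by
      rw [slope, vsub_eq_sub]
      exact (Complex.coe_smul _ _).symm
    rw [e, inner_smul_right, Complex.re_ofReal_mul]
    field_simp

end IsContractionSemigroup

end Semigroup

end FreeKawasaki

namespace FreeKawasaki

/-! ### Exponential vectors and second quantization -/

/-- `‖u f - u g‖²` is a combination of exponentials of inner products, continuous in `f` and zero at
`f = g`. -/
theorem continuous_of_inner_eq_exp {H X : Type*} [NormedAddCommGroup H] [InnerProductSpace ℂ H]
    [NormedAddCommGroup X] [InnerProductSpace ℂ X] {u : H → X}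
    (h : ∀ f g, inner ℂ (u f) (u g) = Complex.exp (inner ℂ f g)) : Continuous u := by
  refine continuous_iff_continuousAt.2 fun g => ?_
  rw [ContinuousAt, tendsto_iff_norm_sub_tendsto_zero]
  have e : ∀ f, ‖u f - u g‖ ^ 2 = (Complex.exp (inner ℂ f f) - Complex.exp (inner ℂ f g)
      - Complex.exp (inner ℂ g f) + Complex.exp (inner ℂ g g)).re := by
    intro f
    have h1 := inner_self_eq_norm_sq_to_K (𝕜 := ℂ) (u f - u g)
    have h2 : inner ℂ (u f - u g) (u f - u g) = Complex.exp (inner ℂ f f)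
        - Complex.exp (inner ℂ f g) - Complex.exp (inner ℂ g f) + Complex.exp (inner ℂ g g) := by
      simp only [inner_sub_left, inner_sub_right, h]
      ring
    rw [← h2, h1]
    norm_cast
  have hc : Continuous fun f : H => (Complex.exp (inner ℂ f f) - Complex.exp (inner ℂ f g)
      - Complex.exp (inner ℂ g f) + Complex.exp (inner ℂ g g)).re := by fun_prop
  have h0 : Tendsto (fun f => ‖u f - u g‖ ^ 2) (𝓝 g) (𝓝 0) := by
    simp only [e]
    have := hc.tendsto g
    simpa using this
  have h1 := (Real.continuous_sqrt.tendsto 0).comp h0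
  simpa [Function.comp_def, Real.sqrt_sq (norm_nonneg _)] using h1

/-- Inclusion–exclusion for the permanent: expanding the product for `T` gives a sum over maps whose
image avoids `T`. The alternating sum over `T` keeps only the surjective maps, which are the
permutations. -/
theorem sum_perm_prod_eq {n : ℕ} (M : Fin n → Fin n → ℂ) :
    ∑ σ : Equiv.Perm (Fin n), ∏ i, M (σ i) i =
      ∑ T : Finset (Fin n), (-1) ^ T.card * ∏ i, ∑ j ∈ Tᶜ, M j i := by
  have h1 : ∀ T : Finset (Fin n), (-1 : ℂ) ^ T.card * ∏ i, ∑ j ∈ Tᶜ, M j i =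
      ∑ g : Fin n → Fin n, if T ⊆ (Finset.univ.image g)ᶜ then
        (-1) ^ T.card * ∏ i, M (g i) i else 0 := by
    intro T
    rw [Finset.prod_univ_sum, Finset.mul_sum, ← Finset.sum_filter]
    refine Finset.sum_congr ?_ fun _ _ => rfl
    ext g
    simp only [Fintype.mem_piFinset, Finset.mem_compl, Finset.mem_filter, Finset.mem_univ,
      true_and, Finset.subset_iff, Finset.mem_image, not_exists]
    constructor
    · rintro h x hx i rfl
      exact h i hx
    · intro h i hi
      exact h hi i rfl
  simp only [h1]
  rw [Finset.sum_comm]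
  have h2 : ∀ g : Fin n → Fin n, (∑ T : Finset (Fin n), if T ⊆ (Finset.univ.image g)ᶜ then
      (-1 : ℂ) ^ T.card * ∏ i, M (g i) i else 0) =
      if (Finset.univ.image g)ᶜ = ∅ then ∏ i, M (g i) i else 0 := by
    intro g
    rw [← Finset.sum_filter, ← Finset.sum_mul]
    have h3 := Finset.sum_powerset_neg_one_pow_card (x := (Finset.univ.image g)ᶜ)
    have h4 : (Finset.univ.filter fun T : Finset (Fin n) => T ⊆ (Finset.univ.image g)ᶜ) =
        ((Finset.univ.image g)ᶜ).powerset := by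
      ext T
      simp
    have h5 : ∑ T ∈ ((Finset.univ.image g)ᶜ).powerset, (-1 : ℂ) ^ T.card =
        if (Finset.univ.image g)ᶜ = ∅ then 1 else 0 := by
      exact_mod_cast congrArg (Int.cast : ℤ → ℂ) h3
    rw [h4, h5]
    split_ifs <;> simp
  simp only [h2]
  refine Finset.sum_of_injOn (fun σ : Equiv.Perm (Fin n) => (σ : Fin n → Fin n))
    (fun σ _ τ _ h => DFunLike.coe_injective h) (fun _ _ => Finset.mem_coe.2 (Finset.mem_univ _))
    ?_ ?_
  · intro g _ hg
    rw [if_neg]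
    intro h
    rw [Finset.compl_eq_empty_iff] at h
    have hs : Function.Surjective g := fun y => by
      have := Finset.mem_univ y
      rw [← h, Finset.mem_image] at this
      obtain ⟨x, _, hx⟩ := this
      exact ⟨x, hx⟩
    exact hg ⟨Equiv.ofBijective g (Finite.surjective_iff_bijective.1 hs), by simp, rfl⟩
  · intro σ _
    rw [if_pos]
    rw [Finset.compl_eq_empty_iff]
    exact Finset.image_univ_of_surjective σ.surjective

section Fock

variable {d : ℕ} {z : ℝ≥0}

instance (n : ℕ) : CompleteSpace (symPower d z n) := by
  unfold symPower
  infer_instance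

theorem ae_levelMeasure_of_ae_pi {n : ℕ} {p : (Fin n → E d) → Prop}
    (h : ∀ᵐ x ∂(Measure.pi fun _ : Fin n => intensity d z), p x) :
    ∀ᵐ x ∂(levelMeasure d z n), p x :=
  Measure.ae_smul_measure h _

theorem ae_pi_forall {n : ℕ} {p : E d → Prop} (h : ∀ᵐ x ∂(intensity d z), p x) :
    ∀ᵐ x ∂(levelMeasure d z n), ∀ i, p (x i) :=
  ae_levelMeasure_of_ae_pi (eventually_all.2 fun i =>
    (Measure.quasiMeasurePreserving_eval (fun _ : Fin n => intensity d z) i).ae h)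

theorem symTensorFun_const {n : ℕ} (f : OneParticle d z) (x : Fin n → E d) :
    symTensorFun (fun _ : Fin n => f) x = ∏ i, f (x i) := by
  simp only [symTensorFun, Finset.sum_const, Finset.card_univ, Fintype.card_perm, Fintype.card_fin,
    nsmul_eq_mul]
  rw [inv_mul_cancel_left₀]
  exact_mod_cast n.factorial_ne_zero

theorem symTensorLp_coe {n : ℕ} (f : Fin n → OneParticle d z) :
    symTensorLp f =ᵐ[levelMeasure d z n] symTensorFun f :=
  (memLp_symTensorFun f).coeFn_toLp

/-- The diagonal tensor `f ⊗ ⋯ ⊗ f`. -/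
def diagTensor (n : ℕ) (f : OneParticle d z) : symPower d z n := symTensor fun _ : Fin n => f

theorem diagTensor_coe (n : ℕ) (f : OneParticle d z) :
    ((diagTensor n f : symPower d z n) : Lp ℂ 2 (levelMeasure d z n)) =ᵐ[levelMeasure d z n]
      fun x => ∏ i, f (x i) := by
  filter_upwards [symTensorLp_coe fun _ : Fin n => f] with x hx
  exact hx.trans (symTensorFun_const f x)

theorem diagTensor_smul (n : ℕ) (c : ℂ) (f : OneParticle d z) :
    diagTensor n (c • f) = c ^ n • diagTensor n f := by
  refine Subtype.ext (Lp.ext ?_)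
  rw [Submodule.coe_smul]
  filter_upwards [diagTensor_coe n (c • f), diagTensor_coe n f,
    Lp.coeFn_smul (c ^ n) (diagTensor n f : symPower d z n).1,
    ae_pi_forall (Lp.coeFn_smul c f)] with x h1 h2 h3 h4
  rw [h1, h3, Pi.smul_apply, h2]
  simp [h4, Finset.prod_mul_distrib]

theorem inner_diagTensor (n : ℕ) (f g : OneParticle d z) :
    inner ℂ (diagTensor n f) (diagTensor n g) = (n.factorial : ℂ) * inner ℂ f g ^ n := by
  rw [Submodule.coe_inner, L2.inner_def]
  have h1 : ∫ x, inner ℂ (((diagTensor n f : symPower d z n) : Lp ℂ 2 (levelMeasure d z n)) x)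
      (((diagTensor n g : symPower d z n) : Lp ℂ 2 (levelMeasure d z n)) x) ∂(levelMeasure d z n) =
      ∫ x, ∏ i, inner ℂ (f (x i)) (g (x i)) ∂(levelMeasure d z n) := by
    refine integral_congr_ae ?_
    filter_upwards [diagTensor_coe n f, diagTensor_coe n g] with x hf hg
    simp only [hf, hg, RCLike.inner_apply, map_prod, Finset.prod_mul_distrib]
  rw [h1, levelMeasure, integral_smul_measure,
    integral_fintype_prod_eq_prod (𝕜 := ℂ) (fun _ : Fin n => fun x => inner ℂ (f x) (g x))]
  simp only [Finset.prod_const, Finset.card_univ, Fintype.card_fin, ENNReal.toReal_natCast,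
    L2.inner_def]
  rw [Complex.real_smul]
  push_cast
  rfl

theorem norm_diagTensor (n : ℕ) (f : OneParticle d z) :
    ‖diagTensor n f‖ ^ 2 = n.factorial * (‖f‖ ^ 2) ^ n := by
  have h := inner_diagTensor n f f
  rw [inner_self_eq_ofReal, inner_self_eq_ofReal] at h
  exact_mod_cast h

/-- Polarization. -/
theorem factorial_smul_symTensor {n : ℕ} (f : Fin n → OneParticle d z) :
    (n.factorial : ℂ) • symTensor f =
      ∑ T : Finset (Fin n), ((-1 : ℂ) ^ T.card) • diagTensor n (∑ j ∈ Tᶜ, f j) := by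
  refine Subtype.ext (Lp.ext ?_)
  rw [Submodule.coe_smul, Submodule.coe_sum]
  have h1 : ∀ᵐ x ∂(levelMeasure d z n), ∀ T : Finset (Fin n),
      (((-1 : ℂ) ^ T.card • diagTensor n (∑ j ∈ Tᶜ, f j) : symPower d z n) :
        Lp ℂ 2 (levelMeasure d z n)) x = (-1) ^ T.card * ∏ i, ∑ j ∈ Tᶜ, f j (x i) := by
    refine eventually_all.2 fun T => ?_
    rw [Submodule.coe_smul]
    have h2 : ∀ᵐ x ∂(intensity d z), (∑ j ∈ Tᶜ, f j : OneParticle d z) x = ∑ j ∈ Tᶜ, f j x := by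
      filter_upwards [Lp.coeFn_finsetSum Tᶜ f] with x hx
      rw [hx, Finset.sum_apply]
    filter_upwards [Lp.coeFn_smul ((-1 : ℂ) ^ T.card) (diagTensor n (∑ j ∈ Tᶜ, f j) :
      symPower d z n).1, diagTensor_coe n (∑ j ∈ Tᶜ, f j), ae_pi_forall h2] with x h3 h4 h5
    rw [h3, Pi.smul_apply, h4, smul_eq_mul]
    simp only [h5]
  filter_upwards [h1, symTensorLp_coe f, Lp.coeFn_smul (n.factorial : ℂ) (symTensorLp f),
    Lp.coeFn_finsetSum Finset.univ fun T : Finset (Fin n) =>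
      (((-1 : ℂ) ^ T.card • diagTensor n (∑ j ∈ Tᶜ, f j) : symPower d z n) :
        Lp ℂ 2 (levelMeasure d z n))] with x h1 h2 h3 h4
  rw [h4, Finset.sum_apply]
  simp only [h1]
  have e : ((symTensor f : symPower d z n) : Lp ℂ 2 (levelMeasure d z n)) = symTensorLp f := rfl
  rw [e, h3, Pi.smul_apply, h2, symTensorFun, smul_eq_mul, mul_inv_cancel_left₀
    (by exact_mod_cast n.factorial_ne_zero), sum_perm_prod_eq fun j i => f j (x i)]

theorem summable_norm_exponential (f : OneParticle d z) :
    Summable fun n : ℕ => ‖((n.factorial : ℂ)⁻¹) • diagTensor n f‖ ^ 2 := by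
  refine (NormedSpace.expSeries_div_summable (‖f‖ ^ 2 : ℝ)).congr fun n => ?_
  have h0 : (n.factorial : ℝ) ≠ 0 := by exact_mod_cast n.factorial_ne_zero
  rw [norm_smul, mul_pow, norm_diagTensor]
  simp only [norm_inv, Complex.norm_natCast]
  field_simp

/-- The exponential vector `∑ₙ f^{⊗ n} / n!` in Fock space. -/
def expVector (f : OneParticle d z) : Fock d z :=
  ⟨fun n => ((n.factorial : ℂ)⁻¹) • diagTensor n f, by
    refine memℓp_gen ?_
    simpa using summable_norm_exponential f⟩

theorem symPower_inner_smul_right {n : ℕ} (c : ℂ) (x y : symPower d z n) :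
    inner ℂ x (c • y) = c * inner ℂ x y := by
  have := inner_smul_right (𝕜 := ℂ) x y c
  exact this

theorem symPower_inner_smul_left {n : ℕ} (c : ℂ) (x y : symPower d z n) :
    inner ℂ (c • x) y = (starRingEnd ℂ) c * inner ℂ x y := by
  have := inner_smul_left (𝕜 := ℂ) x y c
  exact this

theorem inner_factorial_inv_smul_diagTensor (n : ℕ) (f g : OneParticle d z) :
    inner ℂ (((n.factorial : ℂ)⁻¹) • diagTensor n f) (((n.factorial : ℂ)⁻¹) • diagTensor n g) =
      inner ℂ f g ^ n / n.factorial := by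
  have h0 : (n.factorial : ℂ) ≠ 0 := by exact_mod_cast n.factorial_ne_zero
  rw [symPower_inner_smul_left, symPower_inner_smul_right, inner_diagTensor, map_inv₀, map_natCast]
  field_simp

/-- By polarization the diagonal tensors span all symmetric tensors, and these are dense in the
symmetric power by definition. -/
theorem eq_zero_of_inner_diagTensor {n : ℕ} {y : symPower d z n}
    (h2 : ∀ f : OneParticle d z, inner ℂ y (diagTensor n f) = 0) : y = 0 := by
  have h3 : ∀ f : Fin n → OneParticle d z, inner ℂ (symTensor f) y = 0 := by
    intro f
    have h0 : (n.factorial : ℂ) ≠ 0 := by exact_mod_cast n.factorial_ne_zero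
    have h4 : inner ℂ y ((n.factorial : ℂ) • symTensor f) = 0 := by
      rw [factorial_smul_symTensor, inner_sum]
      refine Finset.sum_eq_zero fun T _ => ?_
      rw [symPower_inner_smul_right, h2, mul_zero]
    rw [symPower_inner_smul_right] at h4
    have h5 : inner ℂ (y : Lp ℂ 2 (levelMeasure d z n)) (symTensorLp f) = 0 :=
      (mul_eq_zero.1 h4).resolve_left h0
    exact inner_eq_zero_symm.1 h5
  refine Subtype.ext ?_
  have h5 : (y : Lp ℂ 2 (levelMeasure d z n)) ∈
      (Submodule.span ℂ (Set.range (symTensorLp (d := d) (z := z) (n := n))))ᗮ := by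
    rw [Submodule.mem_orthogonal]
    intro w hw
    induction hw using Submodule.span_induction with
    | mem v hv => obtain ⟨f, rfl⟩ := hv; exact h3 f
    | zero => simp
    | add v w _ _ hv hw => rw [inner_add_left, hv, hw, add_zero]
    | smul c v _ hv => rw [inner_smul_left, hv, mul_zero]
  rw [← Submodule.orthogonal_closure] at h5
  have h6 := (Submodule.mem_orthogonal _ _).1 h5 _ y.2
  exact inner_self_eq_zero.1 h6

/-- The weight `n!` of the `n`-th level meets the two factors `1 / n!`, so level `n` contributes
`⟨f, g⟩ⁿ / n!`. -/
theorem inner_expVector (f g : OneParticle d z) :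
    inner ℂ (expVector f) (expVector g) = Complex.exp (inner ℂ f g) := by
  refine (lp.hasSum_inner (expVector f) (expVector g)).unique ?_
  rw [Complex.exp_eq_exp_ℂ]
  refine (NormedSpace.expSeries_div_hasSum_exp (inner ℂ f g)).congr_fun fun n => ?_
  exact inner_factorial_inv_smul_diagTensor n f g

theorem continuous_expVector : Continuous (expVector : OneParticle d z → Fock d z) :=
  continuous_of_inner_eq_exp inner_expVector

theorem hasSum_expVector (f : OneParticle d z) (s : ℂ) :
    HasSum (fun n : ℕ => s ^ n • (((n.factorial : ℂ)⁻¹) • (lp.single 2 n (diagTensor n f) :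
      Fock d z))) (expVector (s • f)) := by
  refine (lp.hasSum_single (p := 2) (by simp) (expVector (s • f))).congr_fun fun n => ?_
  rw [← lp.single_smul, ← lp.single_smul]
  congr 1
  simp only [expVector, diagTensor_smul]
  rw [smul_comm]

/-- By continuity, orthogonality to a dense set of exponential vectors is orthogonality to all of
them. Scaling `f` by `s` gives a power series that vanishes identically, so each level is orthogonal
to every diagonal tensor. -/
theorem isTotal_expVector {D : Set (OneParticle d z)} (hD : Dense D) :
    IsTotal (fun f : D => expVector (f : OneParticle d z)) := by
  refine IsTotal.of_inner fun x hx => ?_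
  have h1 : ∀ f : OneParticle d z, inner ℂ x (expVector f) = 0 := by
    have hcl : IsClosed {f : OneParticle d z | inner ℂ x (expVector f) = 0} :=
      isClosed_eq (continuous_const.inner continuous_expVector) continuous_const
    intro f
    refine hcl.closure_subset_iff.2 (fun g hg => ?_) (hD f)
    exact inner_eq_zero_symm.1 (hx ⟨g, hg⟩)
  have h2 : ∀ n (f : OneParticle d z), inner ℂ (x n) (diagTensor n f) = 0 := by
    intro n f
    have h3 := coeff_eq_of_hasSum (f := fun _ : ℂ => (0 : ℂ)) (w := fun _ => 0)
      (v := fun n => inner ℂ x (((n.factorial : ℂ)⁻¹) • (lp.single 2 n (diagTensor n f) :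
        Fock d z))) (fun s => by
        have := (hasSum_expVector f s).mapL (innerSL ℂ x)
        simpa [h1, inner_smul_right] using this) (fun s => by simp) n
    have h0 : (n.factorial : ℂ) ≠ 0 := by exact_mod_cast n.factorial_ne_zero
    simpa [inner_smul_right, h0, lp.inner_single_right] using h3
  exact lp.ext (funext fun n => eq_zero_of_inner_diagTensor (h2 n))

/-- Every contraction has a second quantization. -/
theorem exists_secondQuantization (T : OneParticle d z →L[ℂ] OneParticle d z) (hT : ‖T‖ ≤ 1) :
    ∃ U : Fock d z →L[ℂ] Fock d z, IsSecondQuantization T U ∧ ‖U‖ ≤ 1 ∧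
      ∀ f, U (expVector f) = expVector (T f) := by
  have htot : IsTotal (expVector : OneParticle d z → Fock d z) := by
    have := isTotal_expVector (d := d) (z := z) dense_univ
    unfold IsTotal at this ⊢
    convert this using 3
    ext x
    simp
  obtain ⟨U, hU, hUe⟩ := exists_contraction_exp htot inner_expVector T hT
  refine ⟨U, fun n f => ?_, hU, hUe⟩
  -- Comparison of the coefficients of `sⁿ` in `U (expVector (s • f)) = expVector (s • T f)`;
  -- polarization then passes to general symmetric tensors.
  have hdiag : ∀ f : OneParticle d z,
      U (lp.single 2 n (diagTensor n f)) = lp.single 2 n (diagTensor n (T f)) := by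
    intro f
    have h1 := coeff_eq_of_hasSum
      (fun s => by simpa using (hasSum_expVector f s).mapL U)
      (fun s => by simpa [hUe] using hasSum_expVector (T f) s) n
    have h0 : ((n.factorial : ℂ)⁻¹) ≠ 0 := by
      exact inv_ne_zero (by exact_mod_cast n.factorial_ne_zero)
    exact (smul_right_injective _ h0) h1
  have h0 : (n.factorial : ℂ) ≠ 0 := by exact_mod_cast n.factorial_ne_zero
  refine (smul_right_injective _ h0) ?_
  show (n.factorial : ℂ) • _ = (n.factorial : ℂ) • _
  rw [← map_smul, ← lp.single_smul, ← lp.single_smul, factorial_smul_symTensor,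
    factorial_smul_symTensor]
  have hs : ∀ g : Finset (Fin n) → symPower d z n, (lp.single 2 n (∑ T, g T) : Fock d z) =
      ∑ T, lp.single 2 n (g T) := fun g =>
    map_sum (lp.singleAddMonoidHom (E := fun n => symPower d z n) 2 n) g Finset.univ
  rw [hs, hs, map_sum]
  refine Finset.sum_congr rfl fun S _ => ?_
  rw [lp.single_smul, lp.single_smul, map_smul, hdiag, map_sum]

end Fock

end FreeKawasaki

namespace FreeKawasaki

/-! ### Measurability on the configuration space -/

namespace Config

variable {d : ℕ}

theorem finite_inter_closedBall (γ : Config d) (r : ℝ) :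
    (γ.carrier ∩ Metric.closedBall 0 r).Finite :=
  γ.finite_inter _ (isCompact_closedBall 0 r)

theorem countable_carrier (γ : Config d) : γ.carrier.Countable := by
  have : γ.carrier = ⋃ n : ℕ, γ.carrier ∩ Metric.closedBall 0 n := by
    rw [← inter_iUnion, Metric.iUnion_closedBall_nat, inter_univ]
  rw [this]
  exact countable_iUnion fun n => (γ.finite_inter_closedBall n).countable

instance (γ : Config d) : Countable γ.carrier := γ.countable_carrier.to_subtype

/-- The counting measure of a configuration. -/
def counting (γ : Config d) : Measure (E d) := Measure.sum fun x : γ.carrier => Measure.dirac (x : E d)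

theorem lintegral_counting (γ : Config d) (f : E d → ℝ≥0∞) :
    ∫⁻ x, f x ∂γ.counting = ∑' x : γ.carrier, f x := by
  rw [counting, lintegral_sum_measure]
  simp

theorem counting_apply (γ : Config d) (s : Set (E d)) (hs : MeasurableSet s) :
    γ.counting s = (γ.carrier ∩ s).encard := by
  rw [counting, Measure.sum_apply _ hs]
  have h1 : ∀ x : γ.carrier, Measure.dirac (x : E d) s = s.indicator 1 (x : E d) := fun x =>
    Measure.dirac_apply' _ hs
  simp only [h1]
  rw [tsum_subtype γ.carrier (s.indicator (1 : E d → ℝ≥0∞))]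
  rw [Set.indicator_indicator, ← tsum_subtype (γ.carrier ∩ s) (1 : E d → ℝ≥0∞)]
  simp only [Pi.one_apply]
  exact ENNReal.tsum_set_one _

theorem counting_lt_top (γ : Config d) {s : Set (E d)} (hs : MeasurableSet s)
    (hb : Bornology.IsBounded s) : γ.counting s < ⊤ := by
  rw [counting_apply γ s hs]
  obtain ⟨r, hr⟩ := hb.subset_closedBall 0
  have := ((γ.finite_inter_closedBall r).subset (inter_subset_inter_right _ hr))
  have h2 := this.encard_lt_top
  exact_mod_cast (ENat.toENNReal_lt_top.2 h2)

theorem ae_counting_iff (γ : Config d) {p : E d → Prop} :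
    (∀ᵐ x ∂γ.counting, p x) ↔ ∀ x ∈ γ.carrier, p x := by
  rw [counting, Measure.ae_sum_iff]
  simp

theorem finite_support {M : Type*} [Zero M] [TopologicalSpace M] (γ : Config d) {f : E d → M}
    (hf : HasCompactSupport f) : (Function.support fun x : γ.carrier => f x).Finite := by
  have h := γ.finite_inter _ hf
  refine Set.Finite.of_finite_image (f := Subtype.val) (h.subset ?_) Subtype.val_injective.injOn
  rintro _ ⟨x, hx, rfl⟩
  exact ⟨x.2, subset_tsupport _ hx⟩

theorem summable_of_hasCompactSupport {M : Type*} [AddCommMonoid M] [TopologicalSpace M]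
    (γ : Config d) {f : E d → M} (hf : HasCompactSupport f) :
    Summable fun x : γ.carrier => f x :=
  summable_of_hasFiniteSupport (γ.finite_support hf)

theorem continuous_pairing {f : E d → ℝ} (hf : Continuous f) (hc : HasCompactSupport f) :
    Continuous (pairing f) := by
  have h : Continuous (fun (γ : Config d) (f : {f : E d → ℝ // Continuous f ∧ HasCompactSupport f}) =>
      pairing f.1 γ) := continuous_induced_dom
  exact (continuous_apply (⟨f, hf, hc⟩ : {f : E d → ℝ // Continuous f ∧ HasCompactSupport f})).comp h

/-- A continuous cutoff function. -/
def cutoff (n : ℕ) (x : E d) : ℝ := max 0 (min 1 (n + 1 - ‖x‖))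

theorem continuous_cutoff (n : ℕ) : Continuous (cutoff n : E d → ℝ) := by
  unfold cutoff; fun_prop

theorem cutoff_nonneg (n : ℕ) (x : E d) : 0 ≤ cutoff n x := le_max_left _ _

theorem cutoff_eq_one {n : ℕ} {x : E d} (hx : ‖x‖ ≤ n) : cutoff n x = 1 := by
  unfold cutoff
  rw [min_eq_left (by linarith)]
  simp

theorem cutoff_eq_zero {n : ℕ} {x : E d} (hx : n + 1 ≤ ‖x‖) : cutoff n x = 0 := by
  unfold cutoff
  exact max_eq_left ((min_le_right _ _).trans (by linarith))

theorem hasCompactSupport_cutoff (n : ℕ) : HasCompactSupport (cutoff n : E d → ℝ) := by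
  refine HasCompactSupport.intro (isCompact_closedBall 0 (n + 1)) fun x hx => cutoff_eq_zero ?_
  simp only [mem_closedBall_zero_iff, not_le] at hx
  exact hx.le

/-- A countable family of test functions which determines the vague topology. -/
def basicTest (i : Option ℕ × ℕ) (x : E d) : ℝ :=
  (i.1.elim 1 fun k => TopologicalSpace.denseSeq C(E d, ℝ) k x) * cutoff i.2 x

theorem continuous_basicTest (i : Option ℕ × ℕ) : Continuous (basicTest i : E d → ℝ) := by
  obtain ⟨_ | k, n⟩ := i
  · exact continuous_const.mul (continuous_cutoff n)
  · exact (TopologicalSpace.denseSeq C(E d, ℝ) k).continuous.mul (continuous_cutoff n)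

theorem hasCompactSupport_basicTest (i : Option ℕ × ℕ) :
    HasCompactSupport (basicTest i : E d → ℝ) :=
  (hasCompactSupport_cutoff i.2).mul_left

theorem exists_denseSeq_close (f : C(E d, ℝ)) {K : Set (E d)} (hK : IsCompact K) {δ : ℝ}
    (hδ : 0 < δ) : ∃ k, ∀ x ∈ K, |TopologicalSpace.denseSeq C(E d, ℝ) k x - f x| < δ := by
  have : CompactSpace K := isCompact_iff_compactSpace.1 hK
  have ho : IsOpen ((fun g : C(E d, ℝ) => g.restrict K) ⁻¹' Metric.ball (f.restrict K) δ) :=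
    Metric.isOpen_ball.preimage (ContinuousMap.continuous_restrict K)
  obtain ⟨_, hg, ⟨k, rfl⟩⟩ := (TopologicalSpace.denseRange_denseSeq C(E d, ℝ)).inter_open_nonempty _
    ho ⟨f, by simpa using hδ⟩
  refine ⟨k, fun x hx => ?_⟩
  have := (ContinuousMap.dist_lt_iff hδ).1 (Metric.mem_ball.1 hg) ⟨x, hx⟩
  simpa [Real.dist_eq] using this

/-- On a neighbourhood of `γ₀` the pairing with a cutoff function bounds the number of points in a
ball. A uniform approximation of `f` on that ball by a member of the countable family therefore
makes the two pairings uniformly close there. -/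
theorem topology_eq_induced : (inferInstance : TopologicalSpace (Config d)) =
    TopologicalSpace.induced (fun γ i => pairing (basicTest i) γ) inferInstance := by
  refine le_antisymm ?_ ?_
  · refine continuous_iff_le_induced.1 (continuous_pi fun i => ?_)
    exact continuous_pairing (continuous_basicTest i) (hasCompactSupport_basicTest i)
  · refine continuous_iff_le_induced.1 ?_
    let _ : TopologicalSpace (Config d) :=
      TopologicalSpace.induced (fun γ i => pairing (basicTest i) γ) inferInstance
    have hb : ∀ i, Continuous fun γ : Config d => pairing (basicTest i) γ := fun i =>

      ((continuous_apply i).comp continuous_induced_dom :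
        Continuous ((fun p => p i) ∘ fun (γ : Config d) i => pairing (basicTest i) γ))
    refine continuous_pi fun f => continuous_iff_continuousAt.2 fun γ₀ => ?_
    obtain ⟨f, hf, hc⟩ := f
    refine continuousAt_of_locally_uniform_approx_of_continuousAt fun u hu => ?_
    obtain ⟨ε, hε, hεu⟩ := Metric.mem_uniformity_dist.1 hu
    obtain ⟨r, hr⟩ := hc.isCompact.isBounded.subset_closedBall 0
    obtain ⟨n, hn⟩ := exists_nat_ge r
    have hcut : ∀ γ : Config d, pairing (basicTest (none, n)) γ = ∑' x : γ.carrier, cutoff n (x : E d) :=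
      fun γ => by simp [pairing, basicTest]
    -- Strictly above the value at `γ₀`, so that `{pairing < M}` is an open neighbourhood;
    -- approximation within `ε / M` then costs less than `ε` in total.
    set M := pairing (basicTest (none, n)) γ₀ + 1 with hM
    have hM0 : 0 < M := by
      rw [hM, hcut]
      have : 0 ≤ ∑' x : γ₀.carrier, cutoff n (x : E d) := tsum_nonneg fun x => cutoff_nonneg n _
      linarith
    obtain ⟨k, hk⟩ := exists_denseSeq_close ⟨f, hf⟩ (isCompact_closedBall (0 : E d) (n + 1))
      (div_pos hε hM0)
    refine ⟨{γ | pairing (basicTest (none, n)) γ < M},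
      (isOpen_lt (hb _) continuous_const).mem_nhds (by simp [hM]), pairing (basicTest (some k, n)),
      (hb _).continuousAt, fun γ hγ => hεu ?_⟩
    have hs1 := γ.summable_of_hasCompactSupport hc
    have hs2 := γ.summable_of_hasCompactSupport (hasCompactSupport_basicTest (d := d) (some k, n))
    have hs3 := γ.summable_of_hasCompactSupport (hasCompactSupport_cutoff (d := d) n)
    have hle : ∀ x : E d, |f x - basicTest (some k, n) x| ≤ ε / M * cutoff n x := by
      intro x
      have e : f x = f x * cutoff n x := by
        by_cases hx : x ∈ tsupport f
        · have h1 := hr hx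
          rw [mem_closedBall_zero_iff] at h1
          rw [cutoff_eq_one (h1.trans hn), mul_one]
        · rw [image_eq_zero_of_notMem_tsupport hx, zero_mul]
      rw [e]
      simp only [basicTest, Option.elim]
      rw [← sub_mul, abs_mul, abs_of_nonneg (cutoff_nonneg n x)]
      rcases le_or_gt (n + 1 : ℝ) ‖x‖ with hx | hx
      · rw [cutoff_eq_zero hx]; simp
      · refine mul_le_mul_of_nonneg_right ?_ (cutoff_nonneg n x)
        rw [abs_sub_comm]
        exact (hk x (by rw [mem_closedBall_zero_iff]; exact hx.le)).le
    rw [Real.dist_eq, pairing, pairing, ← hs1.tsum_sub hs2]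
    have h5 : |∑' x : γ.carrier, (f x - basicTest (some k, n) (x : E d))| ≤
        ∑' x : γ.carrier, ε / M * cutoff n (x : E d) := by
      rw [← Real.norm_eq_abs]
      exact tsum_of_norm_bounded (hs3.mul_left _).hasSum fun x => hle x
    refine h5.trans_lt ?_
    rw [tsum_mul_left, ← hcut, div_mul_eq_mul_div, div_lt_iff₀ hM0]
    exact mul_lt_mul_of_pos_left hγ hε

/-- Countability of the test family is the point: on a countable product of copies of `ℝ` the
product and Borel σ-algebras agree. -/
theorem measurableSpace_eq_comap : (inferInstance : MeasurableSpace (Config d)) =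
    MeasurableSpace.comap (fun γ i => pairing (basicTest i) γ) MeasurableSpace.pi := by
  have h1 : (inferInstance : MeasurableSpace (Config d)) = borel (Config d) := rfl
  have h2 : (MeasurableSpace.pi : MeasurableSpace (Option ℕ × ℕ → ℝ)) = borel _ :=
    BorelSpace.measurable_eq
  rw [h1, h2, ← borel_comap, ← topology_eq_induced]

theorem measurable_of_measurable_pairing_continuous {Ω : Type*} [MeasurableSpace Ω]
    {g : Ω → Config d}
    (h : ∀ f : E d → ℝ, Continuous f → HasCompactSupport f → Measurable fun o => pairing f (g o)) :
    Measurable g := by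
  refine Measurable.mono (measurable_comap_iff.2 (measurable_pi_iff.2 fun i => ?_)) le_rfl
    (le_of_eq measurableSpace_eq_comap)
  exact h _ (continuous_basicTest i) (hasCompactSupport_basicTest i)

/-- With `ψ` smooth, valued in `[0, 1]` and nonzero exactly on `U`, the functions `1 - (1 - ψ)^k`
increase to the indicator of `U`. -/
theorem exists_smooth_approx {U : Set (E d)} (hU : IsOpen U) (hb : Bornology.IsBounded U) :
    ∃ φ : ℕ → E d → ℝ, (∀ k, ContDiff ℝ ∞ (φ k)) ∧ (∀ k, HasCompactSupport (φ k)) ∧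
      (∀ k x, 0 ≤ φ k x) ∧ Monotone φ ∧
      ∀ x, Tendsto (fun k => ENNReal.ofReal (φ k x)) atTop (𝓝 (U.indicator 1 x)) := by
  obtain ⟨ψ, hψ, hψs, hψr⟩ := hU.exists_contDiff_support_eq (n := ⊤)
  have hr : ∀ x, 0 ≤ ψ x ∧ ψ x ≤ 1 := fun x => hψr ⟨x, rfl⟩
  have hzero : ∀ x, x ∉ U → ψ x = 0 := fun x hx => by
    by_contra hne
    exact hx (hψ ▸ hne)
  refine ⟨fun k x => 1 - (1 - ψ x) ^ k, fun k => ?_, fun k => ?_, fun k x => ?_, ?_, fun x => ?_⟩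
  · exact contDiff_const.sub ((contDiff_const.sub hψs).pow k)
  · refine HasCompactSupport.intro hb.isCompact_closure fun x hx => ?_
    simp [hzero x fun h => hx (subset_closure h)]
  · have := pow_le_one₀ (n := k) (sub_nonneg.2 (hr x).2) (by linarith [(hr x).1])
    linarith
  · intro k l hkl x
    have := pow_le_pow_of_le_one (sub_nonneg.2 (hr x).2) (by linarith [(hr x).1]) hkl
    simp only
    linarith
  · by_cases hx : x ∈ U
    · have hxpos : 0 < ψ x := lt_of_le_of_ne (hr x).1 (Ne.symm (by rw [← hψ] at hx; exact hx))
      have := tendsto_pow_atTop_nhds_zero_of_lt_one (sub_nonneg.2 (hr x).2)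
        (by linarith : 1 - ψ x < 1)
      simpa [hx] using ENNReal.tendsto_ofReal (this.const_sub 1)
    · simp [hx, hzero x hx]

theorem lintegral_counting_ofReal (γ : Config d) {f : E d → ℝ} (hc : HasCompactSupport f)
    (hf : ∀ x, 0 ≤ f x) : ∫⁻ x, ENNReal.ofReal (f x) ∂γ.counting = ENNReal.ofReal (pairing f γ) := by
  rw [lintegral_counting, pairing, ENNReal.ofReal_tsum_of_nonneg (fun x : γ.carrier => hf x)
    (γ.summable_of_hasCompactSupport hc)]

/-! ### Measurability tested on smooth functions -/

section SmoothCriterion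

variable {Ω : Type*} [MeasurableSpace Ω] {g : Ω → Config d}

theorem measurable_counting_isOpen
    (h : ∀ φ : E d → ℝ, ContDiff ℝ ∞ φ → HasCompactSupport φ → Measurable fun o => pairing φ (g o))
    {U : Set (E d)} (hU : IsOpen U) (hb : Bornology.IsBounded U) :
    Measurable fun o => (g o).counting U := by
  obtain ⟨φ, hs, hc, hpos, hmono, hlim⟩ := exists_smooth_approx hU hb
  refine ENNReal.measurable_of_tendsto (f := fun k o => ENNReal.ofReal (pairing (φ k) (g o)))
    (fun k => (h _ (hs k) (hc k)).ennreal_ofReal) (tendsto_pi_nhds.2 fun o => ?_)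
  simp only [← lintegral_counting_ofReal _ (hc _) (hpos _)]
  rw [← lintegral_indicator_one hU.measurableSet]
  exact lintegral_tendsto_of_tendsto_of_monotone
    (fun k => (hs k).continuous.measurable.ennreal_ofReal.aemeasurable)
    (ae_of_all _ fun x k l hkl => ENNReal.ofReal_le_ofReal (hmono hkl x)) (ae_of_all _ hlim)

instance isFiniteMeasure_restrict_ball (γ : Config d) (n : ℕ) :
    IsFiniteMeasure (γ.counting.restrict (Metric.ball 0 n)) :=
  ⟨by
    rw [Measure.restrict_apply_univ]
    exact γ.counting_lt_top measurableSet_ball Metric.isBounded_ball⟩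

/-- Restriction to a ball makes the measures finite, so that measurability can be checked on the
π-system of open sets. -/
theorem measurable_counting_restrict_ball
    (h : ∀ φ : E d → ℝ, ContDiff ℝ ∞ φ → HasCompactSupport φ → Measurable fun o => pairing φ (g o))
    (n : ℕ) : Measurable fun o => (g o).counting.restrict (Metric.ball 0 n) := by
  refine Measurable.measure_of_isPiSystem (S := {U | IsOpen U}) BorelSpace.measurable_eq
    isPiSystem_isOpen (fun U hU => ?_) ?_
  · have : ∀ o, (g o).counting.restrict (Metric.ball 0 n) U = (g o).counting (U ∩ Metric.ball 0 n) :=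
      fun o => Measure.restrict_apply (IsOpen.measurableSet hU)
    simp only [this]
    exact measurable_counting_isOpen h (IsOpen.inter hU Metric.isOpen_ball)
      (Metric.isBounded_ball.subset inter_subset_right)
  · simp only [Measure.restrict_apply_univ]
    exact measurable_counting_isOpen h Metric.isOpen_ball Metric.isBounded_ball

theorem measurable_counting_of_smooth
    (h : ∀ φ : E d → ℝ, ContDiff ℝ ∞ φ → HasCompactSupport φ → Measurable fun o => pairing φ (g o)) :
    Measurable fun o => (g o).counting := by
  refine Measure.measurable_of_measurable_coe _ fun s hs => ?_
  have hmono : Monotone fun n : ℕ => s ∩ Metric.ball (0 : E d) n := fun m n hmn =>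
    inter_subset_inter_right _ (Metric.ball_subset_ball (by exact_mod_cast hmn))
  have e : ∀ o, (g o).counting s = ⨆ n : ℕ, (g o).counting.restrict (Metric.ball 0 n) s := by
    intro o
    have : s = ⋃ n : ℕ, s ∩ Metric.ball (0 : E d) n := by
      rw [← inter_iUnion, Metric.iUnion_ball_nat, inter_univ]
    conv_lhs => rw [this]
    rw [hmono.measure_iUnion]
    simp only [Measure.restrict_apply hs]
  simp only [e]
  exact Measurable.iSup fun n => Measure.measurable_coe hs |>.comp
    (measurable_counting_restrict_ball h n)

theorem pairing_eq_lintegral (γ : Config d) {f : E d → ℝ} (hc : HasCompactSupport f) :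
    pairing f γ = (∫⁻ x, ENNReal.ofReal (f x) ∂γ.counting).toReal -
      (∫⁻ x, ENNReal.ofReal (-f x) ∂γ.counting).toReal := by
  have hs := γ.summable_of_hasCompactSupport hc
  have h1 : ∀ f : E d → ℝ, (∫⁻ x, ENNReal.ofReal (f x) ∂γ.counting).toReal =
      ∑' x : γ.carrier, max (f x) 0 := by
    intro f
    rw [lintegral_counting, ENNReal.tsum_toReal_eq fun _ => ENNReal.ofReal_ne_top]
    rfl
  rw [h1, h1, pairing, ← Summable.tsum_sub]
  · refine tsum_congr fun x => ?_
    exact (max_zero_sub_eq_self (f x)).symm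
  · exact summable_of_hasFiniteSupport ((γ.finite_support hc).subset fun x hx hx' => hx (by simp [hx']))
  · exact summable_of_hasFiniteSupport ((γ.finite_support hc).subset fun x hx hx' => hx (by simp [hx']))

/-- The Laplace transform is given on smooth functions only. These suffice: they determine the
counting measure measurably, and every continuous pairing is an integral against it. -/
theorem measurable_of_measurable_pairing
    (h : ∀ φ : E d → ℝ, ContDiff ℝ ∞ φ → HasCompactSupport φ → Measurable fun o => pairing φ (g o)) :
    Measurable g := by
  have hm := measurable_counting_of_smooth h
  refine measurable_of_measurable_pairing_continuous fun f hf hc => ?_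
  simp only [pairing_eq_lintegral _ hc]
  exact (((Measure.measurable_lintegral hf.measurable.ennreal_ofReal).comp hm).ennreal_toReal).sub
    (((Measure.measurable_lintegral hf.measurable.neg.ennreal_ofReal).comp hm).ennreal_toReal)

end SmoothCriterion

theorem measurable_counting : Measurable (counting : Config d → Measure (E d)) :=
  measurable_counting_of_smooth (g := id) fun _ hφ hc => (continuous_pairing hφ.continuous hc).measurable

/-- The counting kernel `γ ↦ ∑_{x ∈ γ} δ_x`. -/
def countingKernel (d : ℕ) : ProbabilityTheory.Kernel (Config d) (E d) where
  toFun := counting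
  measurable' := measurable_counting

@[simp]
theorem countingKernel_apply (γ : Config d) : countingKernel d γ = γ.counting := rfl

/-- The number of points in `s` is finite for each `γ` but not uniformly bounded. The kernel is
therefore normalised to mass at most `1`, and its mass is restored as a finite density. -/
theorem isSFiniteKernel_restrict {s : Set (E d)} (hs : MeasurableSet s)
    (hb : Bornology.IsBounded s) :
    ProbabilityTheory.IsSFiniteKernel ((countingKernel d).restrict hs) := by
  have hN : Measurable fun γ : Config d => γ.counting s :=
    (Measure.measurable_coe hs).comp measurable_counting
  let η : ProbabilityTheory.Kernel (Config d) (E d) :=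
    ⟨fun γ => (γ.counting s)⁻¹ • γ.counting.restrict s, by
      refine Measure.measurable_of_measurable_coe _ fun t ht => ?_
      simp only [Measure.smul_apply, Measure.restrict_apply ht, smul_eq_mul]
      exact hN.inv.mul ((Measure.measurable_coe (ht.inter hs)).comp measurable_counting)⟩
  have hη : ProbabilityTheory.IsFiniteKernel η := ⟨1, ENNReal.one_lt_top, fun γ => by
    show ((γ.counting s)⁻¹ • γ.counting.restrict s) univ ≤ 1
    rw [Measure.smul_apply, Measure.restrict_apply_univ, smul_eq_mul]
    exact ENNReal.inv_mul_le_one _⟩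
  have e : (countingKernel d).restrict hs =
      η.withDensity fun γ _ => ((γ.counting s).toNNReal : ℝ≥0∞) := by
    ext γ t ht
    rw [ProbabilityTheory.Kernel.withDensity_apply]
    · rw [withDensity_const, ProbabilityTheory.Kernel.restrict_apply, countingKernel_apply]
      show _ = ((γ.counting s).toNNReal : ℝ≥0∞) * (((γ.counting s)⁻¹ • γ.counting.restrict s) t)
      rw [ENNReal.coe_toNNReal (γ.counting_lt_top hs hb).ne, Measure.smul_apply, smul_eq_mul,
        ← mul_assoc]
      by_cases h0 : γ.counting s = 0
      · rw [h0, zero_mul, zero_mul, Measure.restrict_apply ht]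
        exact measure_mono_null inter_subset_right h0
      · rw [ENNReal.mul_inv_cancel h0 (γ.counting_lt_top hs hb).ne, one_mul]
    · exact (measurable_coe_nnreal_ennreal.comp hN.ennreal_toNNReal).comp measurable_fst
  rw [e]
  infer_instance

instance : ProbabilityTheory.IsSFiniteKernel (countingKernel d) := by
  -- Disjoint bounded shells exhaust the space, so the kernel is a countable sum of its restrictions
  -- to them.
  let A : ℕ → Set (E d) := disjointed fun n => Metric.ball 0 n
  have hA : ∀ n, MeasurableSet (A n) := MeasurableSet.disjointed fun n => measurableSet_ball
  have e : countingKernel d = ProbabilityTheory.Kernel.sum fun n => (countingKernel d).restrict (hA n) := by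
    ext γ t ht
    rw [ProbabilityTheory.Kernel.sum_apply' _ _ ht]
    simp only [ProbabilityTheory.Kernel.restrict_apply]
    rw [← Measure.sum_apply _ ht, ← Measure.restrict_iUnion (disjoint_disjointed _) hA,
      iUnion_disjointed, Metric.iUnion_ball_nat, Measure.restrict_univ]
  rw [e]
  have := fun n => isSFiniteKernel_restrict (hA n)
    (Metric.isBounded_ball.subset (disjointed_subset _ n))
  infer_instance

/-! ### Adding and removing points -/

/-- The configuration `γ ∪ x`. -/
def insertPt (γ : Config d) (x : E d) : Config d where
  carrier := insert x γ.carrier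
  finite_inter K hK := by
    refine ((γ.finite_inter K hK).union (Set.finite_singleton x)).subset ?_
    rintro w ⟨rfl | hw, hwK⟩
    · exact Or.inr rfl
    · exact Or.inl ⟨hw, hwK⟩

/-- The configuration `γ \ x`. -/
def erasePt (γ : Config d) (x : E d) : Config d where
  carrier := γ.carrier \ {x}
  finite_inter K hK := (γ.finite_inter K hK).subset fun _ hx => ⟨hx.1.1, hx.2⟩

theorem move_eq (γ : Config d) (x y : E d) : γ.move x y = (γ.erasePt x).insertPt y := by
  ext w
  simp [move, erasePt, insertPt]

theorem erasePt_insertPt {γ : Config d} {x : E d} (hx : x ∉ γ.carrier) :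
    (γ.insertPt x).erasePt x = γ := by
  ext w
  simp only [erasePt, insertPt, Set.mem_sdiff, mem_insert_iff, mem_singleton_iff]
  constructor
  · rintro ⟨h | h, h'⟩
    · exact absurd h h'
    · exact h
  · intro h
    exact ⟨Or.inr h, fun h' => hx (h' ▸ h)⟩

theorem insertPt_erasePt {γ : Config d} {x : E d} (hx : x ∈ γ.carrier) :
    (γ.erasePt x).insertPt x = γ := by
  ext w
  simp only [erasePt, insertPt, Set.mem_sdiff, mem_insert_iff, mem_singleton_iff]
  constructor
  · rintro (rfl | h)
    · exact hx
    · exact h.1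
  · intro h
    by_cases hw : w = x
    · exact Or.inl hw
    · exact Or.inr ⟨h, hw⟩

theorem tsum_insertPt {M : Type*} [AddCommMonoid M] [TopologicalSpace M] [ContinuousAdd M]
    [T2Space M] {γ : Config d} {x : E d}
    (hx : x ∉ γ.carrier) {f : E d → M} (hf : Summable fun w : γ.carrier => f w) :
    ∑' w : (γ.insertPt x).carrier, f w = f x + ∑' w : γ.carrier, f w := by
  have h := Summable.tsum_union_disjoint (f := f) (s := {x}) (t := γ.carrier)
    (disjoint_singleton_left.2 hx) (hasSum_unique _).summable hf
  rw [tsum_singleton] at h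
  exact h

/-- `x ∈ γ` means that the counting measure of `γ` charges the section of the diagonal at `x`; joint
measurability of this integral is where s-finiteness of the counting kernel enters. -/
theorem measurableSet_mem : MeasurableSet {p : Config d × E d | p.2 ∈ p.1.carrier} := by
  have h1 : Measurable fun p : Config d × E d =>
      ∫⁻ y, ({q : E d × E d | q.1 = q.2}.indicator 1 (p.2, y) : ℝ≥0∞) ∂p.1.counting := by
    have h2 : MeasurableSet {q : E d × E d | q.1 = q.2} :=
      measurableSet_eq_fun measurable_fst measurable_snd
    have h3 : Measurable (Function.uncurry fun (p : Config d × E d) (y : E d) =>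
        ({q : E d × E d | q.1 = q.2}.indicator 1 (p.2, y) : ℝ≥0∞)) := by
      exact (measurable_one.indicator h2).comp
        ((measurable_snd.comp measurable_fst).prodMk measurable_snd)
    exact h3.lintegral_kernel_prod_right
      (κ := (countingKernel d).comap Prod.fst measurable_fst)
  have e : {p : Config d × E d | p.2 ∈ p.1.carrier} = (fun p : Config d × E d =>
      ∫⁻ y, ({q : E d × E d | q.1 = q.2}.indicator 1 (p.2, y) : ℝ≥0∞) ∂p.1.counting) ⁻¹' {0}ᶜ := by
    ext ⟨γ, x⟩
    simp only [mem_ofPred_eq, mem_preimage, mem_compl_iff, mem_singleton_iff, lintegral_counting,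
      ENNReal.tsum_eq_zero, Subtype.forall, not_forall, indicator_apply, mem_ofPred_eq]
    constructor
    · intro h
      exact ⟨x, h, by simp⟩
    · rintro ⟨y, hy, h⟩
      by_cases hxy : x = y
      · exact hxy ▸ hy
      · simp [hxy] at h
  rw [e]
  exact h1 (measurableSet_singleton 0).compl

theorem pairing_insertPt (γ : Config d) (x : E d) {f : E d → ℝ} (hf : HasCompactSupport f) :
    open Classical in
    pairing f (γ.insertPt x) = pairing f γ + if x ∈ γ.carrier then 0 else f x := by
  classical
  split_ifs with hx
  · have : γ.insertPt x = γ := by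
      ext w
      simp only [insertPt, mem_insert_iff, or_iff_right_iff_imp]
      rintro rfl
      exact hx
    rw [this, add_zero]
  · rw [pairing, tsum_insertPt hx (γ.summable_of_hasCompactSupport hf), add_comm]
    rfl

theorem pairing_erasePt (γ : Config d) (x : E d) {f : E d → ℝ} (hf : HasCompactSupport f) :
    open Classical in
    pairing f (γ.erasePt x) = pairing f γ - if x ∈ γ.carrier then f x else 0 := by
  classical
  split_ifs with hx
  · have h := pairing_insertPt (γ.erasePt x) x hf
    rw [insertPt_erasePt hx, if_neg (by simp [erasePt])] at h
    rw [h]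
    ring
  · have : γ.erasePt x = γ := by
      ext w
      simp only [erasePt, Set.mem_sdiff, mem_singleton_iff, and_iff_left_iff_imp]
      rintro hw rfl
      exact hx hw
    rw [this, sub_zero]

theorem measurable_insertPt : Measurable fun p : Config d × E d => p.1.insertPt p.2 := by
  classical
  refine measurable_of_measurable_pairing_continuous fun f hf hc => ?_
  simp only [pairing_insertPt _ _ hc]
  refine (((continuous_pairing hf hc).measurable).comp measurable_fst).add ?_
  exact Measurable.ite measurableSet_mem measurable_const (hf.measurable.comp measurable_snd)

theorem measurable_erasePt : Measurable fun p : Config d × E d => p.1.erasePt p.2 := by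
  classical
  refine measurable_of_measurable_pairing_continuous fun f hf hc => ?_
  simp only [pairing_erasePt _ _ hc]
  refine (((continuous_pairing hf hc).measurable).comp measurable_fst).sub ?_
  exact Measurable.ite measurableSet_mem (hf.measurable.comp measurable_snd) measurable_const

theorem measurable_move : Measurable fun p : (Config d × E d) × E d => p.1.1.move p.1.2 p.2 := by
  simp only [move_eq]
  exact measurable_insertPt.comp ((measurable_erasePt.comp measurable_fst).prodMk measurable_snd)

theorem ae_notMem (γ : Config d) (ν : Measure (E d)) [NullSingletonClass ν] : ∀ᵐ x ∂ν, x ∉ γ.carrier :=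
  measure_eq_zero_iff_ae_notMem.1 (γ.countable_carrier.measure_zero ν)

end Config

end FreeKawasaki

namespace FreeKawasaki

/-! ### Uniqueness of Laplace transforms and the Mecke identity -/

open ProbabilityTheory

variable {d : ℕ}

namespace Config

theorem pairing_const_mul (c : ℝ) (f : E d → ℝ) (γ : Config d) :
    pairing (fun x => c * f x) γ = c * pairing f γ := tsum_mul_left

theorem pairing_add {f g : E d → ℝ} (hf : HasCompactSupport f) (hg : HasCompactSupport g)
    (γ : Config d) : pairing (fun x => f x + g x) γ = pairing f γ + pairing g γ :=
  (γ.summable_of_hasCompactSupport hf).tsum_add (γ.summable_of_hasCompactSupport hg)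

theorem pairing_sum {ι : Type*} (s : Finset ι) {f : ι → E d → ℝ}
    (hf : ∀ i ∈ s, HasCompactSupport (f i)) (γ : Config d) :
    pairing (fun x => ∑ i ∈ s, f i x) γ = ∑ i ∈ s, pairing (f i) γ :=
  Summable.tsum_finsetSum fun i hi => γ.summable_of_hasCompactSupport (hf i hi)

/-- A moment generating function that is finite on the whole line continues analytically to the
plane, so equality for real arguments gives equality at `i`. -/
theorem _root_.ProbabilityTheory.integral_cexp_eq_of_mgf {Ω : Type*} [MeasurableSpace Ω]
    {μ₁ μ₂ : Measure Ω} [IsFiniteMeasure μ₁] [IsFiniteMeasure μ₂] {X : Ω → ℝ}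
    (h₁ : ∀ t : ℝ, Integrable (fun o => Real.exp (t * X o)) μ₁)
    (h : ∀ t : ℝ, ∫ o, Real.exp (t * X o) ∂μ₁ = ∫ o, Real.exp (t * X o) ∂μ₂) :
    ∫ o, Complex.exp (X o * Complex.I) ∂μ₁ = ∫ o, Complex.exp (X o * Complex.I) ∂μ₂ := by
  have h0 : μ₁ = 0 ↔ μ₂ = 0 := by
    have := h 0
    simp only [zero_mul, Real.exp_zero, integral_const, smul_eq_mul, mul_one] at this
    rw [← Measure.measure_univ_eq_zero, ← Measure.measure_univ_eq_zero, ← measureReal_eq_zero_iff,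
      ← measureReal_eq_zero_iff, this]
  have hset : integrableExpSet X μ₁ = univ := eq_univ_of_forall h₁
  have := eqOn_complexMGF_of_mgf' (X := X) (Y := X) (funext h) h0
    (show (Complex.I : ℂ) ∈ _ by simp [hset])
  simpa [complexMGF, mul_comm] using this

/-- Laplace transforms determine the characteristic functions of all finite families of smooth
pairings. By uniqueness of projective limits these determine the joint law of all smooth pairings,
which generate the σ-algebra. -/
theorem ext_of_laplace {μ₁ μ₂ : Measure (Config d)} [IsFiniteMeasure μ₁] [IsFiniteMeasure μ₂]
    (hint : ∀ φ : E d → ℝ, ContDiff ℝ ∞ φ → HasCompactSupport φ →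
      Integrable (fun γ => Real.exp (pairing φ γ)) μ₁)
    (h : ∀ φ : E d → ℝ, ContDiff ℝ ∞ φ → HasCompactSupport φ →
      ∫ γ, Real.exp (pairing φ γ) ∂μ₁ = ∫ γ, Real.exp (pairing φ γ) ∂μ₂) : μ₁ = μ₂ := by
  classical
  have hc : ∀ φ : E d → ℝ, ContDiff ℝ ∞ φ → HasCompactSupport φ →
      ∫ γ, Complex.exp (pairing φ γ * Complex.I) ∂μ₁ =
        ∫ γ, Complex.exp (pairing φ γ * Complex.I) ∂μ₂ := by
    intro φ hφ hs
    refine integral_cexp_eq_of_mgf (fun t => ?_) fun t => ?_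
    · simpa only [pairing_const_mul] using hint _ (contDiff_const.mul hφ) (hs.mul_left (f := fun _ => t))
    · simpa only [pairing_const_mul] using h _ (contDiff_const.mul hφ) (hs.mul_left (f := fun _ => t))
  let 𝒯 := {φ : E d → ℝ // ContDiff ℝ ∞ φ ∧ HasCompactSupport φ}
  let Ψ : Config d → 𝒯 → ℝ := fun γ φ => pairing φ.1 γ
  have hΨ : Measurable Ψ := measurable_pi_iff.2 fun φ =>
    (continuous_pairing φ.2.1.continuous φ.2.2).measurable
  have hmap : μ₁.map Ψ = μ₂.map Ψ := by
    have hJ : ∀ J : Finset 𝒯, (μ₂.map Ψ).map J.restrict = (μ₁.map Ψ).map J.restrict := by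
      intro J
      have hm : Measurable (J.restrict (π := fun _ : 𝒯 => ℝ)) := Finset.measurable_restrict J
      refine Measure.ext_of_charFunDual (funext fun l => ?_)
      have key : ∀ μ : Measure (Config d), charFunDual ((μ.map Ψ).map J.restrict) l =
          ∫ γ, Complex.exp (pairing (fun x => ∑ j, l (Pi.single j 1) * j.1.1 x) γ * Complex.I) ∂μ := by
        intro μ
        have hml : Measurable fun v : J → ℝ => Complex.exp (l v * Complex.I) := by fun_prop
        rw [charFunDual_apply, Measure.map_map hm hΨ,
          integral_map (hm.comp hΨ).aemeasurable hml.aestronglyMeasurable]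
        refine integral_congr_ae (ae_of_all _ fun γ => ?_)
        simp only
        congr 3
        rw [pairing_sum _ fun j _ => (j.1.2.2.mul_left (f := fun _ => l (Pi.single j 1)))]
        -- In coordinates, a linear functional of finitely many pairings is the pairing with one
        -- linear combination of the test functions.
        have : (J.restrict ∘ Ψ) γ = ∑ j, (Ψ γ j.1) • (Pi.single j 1 : J → ℝ) := by
          funext j
          rw [Finset.sum_apply, Finset.sum_eq_single j]
          · simp
          · intro i _ hij
            simp [hij.symm]
          · simp
        rw [this, map_sum]
        refine Finset.sum_congr rfl fun j _ => ?_
        rw [map_smul, pairing_const_mul, smul_eq_mul, mul_comm]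
      rw [key, key]
      refine (hc _ ?_ ?_).symm
      · exact ContDiff.sum fun j _ => contDiff_const.mul j.1.2.1
      · have : (fun x => ∑ j : J, l (Pi.single j 1) * j.1.1 x) =
            ∑ j : J, fun x => l (Pi.single j 1) * j.1.1 x := by
          funext x; simp
        rw [this]
        refine Finset.sum_induction _ HasCompactSupport (fun f g hf hg => hf.add hg)
          HasCompactSupport.zero fun j _ => j.1.2.2.mul_left
    have hfin : ∀ J : Finset 𝒯, IsFiniteMeasure ((μ₁.map Ψ).map J.restrict) := fun J => inferInstance
    exact IsProjectiveLimit.unique (P := fun J => (μ₁.map Ψ).map J.restrict) (fun J => rfl) hJ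
  refine Measure.ext fun s hs => ?_
  have hle : (inferInstance : MeasurableSpace (Config d)) ≤ MeasurableSpace.comap Ψ MeasurableSpace.pi := by
    have : Measurable[MeasurableSpace.comap Ψ MeasurableSpace.pi] (id : Config d → Config d) := by
      refine @measurable_of_measurable_pairing d _ (MeasurableSpace.comap Ψ MeasurableSpace.pi) id
        fun φ hφ hcφ => ?_
      exact (measurable_pi_apply (⟨φ, hφ, hcφ⟩ : 𝒯)).comp (comap_measurable Ψ)
    simpa using this.comap_le
  obtain ⟨t, ht, rfl⟩ := hle s hs
  rw [← Measure.map_apply hΨ ht, ← Measure.map_apply hΨ ht, hmap]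

end Config

open Config

namespace IsPoissonMeasure

variable {ν : Measure (E d)} {π : Measure (Config d)}

/-- A non-integrable function has Bochner integral `0`, whereas the right side of the Laplace
identity is positive. -/
theorem integrable_exp (hπ : IsPoissonMeasure ν π) {φ : E d → ℝ} (hφ : ContDiff ℝ ∞ φ)
    (hc : HasCompactSupport φ) : Integrable (fun γ => Real.exp (pairing φ γ)) π := by
  by_contra h
  have := hπ.laplace φ hφ hc
  rw [integral_undef h] at this
  exact (Real.exp_pos _).ne this

/-- Derivative at `t = 0` of the Laplace identity for `φ + t g`. Both sides are expressed through
moment generating functions, of `⟨g, ·⟩` under `e^{⟨φ, ·⟩} π` and of `g` under `e^φ ν`, whose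
derivatives are known. -/
theorem integral_pairing_mul_exp [IsFiniteMeasureOnCompacts ν] (hπ : IsPoissonMeasure ν π)
    {φ g : E d → ℝ} (hφ : ContDiff ℝ ∞ φ) (hc : HasCompactSupport φ) (hg : ContDiff ℝ ∞ g)
    (hgc : HasCompactSupport g) :
    ∫ γ, pairing g γ * Real.exp (pairing φ γ) ∂π =
      (∫ x, g x * Real.exp (φ x) ∂ν) * ∫ γ, Real.exp (pairing φ γ) ∂π := by
  have := hπ.isProbability
  have hmg := (continuous_pairing hg.continuous hgc).measurable
  have hmφ := (continuous_pairing hφ.continuous hc).measurable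
  set ρ : Measure (Config d) := π.withDensity fun γ => ENNReal.ofReal (Real.exp (pairing φ γ))
  have hρ : ∀ F : Config d → ℝ, ∫ γ, F γ ∂ρ = ∫ γ, Real.exp (pairing φ γ) * F γ ∂π := fun F => by
    rw [integral_withDensity_eq_integral_toReal_smul hmφ.exp.ennreal_ofReal
      (ae_of_all _ fun _ => ENNReal.ofReal_lt_top)]
    refine integral_congr_ae (ae_of_all _ fun γ => ?_)
    simp [ENNReal.toReal_ofReal (Real.exp_pos _).le]
  have hcadd : ∀ t : ℝ, ContDiff ℝ ∞ (fun x => φ x + t * g x) ∧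
      HasCompactSupport (fun x => φ x + t * g x) := fun t =>
    ⟨hφ.add (contDiff_const.mul hg), hc.add (hgc.mul_left (f := fun _ => t))⟩
  have hpair : ∀ t : ℝ, ∀ γ, pairing (fun x => φ x + t * g x) γ = pairing φ γ + t * pairing g γ :=
    fun t γ => by
      rw [pairing_add (f := φ) (g := fun x => t * g x) hc (hgc.mul_left (f := fun _ => t)), pairing_const_mul]
  have hset1 : integrableExpSet (pairing g) ρ = univ := by
    refine eq_univ_of_forall fun t => ?_
    show Integrable _ _
    rw [integrable_withDensity_iff_integrable_smul' hmφ.exp.ennreal_ofReal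
      (ae_of_all _ fun _ => ENNReal.ofReal_lt_top)]
    refine (hπ.integrable_exp (hcadd t).1 (hcadd t).2).congr (ae_of_all _ fun γ => ?_)
    simp [ENNReal.toReal_ofReal (Real.exp_pos _).le, hpair, Real.exp_add]
  set K := tsupport g with hK
  -- `ν` may be infinite, and off the support of `g` the function `exp (t g)` equals `1`.
  -- Restriction to the compact `K` makes the generating function finite and changes the exponent
  -- only by a term independent of `t`.
  set η : Measure (E d) := (ν.restrict K).withDensity fun x => ENNReal.ofReal (Real.exp (φ x))
  have hη : ∀ F : E d → ℝ, ∫ x, F x ∂η = ∫ x in K, Real.exp (φ x) * F x ∂ν := fun F => by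
    rw [integral_withDensity_eq_integral_toReal_smul hφ.continuous.measurable.exp.ennreal_ofReal
      (ae_of_all _ fun _ => ENNReal.ofReal_lt_top)]
    refine integral_congr_ae (ae_of_all _ fun γ => ?_)
    simp [ENNReal.toReal_ofReal (Real.exp_pos _).le]
  have hset2 : integrableExpSet g η = univ := by
    refine eq_univ_of_forall fun t => ?_
    show Integrable _ _
    rw [integrable_withDensity_iff_integrable_smul' hφ.continuous.measurable.exp.ennreal_ofReal
      (ae_of_all _ fun _ => ENNReal.ofReal_lt_top)]
    have h1 : IntegrableOn (fun x => Real.exp (φ x) * Real.exp (t * g x)) K ν :=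
      ContinuousOn.integrableOn_compact hgc (by
        have := hφ.continuous; have := hg.continuous; fun_prop)
    refine h1.congr (ae_of_all _ fun x => ?_)
    simp [ENNReal.toReal_ofReal (Real.exp_pos _).le]
  have hd1 := hasDerivAt_mgf (X := pairing g) (μ := ρ) (t := 0) (by simp [hset1])
  have hd2 := hasDerivAt_mgf (X := g) (μ := η) (t := 0) (by simp [hset2])
  have hmgf2 : ∀ t, ∫ x, (Real.exp (φ x + t * g x) - 1) ∂ν =
      mgf g η t + (∫ x, (Real.exp (φ x) - 1) ∂ν - ∫ x in K, Real.exp (φ x) ∂ν) := by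
    intro t
    have hi1 : Integrable (fun x => Real.exp (φ x) - 1) ν := by
      refine Continuous.integrable_of_hasCompactSupport
        (by have := hφ.continuous; fun_prop) (hc.comp_left (g := fun r => Real.exp r - 1) (by simp))
    have hi2 : Integrable (fun x => Real.exp (φ x) * (Real.exp (t * g x) - 1)) ν := by
      refine Continuous.integrable_of_hasCompactSupport
        (by have := hφ.continuous; have := hg.continuous; fun_prop) ?_
      exact (hgc.comp_left (g := fun r => Real.exp (t * r) - 1) (by simp)).mul_left
    have e1 : ∫ x, (Real.exp (φ x + t * g x) - 1) ∂ν =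
        ∫ x, (Real.exp (φ x) - 1) ∂ν + ∫ x, Real.exp (φ x) * (Real.exp (t * g x) - 1) ∂ν := by
      rw [← integral_add hi1 hi2]
      refine integral_congr_ae (ae_of_all _ fun x => ?_)
      simp only [Real.exp_add]
      ring
    have e2 : ∫ x, Real.exp (φ x) * (Real.exp (t * g x) - 1) ∂ν =
        ∫ x in K, Real.exp (φ x) * (Real.exp (t * g x) - 1) ∂ν := by
      refine (setIntegral_eq_integral_of_forall_compl_eq_zero fun x hx => ?_).symm
      rw [image_eq_zero_of_notMem_tsupport hx]
      simp
    have e3 : ∫ x in K, Real.exp (φ x) * (Real.exp (t * g x) - 1) ∂ν =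
        mgf g η t - ∫ x in K, Real.exp (φ x) ∂ν := by
      rw [mgf, hη, ← integral_sub]
      · refine integral_congr_ae (ae_of_all _ fun x => ?_)
        simp only
        ring
      · exact ContinuousOn.integrableOn_compact hgc (by
          have := hφ.continuous; have := hg.continuous; fun_prop)
      · exact ContinuousOn.integrableOn_compact hgc (by
          have := hφ.continuous; fun_prop)
    rw [e1, e2, e3]
    ring
  have hmgf1 : ∀ t, mgf (pairing g) ρ t = Real.exp (∫ x, (Real.exp (φ x + t * g x) - 1) ∂ν) := by
    intro t
    rw [← hπ.laplace _ (hcadd t).1 (hcadd t).2, mgf, hρ]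
    refine integral_congr_ae (ae_of_all _ fun γ => ?_)
    simp only [hpair, Real.exp_add]
  have hd3 : HasDerivAt (mgf (pairing g) ρ)
      (Real.exp (∫ x, (Real.exp (φ x) - 1) ∂ν) * ∫ x, g x * Real.exp (0 * g x) ∂η) 0 := by
    have := (hd2.add_const (∫ x, (Real.exp (φ x) - 1) ∂ν - ∫ x in K, Real.exp (φ x) ∂ν)).exp
    have h0 := hmgf2 0
    simp only [zero_mul, add_zero] at h0
    rw [← h0] at this
    refine this.congr_of_eventuallyEq (Eventually.of_forall fun t => ?_)
    simp only [hmgf1, hmgf2]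
  have huniq := hd1.unique hd3
  simp only [zero_mul, Real.exp_zero, mul_one] at huniq
  rw [hρ, hη] at huniq
  have e4 : ∫ x in K, Real.exp (φ x) * g x ∂ν = ∫ x, Real.exp (φ x) * g x ∂ν := by
    refine setIntegral_eq_integral_of_forall_compl_eq_zero fun x hx => ?_
    rw [image_eq_zero_of_notMem_tsupport hx, mul_zero]
  rw [e4, ← hπ.laplace φ hφ hc] at huniq
  simp only [mul_comm _ (Real.exp _)]
  rw [huniq, mul_comm]

end IsPoissonMeasure

end FreeKawasaki

/-! ### The Mecke identity -/

namespace FreeKawasaki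

open ProbabilityTheory Config

variable {d : ℕ} {ν : Measure (E d)} {π : Measure (Config d)}

theorem Config.insertPt_move {γ : Config d} {x : E d} (hx : x ∉ γ.carrier) (y : E d) :
    (γ.insertPt x).move x y = γ.insertPt y := by
  rw [move_eq, erasePt_insertPt hx]

theorem ae_prod_notMem [SFinite ν] [NullSingletonClass ν] [SFinite π] :
    ∀ᵐ p ∂π.prod ν, p.2 ∉ p.1.carrier := by
  refine (Measure.ae_prod_iff_ae_ae measurableSet_mem.compl).2 ?_
  exact ae_of_all _ fun γ => γ.ae_notMem ν

namespace IsPoissonMeasure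

theorem integrable_pairing_mul_exp (hπ : IsPoissonMeasure ν π) {φ g : E d → ℝ}
    (hφ : ContDiff ℝ ∞ φ) (hc : HasCompactSupport φ) (hg : ContDiff ℝ ∞ g)
    (hgc : HasCompactSupport g) (hg0 : ∀ x, 0 ≤ g x) :
    Integrable (fun γ => pairing g γ * Real.exp (pairing φ γ)) π := by
  refine (hπ.integrable_exp (φ := fun x => φ x + g x) (hφ.add hg) (hc.add hgc)).mono' ?_
    (ae_of_all _ fun γ => ?_)
  · exact ((continuous_pairing hg.continuous hgc).measurable.mul
      (continuous_pairing hφ.continuous hc).measurable.exp).aestronglyMeasurable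
  · have h0 : 0 ≤ pairing g γ := tsum_nonneg fun x => hg0 x
    rw [Real.norm_of_nonneg (by positivity), pairing_add hc hgc, Real.exp_add, mul_comm]
    exact mul_le_mul_of_nonneg_left (by linarith [Real.add_one_le_exp (pairing g γ)])
      (Real.exp_pos _).le

variable [SigmaFinite ν] [NullSingletonClass ν] [IsFiniteMeasureOnCompacts ν]

/-- Both finite measures have the same Laplace transform. On the right, the inserted point lies
outside `γ` almost surely because `ν` has no atoms, so it contributes an independent factor
`e^{φ(x)}`. -/
theorem withDensity_pairing (hπ : IsPoissonMeasure ν π) {g : E d → ℝ}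
    (hg : ContDiff ℝ ∞ g) (hgc : HasCompactSupport g) (hg0 : ∀ x, 0 ≤ g x) :
    π.withDensity (fun γ => ENNReal.ofReal (pairing g γ)) =
      (π.prod (ν.withDensity fun x => ENNReal.ofReal (g x))).map fun p => p.1.insertPt p.2 := by
  have := hπ.isProbability
  have hmg := (continuous_pairing hg.continuous hgc).measurable
  have hp0 : ∀ γ, 0 ≤ pairing g γ := fun γ => tsum_nonneg fun x => hg0 x
  have hz : pairing (fun _ : E d => (0 : ℝ)) = fun _ => 0 := funext fun γ => by simp [pairing]
  have hfin1 : IsFiniteMeasure (π.withDensity fun γ => ENNReal.ofReal (pairing g γ)) := by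
    refine isFiniteMeasure_withDensity_ofReal (Integrable.hasFiniteIntegral ?_)
    have := hπ.integrable_pairing_mul_exp (φ := fun _ => 0) contDiff_const HasCompactSupport.zero
      hg hgc hg0
    simpa [hz] using this
  have hgi : Integrable g ν := hg.continuous.integrable_of_hasCompactSupport hgc
  have hfin2 : IsFiniteMeasure (ν.withDensity fun x => ENNReal.ofReal (g x)) :=
    isFiniteMeasure_withDensity_ofReal hgi.hasFiniteIntegral
  have hns : NullSingletonClass (ν.withDensity fun x => ENNReal.ofReal (g x)) :=
    ⟨fun x => withDensity_absolutelyContinuous _ _ (measure_singleton x)⟩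
  have hsm : ∀ γ, (ENNReal.ofReal (pairing g γ)).toReal = pairing g γ := fun γ =>
    ENNReal.toReal_ofReal (hp0 γ)
  refine ext_of_laplace (fun φ hφ hc => ?_) fun φ hφ hc => ?_
  · rw [integrable_withDensity_iff_integrable_smul' hmg.ennreal_ofReal
      (ae_of_all _ fun _ => ENNReal.ofReal_lt_top)]
    simpa only [hsm, smul_eq_mul] using hπ.integrable_pairing_mul_exp hφ hc hg hgc hg0
  · rw [integral_withDensity_eq_integral_toReal_smul hmg.ennreal_ofReal
      (ae_of_all _ fun _ => ENNReal.ofReal_lt_top)]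
    simp only [hsm, smul_eq_mul]
    rw [hπ.integral_pairing_mul_exp hφ hc hg hgc, integral_map measurable_insertPt.aemeasurable
      (continuous_pairing hφ.continuous hc).measurable.exp.aestronglyMeasurable]
    have h1 : ∫ p, Real.exp (pairing φ (p.1.insertPt p.2))
          ∂π.prod (ν.withDensity fun x => ENNReal.ofReal (g x)) =
        ∫ p, Real.exp (pairing φ p.1) * Real.exp (φ p.2)
          ∂π.prod (ν.withDensity fun x => ENNReal.ofReal (g x)) := by
      refine integral_congr_ae ?_
      filter_upwards [ae_prod_notMem (π := π) (ν := ν.withDensity fun x => ENNReal.ofReal (g x))]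
        with p hp
      rw [pairing_insertPt _ _ hc, if_neg hp, Real.exp_add]
    rw [h1, integral_prod_mul (μ := π) (fun γ => Real.exp (pairing φ γ)) (fun x => Real.exp (φ x)),
      integral_withDensity_eq_integral_toReal_smul hg.continuous.measurable.ennreal_ofReal
      (ae_of_all _ fun _ => ENNReal.ofReal_lt_top), mul_comm]
    simp [ENNReal.toReal_ofReal (hg0 _)]

theorem mecke_prod_isOpen (hπ : IsPoissonMeasure ν π) {C : Set (Config d)} (hC : MeasurableSet C)
    {U : Set (E d)} (hU : IsOpen U) (hb : Bornology.IsBounded U) :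
    ∫⁻ γ in C, γ.counting U ∂π = ∫⁻ γ : Config d, ∫⁻ x, C.indicator 1 (γ.insertPt x) * U.indicator 1 x ∂ν ∂π := by
  have := hπ.isProbability
  obtain ⟨φ, hs, hc, hpos, hmono, hlim⟩ := exists_smooth_approx hU hb
  have hmC : Measurable fun p : Config d × E d => (C.indicator 1 (p.1.insertPt p.2) : ℝ≥0∞) :=
    (measurable_one.indicator hC).comp measurable_insertPt
  have hmφ : ∀ k, Measurable fun x => ENNReal.ofReal (φ k x) := fun k =>
    (hs k).continuous.measurable.ennreal_ofReal
  have hmp : ∀ k, Measurable fun γ => ENNReal.ofReal (pairing (φ k) γ) := fun k =>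
    (continuous_pairing (hs k).continuous (hc k)).measurable.ennreal_ofReal
  have key : ∀ k, ∫⁻ γ in C, ENNReal.ofReal (pairing (φ k) γ) ∂π =
      ∫⁻ γ : Config d, ∫⁻ x, C.indicator 1 (γ.insertPt x) * ENNReal.ofReal (φ k x) ∂ν ∂π := by
    intro k
    have hsf : SFinite (ν.withDensity fun x => ENNReal.ofReal (φ k x)) := inferInstance
    rw [← withDensity_apply _ hC, hπ.withDensity_pairing (hs k) (hc k) (hpos k),
      ← lintegral_indicator_one hC, lintegral_map (measurable_one.indicator hC) measurable_insertPt,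
      lintegral_prod _ hmC.aemeasurable]
    refine lintegral_congr fun γ => ?_
    have h1 := lintegral_withDensity_eq_lintegral_mul ν (hmφ k)
      (hmC.comp (measurable_prodMk_left (x := γ)))
    simp only [Function.comp_def] at h1
    rw [h1]
    simp [mul_comm]
  have lhs : Tendsto (fun k => ∫⁻ γ in C, ENNReal.ofReal (pairing (φ k) γ) ∂π) atTop
      (𝓝 (∫⁻ γ in C, γ.counting U ∂π)) := by
    refine lintegral_tendsto_of_tendsto_of_monotone (fun k => (hmp k).aemeasurable)
      (ae_of_all _ fun γ k l hkl => ?_) (ae_of_all _ fun γ => ?_)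
    · simp only [← lintegral_counting_ofReal _ (hc _) (hpos _)]
      exact lintegral_mono fun x => ENNReal.ofReal_le_ofReal (hmono hkl x)
    · simp only [← lintegral_counting_ofReal _ (hc _) (hpos _)]
      rw [← lintegral_indicator_one hU.measurableSet]
      exact lintegral_tendsto_of_tendsto_of_monotone (fun k => (hmφ k).aemeasurable)
        (ae_of_all _ fun x k l hkl => ENNReal.ofReal_le_ofReal (hmono hkl x)) (ae_of_all _ hlim)
  have hin : ∀ γ : Config d, Tendsto (fun k => ∫⁻ x, C.indicator 1 (γ.insertPt x) * ENNReal.ofReal (φ k x) ∂ν)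
      atTop (𝓝 (∫⁻ x, C.indicator 1 (γ.insertPt x) * U.indicator 1 x ∂ν)) := fun γ => by
    refine lintegral_tendsto_of_tendsto_of_monotone
      (fun k => ((hmC.comp measurable_prodMk_left).mul (hmφ k)).aemeasurable)
      (ae_of_all _ fun x k l hkl => mul_le_mul_right (ENNReal.ofReal_le_ofReal (hmono hkl x)) _)
      (ae_of_all _ fun x => ?_)
    refine ENNReal.Tendsto.const_mul (hlim x) (Or.inr ?_)
    by_cases h : γ.insertPt x ∈ C <;> simp [h]
  have rhs : Tendsto (fun k => ∫⁻ γ : Config d, ∫⁻ x, C.indicator 1 (γ.insertPt x) * ENNReal.ofReal (φ k x) ∂ν ∂π)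
      atTop (𝓝 (∫⁻ γ : Config d, ∫⁻ x, C.indicator 1 (γ.insertPt x) * U.indicator 1 x ∂ν ∂π)) := by
    refine lintegral_tendsto_of_tendsto_of_monotone (fun k => ?_)
      (ae_of_all _ fun γ k l hkl => ?_) (ae_of_all _ hin)
    · exact (Measurable.lintegral_prod_right' (f := fun p : Config d × E d =>
        C.indicator 1 (p.1.insertPt p.2) * ENNReal.ofReal (φ k p.2))
        (hmC.mul ((hmφ k).comp measurable_snd))).aemeasurable
    · exact lintegral_mono fun x => mul_le_mul_right (ENNReal.ofReal_le_ofReal (hmono hkl x)) _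
  simp only [key] at lhs
  exact tendsto_nhds_unique lhs rhs

/-- The Mecke identity. -/
theorem mecke (hπ : IsPoissonMeasure ν π) [SFinite π] :
    π ⊗ₘ countingKernel d = (π.prod ν).map fun p => (p.1.insertPt p.2, p.2) := by
  have := hπ.isProbability
  have hm : Measurable fun p : Config d × E d => (p.1.insertPt p.2, p.2) :=
    measurable_insertPt.prodMk measurable_snd
  have hbdd : ∀ {C : Set (Config d)} {U : Set (E d)}, MeasurableSet C → IsOpen U →
      Bornology.IsBounded U → (π ⊗ₘ countingKernel d) (C ×ˢ U) =
        (π.prod ν).map (fun p => (p.1.insertPt p.2, p.2)) (C ×ˢ U) := by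
    intro C U hC hU hb
    rw [Measure.compProd_apply_prod hC hU.measurableSet]
    simp only [countingKernel_apply]
    rw [hπ.mecke_prod_isOpen hC hU hb, ← lintegral_indicator_one (hC.prod hU.measurableSet),
      lintegral_map (measurable_one.indicator (hC.prod hU.measurableSet)) hm, lintegral_prod]
    · refine lintegral_congr fun γ => lintegral_congr fun x => ?_
      by_cases h1 : γ.insertPt x ∈ C <;> by_cases h2 : x ∈ U <;> simp [h1, h2]
    · exact ((measurable_one.indicator (hC.prod hU.measurableSet)).comp hm).aemeasurable
  -- Continuity from below along `U ∩ ball 0 n` removes the boundedness of `U`; the measures are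
  -- then compared on the π-system of rectangles.
  have hopen : ∀ {C : Set (Config d)} {U : Set (E d)}, MeasurableSet C → IsOpen U →
      (π ⊗ₘ countingKernel d) (C ×ˢ U) =
        (π.prod ν).map (fun p => (p.1.insertPt p.2, p.2)) (C ×ˢ U) := by
    intro C U hC hU
    have hUn : C ×ˢ U = ⋃ n : ℕ, C ×ˢ (U ∩ Metric.ball 0 n) := by
      rw [← prod_iUnion, ← inter_iUnion, Metric.iUnion_ball_nat, inter_univ]
    have hmon : Monotone fun n : ℕ => C ×ˢ (U ∩ Metric.ball (0 : E d) n) := fun m n hmn =>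
      prod_mono le_rfl (inter_subset_inter_right _ (Metric.ball_subset_ball (by exact_mod_cast hmn)))
    rw [hUn, hmon.measure_iUnion, hmon.measure_iUnion]
    exact iSup_congr fun n => hbdd hC (hU.inter Metric.isOpen_ball)
      (Metric.isBounded_ball.subset inter_subset_right)
  refine Measure.ext_of_generateFrom_of_iUnion
    (image2 (· ×ˢ ·) {C : Set (Config d) | MeasurableSet C} {U : Set (E d) | IsOpen U})
    (fun n : ℕ => univ ×ˢ Metric.ball 0 n) ?_ ?_ ?_ (fun n => ?_) (fun n => ?_) ?_
  · refine (generateFrom_eq_prod ?_ ?_ ?_ ?_).symm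
    · exact MeasurableSpace.generateFrom_measurableSet
    · exact (BorelSpace.measurable_eq (α := E d)).symm
    · exact isCountablySpanning_measurableSet
    · exact ⟨fun _ => univ, fun _ => by simp, iUnion_const _⟩
  · exact MeasurableSpace.isPiSystem_measurableSet.prod isPiSystem_isOpen
  · rw [← prod_iUnion, Metric.iUnion_ball_nat, univ_prod_univ]
  · exact ⟨univ, by simp, _, by simp, rfl⟩
  · rw [hopen MeasurableSet.univ Metric.isOpen_ball,
      Measure.map_apply hm (MeasurableSet.univ.prod measurableSet_ball)]
    have : (fun p : Config d × E d => (p.1.insertPt p.2, p.2)) ⁻¹' (univ ×ˢ Metric.ball 0 n) =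
        univ ×ˢ Metric.ball 0 n := by
      ext p; simp
    rw [this, Measure.prod_prod, measure_univ, one_mul]
    exact Metric.isBounded_ball.measure_lt_top.ne
  · rintro _ ⟨C, hC, U, hU, rfl⟩
    exact hopen hC hU

theorem lintegral_tsum (hπ : IsPoissonMeasure ν π) {h : Config d → E d → ℝ≥0∞}
    (hh : Measurable (Function.uncurry h)) :
    ∫⁻ γ, ∑' x : γ.carrier, h γ x ∂π = ∫⁻ γ, ∫⁻ x, h (γ.insertPt x) x ∂ν ∂π := by
  have := hπ.isProbability
  have hm : Measurable fun p : Config d × E d => (p.1.insertPt p.2, p.2) :=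
    measurable_insertPt.prodMk measurable_snd
  have := congrArg (fun μ => ∫⁻ p, Function.uncurry h p ∂μ) hπ.mecke
  rw [Measure.lintegral_compProd hh, lintegral_map hh hm,
    lintegral_prod (fun p : Config d × E d => Function.uncurry h (p.1.insertPt p.2, p.2))
      (hh.comp hm).aemeasurable] at this
  simpa only [countingKernel_apply, lintegral_counting, Function.uncurry] using this

/-- Inserting a point cannot hit a null set `N` with positive measure: by the Mecke identity that
measure is the expected number of points of `γ` on the event `γ ∈ N`. -/
theorem quasiMeasurePreserving_insertPt (hπ : IsPoissonMeasure ν π) :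
    Measure.QuasiMeasurePreserving (fun p : Config d × E d => p.1.insertPt p.2) (π.prod ν) π := by
  have := hπ.isProbability
  refine ⟨measurable_insertPt, Measure.AbsolutelyContinuous.mk fun N hN h0 => ?_⟩
  have hm : Measurable fun p : Config d × E d => (p.1.insertPt p.2, p.2) :=
    measurable_insertPt.prodMk measurable_snd
  have h1 : (π ⊗ₘ countingKernel d) (N ×ˢ univ) = 0 := by
    rw [Measure.compProd_apply_prod hN MeasurableSet.univ]
    exact setLIntegral_measure_zero _ _ h0
  rw [hπ.mecke, Measure.map_apply hm (hN.prod MeasurableSet.univ)] at h1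
  rw [Measure.map_apply measurable_insertPt hN]
  convert h1 using 2
  ext p
  simp

theorem ae_forall_mem (hπ : IsPoissonMeasure ν π) {P : Config d → E d → Prop}
    (hP : MeasurableSet {p : Config d × E d | P p.1 p.2})
    (h : ∀ᵐ p ∂π.prod ν, P (p.1.insertPt p.2) p.2) : ∀ᵐ γ ∂π, ∀ x ∈ γ.carrier, P γ x := by
  have := hπ.isProbability
  have hm : Measurable fun p : Config d × E d => (p.1.insertPt p.2, p.2) :=
    measurable_insertPt.prodMk measurable_snd
  have h1 : ∀ᵐ p ∂(π ⊗ₘ countingKernel d), P p.1 p.2 := by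
    rw [hπ.mecke]
    exact (ae_map_iff hm.aemeasurable hP).2 h
  filter_upwards [Measure.ae_ae_of_ae_compProd h1] with γ hγ
  exact (γ.ae_counting_iff).1 hγ

/-- Under the Mecke identity, moving `x` to `y` becomes inserting `y` into the configuration without
`x`, and insertion respects null sets. This is why `L F` does not depend on the representative of
`F`. -/
theorem ae_forall_mem_ae_move (hπ : IsPoissonMeasure ν π) {μ : Measure (E d)} [SFinite μ]
    (hμ : μ ≪ ν) {P : Config d → Prop} (hP : ∀ᵐ γ ∂π, P γ) :
    ∀ᵐ γ ∂π, ∀ x ∈ γ.carrier, ∀ᵐ y ∂μ, P (γ.move x y) := by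
  have := hπ.isProbability
  -- A measurable null superset is needed so that the measure of its sections is a measurable
  -- function.
  obtain ⟨N, hN, hNm, hN0⟩ := exists_measurable_superset_of_null (ae_iff.1 hP)
  have hq : ∀ᵐ γ ∂π, ∀ x ∈ γ.carrier, μ {y | γ.move x y ∈ N} = 0 := by
    refine hπ.ae_forall_mem (P := fun γ x => μ {y | γ.move x y ∈ N} = 0) ?_ ?_
    · have := measurable_measure_prodMk_left (ν := μ) (measurable_move hNm)
      exact this (measurableSet_singleton 0)
    · have h1 : ∀ᵐ p ∂π.prod ν, p.1.insertPt p.2 ∉ N :=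
        hπ.quasiMeasurePreserving_insertPt.ae (measure_eq_zero_iff_ae_notMem.1 hN0)
      have h2 : ∀ᵐ γ ∂π, ∀ᵐ y ∂μ, γ.insertPt y ∉ N := by
        filter_upwards [Measure.ae_ae_of_ae_prod h1] with γ hγ using hμ hγ
      have h3 : ∀ᵐ p ∂π.prod ν, ∀ᵐ y ∂μ, p.1.insertPt y ∉ N :=
        Measure.quasiMeasurePreserving_fst.ae h2
      filter_upwards [h3, ae_prod_notMem (π := π) (ν := ν)] with p hp hp'
      simp only [insertPt_move hp']
      exact measure_eq_zero_iff_ae_notMem.2 hp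
  filter_upwards [hq] with γ hγ x hx
  filter_upwards [measure_eq_zero_iff_ae_notMem.1 (hγ x hx)] with y hy
  by_contra h
  exact hy (hN h)

theorem quasiMeasurePreserving_fst (hπ : IsPoissonMeasure ν π) [SFinite π] :
    Measure.QuasiMeasurePreserving Prod.fst (π ⊗ₘ countingKernel d) π := by
  rw [hπ.mecke]
  exact ⟨measurable_fst, by
    rw [Measure.map_map measurable_fst (measurable_insertPt.prodMk measurable_snd)]
    exact hπ.quasiMeasurePreserving_insertPt.absolutelyContinuous⟩

theorem quasiMeasurePreserving_snd (hπ : IsPoissonMeasure ν π) [SFinite π] :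
    Measure.QuasiMeasurePreserving Prod.snd (π ⊗ₘ countingKernel d) ν := by
  rw [hπ.mecke]
  exact ⟨measurable_snd, by
    rw [Measure.map_map measurable_snd (measurable_insertPt.prodMk measurable_snd)]
    exact Measure.quasiMeasurePreserving_snd.absolutelyContinuous⟩

theorem quasiMeasurePreserving_erasePt (hπ : IsPoissonMeasure ν π) [SFinite π] :
    Measure.QuasiMeasurePreserving (fun p : Config d × E d => p.1.erasePt p.2)
      (π ⊗ₘ countingKernel d) π := by
  rw [hπ.mecke]
  refine ⟨measurable_erasePt, ?_⟩
  rw [Measure.map_map measurable_erasePt (measurable_insertPt.prodMk measurable_snd)]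
  have : (fun p : Config d × E d => p.1.erasePt p.2) ∘ (fun p => (p.1.insertPt p.2, p.2))
      =ᵐ[π.prod ν] Prod.fst := by
    filter_upwards [ae_prod_notMem (π := π) (ν := ν)] with p hp
    exact erasePt_insertPt hp
  rw [Measure.map_congr this]
  exact Measure.quasiMeasurePreserving_fst.absolutelyContinuous

theorem ae_forall_mem_of_ae (hπ : IsPoissonMeasure ν π) {P : E d → Prop} (h : ∀ᵐ x ∂ν, P x) :
    ∀ᵐ γ ∂π, ∀ x ∈ γ.carrier, P x := by
  have := hπ.isProbability
  filter_upwards [Measure.ae_ae_of_ae_compProd (hπ.quasiMeasurePreserving_snd.ae h)] with γ hγ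
  exact (γ.ae_counting_iff).1 hγ

/-- The Mecke identity for Bochner integrals. -/
theorem integral_tsum (hπ : IsPoissonMeasure ν π) {h : Config d → E d → ℂ}
    (hh : AEStronglyMeasurable (Function.uncurry h) (π ⊗ₘ countingKernel d))
    (hi : Integrable (fun p : Config d × E d => h (p.1.insertPt p.2) p.2) (π.prod ν)) :
    (∀ᵐ γ ∂π, Summable fun x : γ.carrier => h γ x) ∧
    Integrable (fun γ => ∑' x : γ.carrier, h γ x) π ∧
    ∫ γ, ∑' x : γ.carrier, h γ x ∂π = ∫ p, h (p.1.insertPt p.2) p.2 ∂π.prod ν := by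
  have := hπ.isProbability
  have hm : Measurable fun p : Config d × E d => (p.1.insertPt p.2, p.2) :=
    measurable_insertPt.prodMk measurable_snd
  have h1 : Integrable (Function.uncurry h) (π ⊗ₘ countingKernel d) := by
    rw [hπ.mecke] at hh ⊢
    exact (integrable_map_measure hh hm.aemeasurable).2 hi
  have h2 : ∀ᵐ γ ∂π, Summable (fun x : γ.carrier => ‖h γ x‖) ∧
      ∫ x, h γ x ∂γ.counting = ∑' x : γ.carrier, h γ x := by
    filter_upwards [((Measure.integrable_compProd_iff hh).1 h1).1] with γ hγ
    have h3 : Integrable (h γ) γ.counting := hγ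
    have h4 : Summable fun x : γ.carrier => ‖h γ x‖ := by
      have := ((integrable_sum_measure_iff (μ := fun x : γ.carrier => Measure.dirac (x : E d))).1 h3).2
      simpa only [integral_dirac] using this
    refine ⟨h4, ?_⟩
    rw [counting, integral_sum_measure h3]
    simp only [integral_dirac]
  refine ⟨?_, ?_, ?_⟩
  · filter_upwards [h2] with γ hγ using hγ.1.of_norm
  · have h3 : Integrable (fun γ => ∫ x, Function.uncurry h (γ, x) ∂countingKernel d γ) π := by
      have := MeasureTheory.Integrable.integral_compProd h1
      simpa using this
    refine h3.congr ?_
    filter_upwards [h2] with γ hγ using hγ.2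
  · have h3 := Measure.integral_compProd h1
    rw [hπ.mecke] at h3
    rw [hπ.mecke] at h1 hh
    rw [integral_map hm.aemeasurable hh] at h3
    refine Eq.trans (integral_congr_ae ?_) h3.symm
    filter_upwards [h2] with γ hγ using hγ.2.symm

end IsPoissonMeasure

end FreeKawasaki

namespace FreeKawasaki

open ProbabilityTheory Config

/-! ### Bogoliubov exponentials: pointwise properties -/

section Pointwise

variable {d : ℕ} {γ : Config d}

/-- The real product `∏_{x ∈ γ} (1 + a(x))`. -/
def bogoliubovReal (a : E d → ℝ) (γ : Config d) : ℝ := ∏' x : γ.carrier, (1 + a x)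

/-- `∑_{x ∈ γ} ψ(x) e_B(φ, γ \ x)`. -/
def bogoliubovDeriv (φ ψ : E d → ℂ) (γ : Config d) : ℂ :=
  ∑' x : γ.carrier, ψ x * bogoliubov φ (γ.erasePt x)

theorem bogoliubov_congr {f g : E d → ℂ} (h : ∀ x ∈ γ.carrier, f x = g x) :
    bogoliubov f γ = bogoliubov g γ :=
  tprod_congr fun x => by rw [h x x.2]

theorem bogoliubov_zero : bogoliubov (fun _ => 0) γ = 1 := by simp [bogoliubov]

theorem hasProd_bogoliubov {f : E d → ℂ} (hf : Summable fun x : γ.carrier => f x) :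
    HasProd (fun x : γ.carrier => 1 + f x) (bogoliubov f γ) :=
  (Complex.multipliable_one_add_of_summable hf).hasProd

theorem hasProd_bogoliubovReal {f : E d → ℝ} (hf : Summable fun x : γ.carrier => f x) :
    HasProd (fun x : γ.carrier => 1 + f x) (bogoliubovReal f γ) :=
  (Real.multipliable_one_add_of_summable hf).hasProd

theorem bogoliubov_ofReal {f : E d → ℝ} (hf : Summable fun x : γ.carrier => f x) :
    bogoliubov (fun x => (f x : ℂ)) γ = bogoliubovReal f γ := by
  have h := (hasProd_bogoliubovReal hf).map Complex.ofRealHom Complex.continuous_ofReal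
  refine HasProd.unique (hasProd_bogoliubov (Complex.ofRealCLM.summable hf)) ?_
  convert h using 1
  · funext x
    simp
  · rfl

theorem bogoliubov_mul {f g : E d → ℂ} (hf : Summable fun x : γ.carrier => f x)
    (hg : Summable fun x : γ.carrier => g x) :
    bogoliubov f γ * bogoliubov g γ = bogoliubov (fun x => f x + g x + f x * g x) γ := by
  rw [((hasProd_bogoliubov hf).mul (hasProd_bogoliubov hg)).tprod_eq.symm]
  exact tprod_congr fun x => by ring

theorem bogoliubov_conj {f : E d → ℂ} (hf : Summable fun x : γ.carrier => f x) :
    starRingEnd ℂ (bogoliubov f γ) = bogoliubov (fun x => starRingEnd ℂ (f x)) γ := by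
  have h := (hasProd_bogoliubov hf).map (starRingEnd ℂ) Complex.continuous_conj
  rw [← h.tprod_eq]
  exact tprod_congr fun x => by simp

theorem summable_of_subset {M : Type*} [NormedAddCommGroup M] [CompleteSpace M] {γ' : Config d}
    (h : γ'.carrier ⊆ γ.carrier) {f : E d → M}
    (hf : Summable fun x : γ.carrier => f x) : Summable fun x : γ'.carrier => f x :=
  hf.comp_injective (i := Set.inclusion h) (Set.inclusion_injective h)

theorem bogoliubov_insertPt {f : E d → ℂ} (hf : Summable fun x : γ.carrier => f x) {x : E d}
    (hx : x ∉ γ.carrier) : bogoliubov f (γ.insertPt x) = (1 + f x) * bogoliubov f γ := by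
  have h := Multipliable.tprod_union_disjoint (f := fun x => 1 + f x) (s := {x}) (t := γ.carrier)
    (disjoint_singleton_left.2 hx) (hasProd_unique _).multipliable (hasProd_bogoliubov hf).multipliable
  rw [tprod_singleton x (fun x => 1 + f x)] at h
  exact h

theorem bogoliubov_eq_mul_erasePt {f : E d → ℂ} (hf : Summable fun x : γ.carrier => f x) {x : E d}
    (hx : x ∈ γ.carrier) : bogoliubov f γ = (1 + f x) * bogoliubov f (γ.erasePt x) := by
  conv_lhs => rw [← insertPt_erasePt hx]
  exact bogoliubov_insertPt (summable_of_subset sdiff_subset hf) (by simp [erasePt])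

/-- The products over all the sets `γ \ x` are indexed by the finite subsets of the same `γ`, so
that limits for different `x` can be summed. -/
theorem hasProd_erasePt {R : Type*} [NormedField R] {f : E d → R} (x : γ.carrier) {c : R}
    (h : HasProd (fun w : (γ.erasePt x).carrier => 1 + f w) c) :
    open Classical in
    Tendsto (fun T : Finset γ.carrier => ∏ w ∈ T.erase x, (1 + f w)) atTop (𝓝 c) := by
  classical
  have h1 : HasProd (mulIndicator (γ.erasePt x).carrier fun w => 1 + f w) c :=
    hasProd_subtype_iff_mulIndicator.1 h
  have hsub : Function.mulSupport (mulIndicator (γ.erasePt x).carrier fun w => 1 + f w) ⊆ γ.carrier :=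
    fun w hw => by
      by_contra hne
      exact hw (mulIndicator_of_notMem (fun h => hne h.1) _)
  have h2 := (hasProd_subtype_iff_of_mulSupport_subset hsub).2 h1
  refine Tendsto.congr (fun T => ?_) h2
  rw [← Finset.prod_erase T (a := x)]
  · refine Finset.prod_congr rfl fun w hw => ?_
    have : (w : E d) ∈ (γ.erasePt x).carrier :=
      ⟨w.2, fun h => (Finset.mem_erase.1 hw).1 (Subtype.ext h)⟩
    simp [mulIndicator_of_mem this]
  · simp [erasePt]

theorem prod_le_bogoliubovReal {f : E d → ℝ} (hf : Summable fun x : γ.carrier => f x)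
    (h0 : ∀ x, 0 ≤ f x) (T : Finset γ.carrier) : ∏ x ∈ T, (1 + f x) ≤ bogoliubovReal f γ := by
  refine ge_of_tendsto (hasProd_bogoliubovReal hf) ?_
  filter_upwards [eventually_ge_atTop T] with T' hT
  rw [← Finset.prod_sdiff hT]
  refine le_mul_of_one_le_left (Finset.prod_nonneg fun x _ => by linarith [h0 x]) ?_
  refine Finset.prod_induction _ (fun r : ℝ => 1 ≤ r) (fun a b ha hb => ?_) le_rfl
    fun x _ => by linarith [h0 x]
  nlinarith

theorem bogoliubovReal_nonneg {f : E d → ℝ} (hf : Summable fun x : γ.carrier => f x)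
    (h0 : ∀ x, 0 ≤ f x) : 0 ≤ bogoliubovReal f γ :=
  zero_le_one.trans (by simpa using prod_le_bogoliubovReal hf h0 ∅)

theorem norm_bogoliubov_le {f : E d → ℂ} {g : E d → ℝ} (hf : Summable fun x : γ.carrier => f x)
    (hg : Summable fun x : γ.carrier => g x) (h : ∀ x, ‖1 + f x‖ ≤ 1 + g x) :
    ‖bogoliubov f γ‖ ≤ bogoliubovReal g γ := by
  refine le_of_tendsto_of_tendsto (hasProd_bogoliubov hf).norm (hasProd_bogoliubovReal hg)
    (Eventually.of_forall fun T => ?_)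
  exact Finset.prod_le_prod (fun x _ => norm_nonneg _) fun x _ => h x

theorem bogoliubovReal_sq {f : E d → ℝ} (hf : Summable fun x : γ.carrier => f x) :
    bogoliubovReal f γ ^ 2 = bogoliubovReal (fun x => 2 * f x + f x ^ 2) γ := by
  rw [sq, ((hasProd_bogoliubovReal hf).mul (hasProd_bogoliubovReal hf)).tprod_eq.symm]
  exact tprod_congr fun x => by ring

/-- The left side consists of the terms of first degree in `b` in the expansion of the right side;
the other terms are nonnegative. -/
theorem sum_mul_prod_erase_le {ι : Type*} [DecidableEq ι] (T : Finset ι) {a b : ι → ℝ}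
    (ha : ∀ i, 0 ≤ a i) (hb : ∀ i, 0 ≤ b i) :
    ∑ i ∈ T, b i * ∏ j ∈ T.erase i, (1 + a j) ≤ ∏ i ∈ T, (1 + (a i + b i)) := by
  induction T using Finset.induction_on with
  | empty => simp
  | insert i T hi ih =>
    rw [Finset.sum_insert hi, Finset.prod_insert hi, Finset.erase_insert hi]
    have h1 : ∑ j ∈ T, b j * ∏ k ∈ (insert i T).erase j, (1 + a k) =
        (1 + a i) * ∑ j ∈ T, b j * ∏ k ∈ T.erase j, (1 + a k) := by
      rw [Finset.mul_sum]
      refine Finset.sum_congr rfl fun j hj => ?_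
      have hij : i ≠ j := fun h => hi (h ▸ hj)
      rw [Finset.erase_insert_of_ne hij, Finset.prod_insert fun h => hi (Finset.mem_of_mem_erase h)]
      ring
    have h2 : ∏ j ∈ T, (1 + a j) ≤ ∏ j ∈ T, (1 + (a j + b j)) :=
      Finset.prod_le_prod (fun j _ => by linarith [ha j]) fun j _ => by linarith [hb j]
    rw [h1]
    have h3 := mul_le_mul_of_nonneg_left ih (by linarith [ha i] : 0 ≤ 1 + a i)
    have h4 := mul_le_mul_of_nonneg_left h2 (hb i)
    calc _ ≤ _ := add_le_add h4 h3
      _ = _ := by ring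

theorem sum_mul_bogoliubovReal_erasePt_le {a b : E d → ℝ} (ha : ∀ x, 0 ≤ a x) (hb : ∀ x, 0 ≤ b x)
    (hsa : Summable fun x : γ.carrier => a x) (hsb : Summable fun x : γ.carrier => b x)
    (T : Finset γ.carrier) : ∑ x ∈ T, b x * bogoliubovReal a (γ.erasePt x) ≤
      bogoliubovReal (fun x => a x + b x) γ := by
  classical
  have h1 : Tendsto (fun T' : Finset γ.carrier => ∑ x ∈ T, b x * ∏ w ∈ T'.erase x, (1 + a w)) atTop
      (𝓝 (∑ x ∈ T, b x * bogoliubovReal a (γ.erasePt x))) := by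
    refine tendsto_finsetSum _ fun x _ => ?_
    exact (hasProd_erasePt x (hasProd_bogoliubovReal (summable_of_subset sdiff_subset hsa))).const_mul _
  refine le_of_tendsto_of_tendsto h1 (hasProd_bogoliubovReal (hsa.add hsb)) ?_
  filter_upwards [eventually_ge_atTop T] with T' hT
  refine le_trans (Finset.sum_le_sum_of_subset_of_nonneg hT fun x _ _ =>
    mul_nonneg (hb x) (Finset.prod_nonneg fun w _ => by linarith [ha w])) ?_
  exact sum_mul_prod_erase_le T' (fun x : γ.carrier => ha x) (fun x : γ.carrier => hb x)

/-- This domination carries the later integrability proofs: a sum over deleted points is bounded by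
a single product, whose moments under the Poisson measure are computable. -/
theorem summable_norm_bogoliubovDeriv {φ ψ : E d → ℂ} (hφ : Summable fun x : γ.carrier => φ x)
    (hψ : Summable fun x : γ.carrier => ψ x) :
    Summable (fun x : γ.carrier => ‖ψ x * bogoliubov φ (γ.erasePt x)‖) ∧
    ∑' x : γ.carrier, ‖ψ x * bogoliubov φ (γ.erasePt x)‖ ≤
      bogoliubovReal (fun x => ‖φ x‖ + ‖ψ x‖) γ := by
  have hle : ∀ T : Finset γ.carrier, ∑ x ∈ T, ‖ψ x * bogoliubov φ (γ.erasePt x)‖ ≤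
      bogoliubovReal (fun x => ‖φ x‖ + ‖ψ x‖) γ := fun T => by
    have h1 : ∑ x ∈ T, ‖ψ x‖ * bogoliubovReal (fun x => ‖φ x‖) (γ.erasePt x) ≤
        bogoliubovReal (fun x => ‖φ x‖ + ‖ψ x‖) γ :=
      sum_mul_bogoliubovReal_erasePt_le (fun x => norm_nonneg (φ x)) (fun x => norm_nonneg (ψ x))
        hφ.norm hψ.norm T
    refine le_trans (Finset.sum_le_sum fun x _ => ?_) h1
    rw [norm_mul]
    refine mul_le_mul_of_nonneg_left ?_ (norm_nonneg _)
    have hsub : (γ.erasePt x).carrier ⊆ γ.carrier := fun _ h => h.1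
    have h2 : Summable fun w : (γ.erasePt x).carrier => φ w := summable_of_subset hsub hφ
    exact norm_bogoliubov_le h2 h2.norm fun x => (norm_add_le _ _).trans (by simp)
  have hs := summable_of_sum_le (fun x : γ.carrier => norm_nonneg (ψ x * bogoliubov φ (γ.erasePt x))) hle
  exact ⟨hs, Summable.tsum_le_of_sum_le hs hle⟩

theorem norm_bogoliubovDeriv_le {φ ψ : E d → ℂ} (hφ : Summable fun x : γ.carrier => φ x)
    (hψ : Summable fun x : γ.carrier => ψ x) :
    ‖bogoliubovDeriv φ ψ γ‖ ≤ bogoliubovReal (fun x => ‖φ x‖ + ‖ψ x‖) γ := by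
  have h := summable_norm_bogoliubovDeriv hφ hψ
  exact (norm_tsum_le_tsum_norm h.1).trans h.2

theorem bogoliubov_eq_exp_pairing {f : E d → ℝ} (hf : HasCompactSupport f) :
    bogoliubov (fun x => (Real.exp (f x) - 1 : ℂ)) γ = Real.exp (γ.pairing f) := by
  have h := (γ.summable_of_hasCompactSupport hf).hasSum
  have h2 := (Complex.hasSum_ofReal.2 h).cexp
  rw [Complex.ofReal_exp]
  refine Eq.trans (tprod_congr fun x => ?_) h2.tprod_eq
  simp

/-- Truncation of a function. -/
def truncate (n : ℕ) (φ : E d → ℂ) : E d → ℂ :=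
  {x | ‖φ x‖ ≤ n ∧ ‖x‖ ≤ n}.indicator φ

theorem norm_truncate_le (n : ℕ) (φ : E d → ℂ) (x : E d) : ‖truncate n φ x‖ ≤ ‖φ x‖ :=
  norm_indicator_le_norm_self _ _

theorem norm_truncate_le' (n : ℕ) (φ : E d → ℂ) (x : E d) : ‖truncate n φ x‖ ≤ n := by
  by_cases h : ‖φ x‖ ≤ n ∧ ‖x‖ ≤ n
  · simp [truncate, h]
  · simp [truncate, h]

theorem hasCompactSupport_truncate (n : ℕ) (φ : E d → ℂ) : HasCompactSupport (truncate n φ) := by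
  refine HasCompactSupport.intro (isCompact_closedBall 0 n) fun x hx => ?_
  rw [mem_closedBall_zero_iff] at hx
  simp [truncate, hx]

theorem measurable_truncate (n : ℕ) {φ : E d → ℂ} (hφ : Measurable φ) : Measurable (truncate n φ) :=
  hφ.indicator ((measurableSet_le hφ.norm measurable_const).inter
    (measurableSet_le measurable_norm measurable_const))

theorem tendsto_truncate (φ : E d → ℂ) (x : E d) :
    Tendsto (fun n => truncate n φ x) atTop (𝓝 (φ x)) := by
  refine tendsto_const_nhds.congr' ?_
  filter_upwards [eventually_ge_atTop ⌈‖φ x‖⌉₊, eventually_ge_atTop ⌈‖x‖⌉₊] with n h1 h2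
  have : x ∈ {x | ‖φ x‖ ≤ n ∧ ‖x‖ ≤ n} := ⟨Nat.ceil_le.1 h1, Nat.ceil_le.1 h2⟩
  rw [truncate, indicator_of_mem this]

theorem tendsto_bogoliubov_truncate {φ : E d → ℂ} (hφ : Summable fun x : γ.carrier => φ x) :
    Tendsto (fun n => bogoliubov (truncate n φ) γ) atTop (𝓝 (bogoliubov φ γ)) :=
  tendsto_tprod_one_add_of_dominated_convergence hφ.norm (fun x => tendsto_truncate φ x)
    (Eventually.of_forall fun n x => norm_truncate_le n φ x)

end Pointwise

end FreeKawasaki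

namespace FreeKawasaki

open ProbabilityTheory Config

/-! ### Bogoliubov exponentials under the Poisson measure -/

variable {d : ℕ}

theorem exists_measurable_ae_eq {ν : Measure (E d)} {φ : E d → ℂ} (hφ : Integrable φ ν) :
    ∃ φ' : E d → ℂ, Measurable φ' ∧ Integrable φ' ν ∧ φ =ᵐ[ν] φ' :=
  ⟨hφ.1.mk φ, hφ.1.stronglyMeasurable_mk.measurable, hφ.congr hφ.1.ae_eq_mk, hφ.1.ae_eq_mk⟩

theorem bogoliubovReal_le_exp {γ : Config d} {a : E d → ℝ} (h0 : ∀ x, 0 ≤ a x)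
    (hs : Summable fun x : γ.carrier => a x) :
    bogoliubovReal a γ ≤ Real.exp (∑' x : γ.carrier, a x) := by
  refine le_of_tendsto_of_tendsto (hasProd_bogoliubovReal hs) hs.hasSum.rexp
    (Eventually.of_forall fun T => ?_)
  exact Finset.prod_le_prod (fun x _ => by linarith [h0 x])
    fun x _ => by simpa [add_comm] using Real.add_one_le_exp (a x)

theorem hasDerivAt_bogoliubov {φ : E d → ℂ} (hc : HasCompactSupport φ) (γ : Config d) (s : ℂ) :
    HasDerivAt (fun s : ℂ => bogoliubov (fun x => s * φ x) γ)
      (bogoliubovDeriv (fun x => s * φ x) φ γ) s := by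
  classical
  set T := (γ.finite_support hc).toFinset with hT
  have hmem : ∀ x : γ.carrier, x ∉ T → φ x = 0 := fun x hx => by
    simpa [hT] using hx
  have h1 : ∀ s : ℂ, bogoliubov (fun x => s * φ x) γ = ∏ x ∈ T, (1 + s * φ x) := fun s =>
    tprod_eq_prod fun x hx => by simp [hmem x hx]
  have h2 : bogoliubovDeriv (fun x => s * φ x) φ γ =
      ∑ x ∈ T, (∏ w ∈ T.erase x, (1 + s * φ w)) • φ x := by
    rw [bogoliubovDeriv, tsum_eq_sum (s := T) fun x hx => by simp [hmem x hx]]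
    refine Finset.sum_congr rfl fun x hx => ?_
    rw [smul_eq_mul, mul_comm]
    congr 1
    have hsub : (γ.erasePt x).carrier ⊆ γ.carrier := fun _ h => h.1
    have hs : Summable fun w : (γ.erasePt x).carrier => s * φ w :=
      summable_of_subset (f := fun w => s * φ w) hsub
        ((γ.summable_of_hasCompactSupport hc).mul_left s)
    refine tendsto_nhds_unique (hasProd_erasePt x (hasProd_bogoliubov hs)) ?_
    refine tendsto_const_nhds.congr' ?_
    filter_upwards [eventually_ge_atTop T] with T' hT'
    refine Finset.prod_subset (Finset.erase_subset_erase _ hT') fun w hw hw' => ?_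
    have : w ∉ T := fun h => hw' (Finset.mem_erase.2 ⟨(Finset.mem_erase.1 hw).1, h⟩)
    simp [hmem w this]
  rw [h2]
  simp only [h1]
  refine HasDerivAt.fun_finsetProd fun x _ => ?_
  simpa using ((hasDerivAt_id s).mul_const (φ x)).const_add 1

namespace IsPoissonMeasure

variable {ν : Measure (E d)} {π : Measure (Config d)}
variable [SigmaFinite ν] [NullSingletonClass ν] [IsFiniteMeasureOnCompacts ν]

theorem ae_summable (hπ : IsPoissonMeasure ν π) {φ : E d → ℂ} (hφ : Integrable φ ν) :
    ∀ᵐ γ ∂π, Summable fun x : γ.carrier => φ x := by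
  have := hπ.isProbability
  exact (hπ.integral_tsum (h := fun _ x => φ x)
    (hφ.1.comp_quasiMeasurePreserving hπ.quasiMeasurePreserving_snd) (hφ.comp_snd π)).1

theorem bogoliubov_ae_congr (hπ : IsPoissonMeasure ν π) {f g : E d → ℂ} (h : f =ᵐ[ν] g) :
    bogoliubov f =ᵐ[π] bogoliubov g := by
  filter_upwards [hπ.ae_forall_mem_of_ae h] with γ hγ using bogoliubov_congr hγ

/-- An uncountable family of index sets underlies the infinite product. Where no factor vanishes it
is the exponential of the integral of `log (1 + φ')` against the counting measure; elsewhere it is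
`0`. Both cases are measurable in `γ`. -/
theorem aestronglyMeasurable_bogoliubov (hπ : IsPoissonMeasure ν π) {φ : E d → ℂ}
    (hφ : Integrable φ ν) : AEStronglyMeasurable (bogoliubov φ) π := by
  have := hπ.isProbability
  obtain ⟨φ', hm, hi, hae⟩ := exists_measurable_ae_eq hφ
  refine AEStronglyMeasurable.congr ?_ (hπ.bogoliubov_ae_congr hae).symm
  have hA : MeasurableSet {x : E d | 1 + φ' x = 0} :=
    measurableSet_eq_fun (measurable_const.add hm) measurable_const
  have hlog : Measurable fun x : E d => Complex.log (1 + φ' x) := by fun_prop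
  have hB : MeasurableSet {γ : Config d | γ.counting {x | 1 + φ' x = 0} = 0} :=
    (Kernel.measurable_coe (countingKernel d) hA) (measurableSet_singleton 0)
  have hF : StronglyMeasurable fun γ : Config d =>
      {γ : Config d | γ.counting {x | 1 + φ' x = 0} = 0}.indicator
        (fun γ => Complex.exp (∫ x, Complex.log (1 + φ' x) ∂γ.counting)) γ := by
    refine StronglyMeasurable.indicator ?_ hB
    have h1 : StronglyMeasurable fun γ : Config d => ∫ x, Complex.log (1 + φ' x) ∂countingKernel d γ :=
      hlog.stronglyMeasurable.integral_kernel
    exact Complex.continuous_exp.comp_stronglyMeasurable h1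
  refine hF.aestronglyMeasurable.congr ?_
  filter_upwards [hπ.ae_summable hi] with γ hγ
  by_cases hz : ∃ x : γ.carrier, 1 + φ' x = 0
  · rw [indicator_of_notMem, bogoliubov, tprod_of_exists_eq_zero hz]
    obtain ⟨x, hx⟩ := hz
    intro h0
    have := (γ.ae_counting_iff (p := fun x => 1 + φ' x ≠ 0)).1 (by
      rw [ae_iff]; simpa using h0) x x.2
    exact this hx
  · push Not at hz
    have h0 : γ.counting {x | 1 + φ' x = 0} = 0 := by
      have := (γ.ae_counting_iff (p := fun x => 1 + φ' x ≠ 0)).2 fun x hx => hz ⟨x, hx⟩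
      rw [ae_iff] at this
      simpa using this
    rw [indicator_of_mem (by exact h0)]
    have hs := Complex.summable_log_one_add_of_summable hγ
    rw [bogoliubov, ← Complex.cexp_tsum_eq_tprod hz hs, counting, integral_sum_measure]
    · simp only [integral_dirac]
    · exact (integrable_sum_measure_iff (μ := fun x : γ.carrier => Measure.dirac (x : E d))).2
        ⟨fun x => integrable_dirac (by simp), by simpa only [integral_dirac] using hs.norm⟩

theorem ae_bogoliubov_insertPt (hπ : IsPoissonMeasure ν π) {φ : E d → ℂ} (hφ : Integrable φ ν) :
    ∀ᵐ p ∂π.prod ν, bogoliubov φ (p.1.insertPt p.2) = (1 + φ p.2) * bogoliubov φ p.1 := by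
  have := hπ.isProbability
  filter_upwards [ae_prod_notMem (π := π) (ν := ν),
    Measure.quasiMeasurePreserving_fst.ae (hπ.ae_summable hφ)] with p hp hs
  exact bogoliubov_insertPt hs hp

theorem aestronglyMeasurable_mul_erasePt (hπ : IsPoissonMeasure ν π) {φ ψ : E d → ℂ}
    (hφ : Integrable φ ν) (hψ : Integrable ψ ν) [SFinite π] :
    AEStronglyMeasurable (Function.uncurry fun (γ : Config d) x => ψ x * bogoliubov φ (γ.erasePt x))
      (π ⊗ₘ countingKernel d) :=
  (hψ.1.comp_quasiMeasurePreserving hπ.quasiMeasurePreserving_snd).mul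
    ((hπ.aestronglyMeasurable_bogoliubov hφ).comp_quasiMeasurePreserving
      hπ.quasiMeasurePreserving_erasePt)

theorem integral_bogoliubovDeriv (hπ : IsPoissonMeasure ν π) {φ ψ : E d → ℂ}
    (hφ : Integrable φ ν) (hψ : Integrable ψ ν) (hi : Integrable (bogoliubov φ) π) :
    Integrable (bogoliubovDeriv φ ψ) π ∧
    ∫ γ, bogoliubovDeriv φ ψ γ ∂π = (∫ x, ψ x ∂ν) * ∫ γ, bogoliubov φ γ ∂π := by
  have := hπ.isProbability
  have hae : (fun p : Config d × E d => ψ p.2 * bogoliubov φ ((p.1.insertPt p.2).erasePt p.2))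
      =ᵐ[π.prod ν] fun p => bogoliubov φ p.1 * ψ p.2 := by
    filter_upwards [ae_prod_notMem (π := π) (ν := ν)] with p hp
    rw [erasePt_insertPt hp, mul_comm]
  have h := hπ.integral_tsum (h := fun γ x => ψ x * bogoliubov φ (γ.erasePt x))
    (hπ.aestronglyMeasurable_mul_erasePt hφ hψ) ((hi.mul_prod hψ).congr hae.symm)
  refine ⟨h.2.1, h.2.2.trans ?_⟩
  rw [integral_congr_ae hae, integral_prod_mul, mul_comm]

/-- By the Mecke identity `h(s) = ∫ e_B(sφ) dπ` solves `h' = (∫ φ dν) h` with `h(0) = 1`. -/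
theorem integral_bogoliubov_of_bounded (hπ : IsPoissonMeasure ν π) {φ : E d → ℂ}
    (hφ : Measurable φ) {C : ℝ} (hC : ∀ x, ‖φ x‖ ≤ C) (hc : HasCompactSupport φ) :
    Integrable (bogoliubov φ) π ∧ ∫ γ, bogoliubov φ γ ∂π = Complex.exp (∫ x, φ x ∂ν) := by
  have := hπ.isProbability
  have hC0 : 0 ≤ C := (norm_nonneg _).trans (hC 0)
  have hi : Integrable φ ν := by
    have h1 : IntegrableOn φ (tsupport φ) ν :=
      Measure.integrableOn_of_bounded (M := C) hc.measure_lt_top.ne hφ.aestronglyMeasurable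
        (ae_of_all _ hC)
    exact (integrableOn_iff_integrable_of_support_subset (subset_tsupport φ)).1 h1
  obtain ⟨R, hR0, hR⟩ := hc.isBounded.exists_pos_norm_le
  -- A smooth function equal to `1` where `φ ≠ 0`: the Poisson exponential moments of its multiples
  -- dominate every product that occurs.
  let g : ContDiffBump (0 : E d) := ⟨R, R + 1, hR0, by linarith⟩
  have hg1 : ∀ x, φ x ≠ 0 → g x = 1 := fun x hx =>
    g.one_of_mem_closedBall (by simpa using hR x (subset_tsupport _ hx))
  have hbound : ∀ (γ : Config d) (r : ℝ), 0 ≤ r →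
      bogoliubovReal (fun x => r * ‖φ x‖) γ ≤ Real.exp (pairing (fun x => r * C * g x) γ) := by
    intro γ r hr
    have hs : Summable fun x : γ.carrier => r * ‖φ x‖ :=
      (γ.summable_of_hasCompactSupport hc).norm.mul_left r
    refine (bogoliubovReal_le_exp (fun x => mul_nonneg hr (norm_nonneg _)) hs).trans
      (Real.exp_le_exp.2 (hs.tsum_le_tsum (fun x => ?_)
        ((γ.summable_of_hasCompactSupport g.hasCompactSupport).mul_left (r * C))))
    by_cases hx : φ x = 0
    · simp only [hx, norm_zero, mul_zero]
      exact mul_nonneg (mul_nonneg hr hC0) g.nonneg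
    · simp only [hg1 x hx, mul_one]
      exact mul_le_mul_of_nonneg_left (hC x) hr
  have hexp : ∀ r : ℝ, Integrable (fun γ => Real.exp (pairing (fun x => r * C * g x) γ)) π :=
    fun r => hπ.integrable_exp (contDiff_const.mul g.contDiff) g.hasCompactSupport.mul_left
  have hsm : ∀ s : ℂ, Integrable (fun x => s * φ x) ν := fun s => hi.const_mul s
  have hint : ∀ s : ℂ, Integrable (bogoliubov fun x => s * φ x) π := fun s => by
    refine (hexp ‖s‖).mono' (hπ.aestronglyMeasurable_bogoliubov (hsm s)) (ae_of_all _ fun γ => ?_)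
    refine le_trans ?_ (hbound γ ‖s‖ (norm_nonneg _))
    refine norm_bogoliubov_le ((γ.summable_of_hasCompactSupport hc).mul_left s)
      ((γ.summable_of_hasCompactSupport hc).norm.mul_left _) fun x => ?_
    exact (norm_add_le _ _).trans (by simp)
  have hder : ∀ s : ℂ, HasDerivAt (fun s : ℂ => ∫ γ, bogoliubov (fun x => s * φ x) γ ∂π)
      ((∫ x, φ x ∂ν) * ∫ γ, bogoliubov (fun x => s * φ x) γ ∂π) s := by
    intro s
    have hd := hπ.integral_bogoliubovDeriv (hsm s) hi (hint s)
    rw [← hd.2]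
    refine (hasDerivAt_integral_of_dominated_loc_of_deriv_le
      (F' := fun s γ => bogoliubovDeriv (fun x => s * φ x) φ γ)
      -- On the unit ball about `s` one has `‖t‖ ≤ ‖s‖ + 1`, and the bound for the derivative adds
      -- one more `‖φ‖`.
      (bound := fun γ => Real.exp (pairing (fun x => (‖s‖ + 2) * C * g x) γ))
      (Metric.ball_mem_nhds s one_pos) (Eventually.of_forall fun t => (hint t).1) (hint s) hd.1.1
      (ae_of_all _ fun γ t ht => ?_) (hexp _)
      (ae_of_all _ fun γ t _ => hasDerivAt_bogoliubov hc γ t)).2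
    have hs1 := γ.summable_of_hasCompactSupport hc
    refine (norm_bogoliubovDeriv_le (hs1.mul_left t) hs1).trans
      (le_trans ?_ (hbound γ (‖s‖ + 2) (by positivity)))
    refine le_of_tendsto_of_tendsto (hasProd_bogoliubovReal ((hs1.mul_left t).norm.add hs1.norm))
      (hasProd_bogoliubovReal (hs1.norm.mul_left (‖s‖ + 2))) (Eventually.of_forall fun T => ?_)
    refine Finset.prod_le_prod (fun x _ => by positivity) fun x _ => ?_
    have h2 : ‖t‖ ≤ ‖s‖ + 1 := by
      rw [mem_ball_iff_norm] at ht
      linarith [norm_le_norm_add_norm_sub s t, norm_sub_rev s t]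
    simp only [norm_mul]
    nlinarith [norm_nonneg (φ x)]
  have hconst : ∀ s : ℂ, (∫ γ, bogoliubov (fun x => s * φ x) γ ∂π) *
      Complex.exp (-(s * ∫ x, φ x ∂ν)) = (∫ γ, bogoliubov (fun x => 0 * φ x) γ ∂π) *
      Complex.exp (-(0 * ∫ x, φ x ∂ν)) := by
    intro s
    have hd : ∀ s : ℂ, HasDerivAt (fun s : ℂ => (∫ γ, bogoliubov (fun x => s * φ x) γ ∂π) *
        Complex.exp (-(s * ∫ x, φ x ∂ν))) 0 s := fun s => by
      have h1 : HasDerivAt (fun s : ℂ => Complex.exp (-(s * ∫ x, φ x ∂ν)))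
          (Complex.exp (-(s * ∫ x, φ x ∂ν)) * -(1 * ∫ x, φ x ∂ν)) s :=
        (((hasDerivAt_id s).mul_const _).neg).cexp
      exact ((hder s).fun_mul h1).congr_deriv (by ring)
    exact is_const_of_deriv_eq_zero (fun s => (hd s).differentiableAt) (fun s => (hd s).deriv) s 0
  have h1 := hconst 1
  simp only [zero_mul, one_mul, neg_zero, Complex.exp_zero, mul_one, bogoliubov_zero] at h1
  rw [integral_const, probReal_univ, one_smul, Complex.exp_neg] at h1
  refine ⟨by simpa using hint 1, ?_⟩
  field_simp at h1
  exact h1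

theorem integrable_of_bounded {φ : E d → ℂ} (hφ : Integrable φ ν) (hm : Measurable φ) (n : ℕ) :
    Integrable (truncate n φ) ν :=
  hφ.mono (measurable_truncate n hm).aestronglyMeasurable (ae_of_all _ (norm_truncate_le n φ))

/-- Fatou's lemma along truncations, whose integrals are at most `exp ∫ ‖φ‖ dν` by the bounded case.
-/
theorem integrable_bogoliubovReal_norm (hπ : IsPoissonMeasure ν π) {φ : E d → ℂ}
    (hφ : Integrable φ ν) : Integrable (bogoliubovReal fun x => ‖φ x‖) π := by
  have := hπ.isProbability
  have hn : Integrable (fun x => (‖φ x‖ : ℂ)) ν := hφ.norm.ofReal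
  obtain ⟨φ', hm, hi, hae⟩ := exists_measurable_ae_eq hn
  set t : ℕ → E d → ℂ := fun n x => ((‖truncate n φ' x‖ : ℝ) : ℂ)
  have ht : ∀ n, Integrable (bogoliubov (t n)) π ∧
      ∫ γ, bogoliubov (t n) γ ∂π = Complex.exp (∫ x, t n x ∂ν) := fun n =>
    hπ.integral_bogoliubov_of_bounded (C := n)
      (Complex.measurable_ofReal.comp (measurable_truncate n hm).norm)
      (fun x => by simpa [t] using norm_truncate_le' n φ' x)
      ((hasCompactSupport_truncate n φ').comp_left (g := fun w : ℂ => ((‖w‖ : ℝ) : ℂ)) (by simp))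
  have hts : ∀ (γ : Config d) n, Summable fun x : γ.carrier => ‖truncate n φ' x‖ := fun γ n =>
    (γ.summable_of_hasCompactSupport (hasCompactSupport_truncate n φ')).norm
  have hle : ∀ n, ∫⁻ γ, ‖bogoliubov (t n) γ‖ₑ ∂π ≤ ENNReal.ofReal (Real.exp (∫ x, ‖φ' x‖ ∂ν)) := by
    intro n
    rw [← ofReal_integral_norm_eq_lintegral_enorm (ht n).1]
    refine ENNReal.ofReal_le_ofReal ?_
    have h1 : ((∫ γ, ‖bogoliubov (t n) γ‖ ∂π : ℝ) : ℂ) = ∫ γ, bogoliubov (t n) γ ∂π := by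
      rw [← integral_complex_ofReal]
      refine integral_congr_ae (ae_of_all _ fun γ => ?_)
      simp only
      have h2 : bogoliubov (t n) γ = bogoliubovReal (fun x => ‖truncate n φ' x‖) γ :=
        bogoliubov_ofReal (hts γ n)
      have h3 : 0 ≤ bogoliubovReal (fun x => ‖truncate n φ' x‖) γ :=
        bogoliubovReal_nonneg (hts γ n) fun x => norm_nonneg _
      rw [h2, Complex.norm_real, Real.norm_of_nonneg h3]
    have h4 : ∫ x, t n x ∂ν = ((∫ x, ‖truncate n φ' x‖ ∂ν : ℝ) : ℂ) := integral_complex_ofReal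
    rw [(ht n).2, h4, ← Complex.ofReal_exp] at h1
    rw [Complex.ofReal_injective h1]
    refine Real.exp_le_exp.2 ?_
    exact integral_mono (integrable_of_bounded hi hm n).norm hi.norm (norm_truncate_le n φ')
  have hsum' := hπ.ae_summable hi
  have hlim : ∀ᵐ γ ∂π, Tendsto (fun n => bogoliubov (t n) γ) atTop
      (𝓝 (bogoliubovReal (fun x => ‖φ x‖) γ : ℂ)) := by
    filter_upwards [hsum', hπ.ae_summable hφ, hπ.ae_forall_mem_of_ae hae] with γ h1 h2 h3
    rw [← bogoliubov_ofReal (f := fun x => ‖φ x‖) h2.norm]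
    refine tendsto_tprod_one_add_of_dominated_convergence h1.norm (fun x => ?_)
      (Eventually.of_forall fun n x => by simpa [t] using norm_truncate_le n φ' x)
    have h4 := (tendsto_truncate φ' x).norm
    rw [show φ' x = _ from (h3 x x.2).symm] at h4
    simpa [t, Function.comp_def] using (Complex.continuous_ofReal.tendsto _).comp h4
  have hmeas : AEStronglyMeasurable (fun γ => (bogoliubovReal (fun x => ‖φ x‖) γ : ℂ)) π :=
    aestronglyMeasurable_of_tendsto_ae atTop (fun n => (ht n).1.1) hlim
  have hI : Integrable (fun γ => (bogoliubovReal (fun x => ‖φ x‖) γ : ℂ)) π := by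
    refine ⟨hmeas, ?_⟩
    refine lt_of_le_of_lt ?_ (ENNReal.ofReal_lt_top (r := Real.exp (∫ x, ‖φ' x‖ ∂ν)))
    have h1 : ∫⁻ γ, ‖(bogoliubovReal (fun x => ‖φ x‖) γ : ℂ)‖ₑ ∂π =
        ∫⁻ γ, liminf (fun n => ‖bogoliubov (t n) γ‖ₑ) atTop ∂π :=
      lintegral_congr_ae (hlim.mono fun γ h => h.enorm.liminf_eq.symm)
    rw [h1]
    refine (lintegral_liminf_le' fun n => (ht n).1.1.enorm).trans ?_
    exact (liminf_le_liminf (Eventually.of_forall hle)).trans (by simp)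
  simpa using hI.re

theorem integrable_bogoliubovReal (hπ : IsPoissonMeasure ν π) {f : E d → ℝ}
    (hf : Integrable f ν) (h0 : ∀ x, 0 ≤ f x) : Integrable (bogoliubovReal f) π := by
  have := hπ.integrable_bogoliubovReal_norm (φ := fun x => (f x : ℂ)) hf.ofReal
  simpa [abs_of_nonneg (h0 _)] using this

theorem integrable_bogoliubov (hπ : IsPoissonMeasure ν π) {φ : E d → ℂ} (hφ : Integrable φ ν) :
    Integrable (bogoliubov φ) π := by
  refine (hπ.integrable_bogoliubovReal_norm hφ).mono' (hπ.aestronglyMeasurable_bogoliubov hφ) ?_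
  filter_upwards [hπ.ae_summable hφ] with γ hγ
  exact norm_bogoliubov_le hγ hγ.norm fun x => (norm_add_le _ _).trans (by simp)

theorem integral_bogoliubov (hπ : IsPoissonMeasure ν π) {φ : E d → ℂ} (hφ : Integrable φ ν) :
    ∫ γ, bogoliubov φ γ ∂π = Complex.exp (∫ x, φ x ∂ν) := by
  obtain ⟨φ', hm, hi, hae⟩ := exists_measurable_ae_eq hφ
  rw [integral_congr_ae (hπ.bogoliubov_ae_congr hae), integral_congr_ae hae]
  have h1 : Tendsto (fun n => ∫ γ, bogoliubov (truncate n φ') γ ∂π) atTop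
      (𝓝 (∫ γ, bogoliubov φ' γ ∂π)) := by
    refine tendsto_integral_of_dominated_convergence (bogoliubovReal fun x => ‖φ' x‖)
      (fun n => hπ.aestronglyMeasurable_bogoliubov (integrable_of_bounded hi hm n))
      (hπ.integrable_bogoliubovReal_norm hi) (fun n => ?_) ?_
    · filter_upwards [hπ.ae_summable hi] with γ hγ
      refine norm_bogoliubov_le (γ.summable_of_hasCompactSupport (hasCompactSupport_truncate n φ'))
        hγ.norm fun x => (norm_add_le _ _).trans ?_
      simpa using norm_truncate_le n φ' x
    · filter_upwards [hπ.ae_summable hi] with γ hγ using tendsto_bogoliubov_truncate hγ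
  have h2 : Tendsto (fun n => ∫ x, truncate n φ' x ∂ν) atTop (𝓝 (∫ x, φ' x ∂ν)) :=
    tendsto_integral_of_dominated_convergence (fun x => ‖φ' x‖)
      (fun n => (measurable_truncate n hm).aestronglyMeasurable) hi.norm
      (fun n => ae_of_all _ (norm_truncate_le n φ')) (ae_of_all _ (tendsto_truncate φ'))
  refine tendsto_nhds_unique h1 (((Complex.continuous_exp.tendsto _).comp h2).congr fun n => ?_)
  exact ((hπ.integral_bogoliubov_of_bounded (measurable_truncate n hm) (norm_truncate_le' n φ')
    (hasCompactSupport_truncate n φ')).2).symm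

end IsPoissonMeasure

end FreeKawasaki

namespace FreeKawasaki

open ProbabilityTheory Config

variable {d : ℕ}

namespace IsPoissonMeasure

variable {ν : Measure (E d)} {π : Measure (Config d)}
variable [SigmaFinite ν] [NullSingletonClass ν] [IsFiniteMeasureOnCompacts ν]

/-! ### Square integrability and inner products -/

/-- `e_B(f)² = e_B(2f + f²)`, and `2f + f²` is integrable for `f ∈ L¹ ∩ L²`. -/
theorem memLp_of_norm_le_bogoliubovReal (hπ : IsPoissonMeasure ν π) {f : E d → ℝ}
    (h1 : MemLp f 1 ν) (h2 : MemLp f 2 ν) (h0 : ∀ x, 0 ≤ f x) {F : Config d → ℂ}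
    (hF : AEStronglyMeasurable F π) (hle : ∀ᵐ γ ∂π, ‖F γ‖ ≤ bogoliubovReal f γ) : MemLp F 2 π := by
  rw [memLp_two_iff_integrable_sq_norm hF]
  have hi : Integrable f ν := memLp_one_iff_integrable.1 h1
  have hsq : Integrable (fun x => f x ^ 2) ν := (memLp_two_iff_integrable_sq h2.1).1 h2
  refine (hπ.integrable_bogoliubovReal (f := fun x => 2 * f x + f x ^ 2)
    ((hi.const_mul 2).add hsq) fun x => by have := h0 x; positivity).mono' (hF.norm.pow 2) ?_
  filter_upwards [hle, hπ.ae_summable (φ := fun x => (f x : ℂ)) hi.ofReal] with γ hγ hs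
  have hs' : Summable fun x : γ.carrier => f x := Complex.summable_ofReal.1 hs
  rw [Real.norm_of_nonneg (by positivity), ← bogoliubovReal_sq hs']
  exact pow_le_pow_left₀ (norm_nonneg _) hγ 2

theorem memLp_bogoliubov (hπ : IsPoissonMeasure ν π) {φ : E d → ℂ} (h1 : MemLp φ 1 ν)
    (h2 : MemLp φ 2 ν) : MemLp (bogoliubov φ) 2 π := by
  have hi := memLp_one_iff_integrable.1 h1
  refine hπ.memLp_of_norm_le_bogoliubovReal h1.norm h2.norm (fun x => norm_nonneg _)
    (hπ.aestronglyMeasurable_bogoliubov hi) ?_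
  filter_upwards [hπ.ae_summable hi] with γ hγ
  exact norm_bogoliubov_le hγ hγ.norm fun x => (norm_add_le _ _).trans (by simp)

theorem memLp_bogoliubovDeriv (hπ : IsPoissonMeasure ν π) {φ ψ : E d → ℂ} (h1 : MemLp φ 1 ν)
    (h2 : MemLp φ 2 ν) (h1' : MemLp ψ 1 ν) (h2' : MemLp ψ 2 ν) :
    MemLp (bogoliubovDeriv φ ψ) 2 π := by
  have hi := memLp_one_iff_integrable.1 h1
  have hi' := memLp_one_iff_integrable.1 h1'
  refine hπ.memLp_of_norm_le_bogoliubovReal (h1.norm.add h1'.norm) (h2.norm.add h2'.norm)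
    (fun x => add_nonneg (norm_nonneg _) (norm_nonneg _))
    (hπ.integral_bogoliubovDeriv hi hi' (hπ.integrable_bogoliubov hi)).1.1 ?_
  filter_upwards [hπ.ae_summable hi, hπ.ae_summable hi'] with γ hγ hγ'
  exact norm_bogoliubovDeriv_le hγ hγ'

/-- The product of the two exponentials is again one, with argument `φ̄ + ψ + φ̄ ψ`, whose integral
is the exponent. -/
theorem integral_conj_bogoliubov_mul (hπ : IsPoissonMeasure ν π) {φ ψ : E d → ℂ}
    (h1 : MemLp φ 1 ν) (h2 : MemLp φ 2 ν) (h1' : MemLp ψ 1 ν) (h2' : MemLp ψ 2 ν) :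
    ∫ γ, starRingEnd ℂ (bogoliubov φ γ) * bogoliubov ψ γ ∂π =
      Complex.exp (starRingEnd ℂ (∫ x, φ x ∂ν) + ∫ x, ψ x ∂ν +
        ∫ x, starRingEnd ℂ (φ x) * ψ x ∂ν) := by
  have hi := memLp_one_iff_integrable.1 h1
  have hi' := memLp_one_iff_integrable.1 h1'
  have hci : Integrable (fun x => starRingEnd ℂ (φ x)) ν := Complex.conjLIE.integrable_comp_iff.2 hi
  have hm : Integrable (fun x => starRingEnd ℂ (φ x) * ψ x) ν := h2.star.integrable_mul h2'
  have e : ∫ x, (starRingEnd ℂ (φ x) + ψ x + starRingEnd ℂ (φ x) * ψ x) ∂ν =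
      starRingEnd ℂ (∫ x, φ x ∂ν) + ∫ x, ψ x ∂ν + ∫ x, starRingEnd ℂ (φ x) * ψ x ∂ν :=
    (integral_add (hci.add hi') hm).trans (congrArg (· + _)
      ((integral_add hci hi').trans (congrArg (· + _) integral_conj)))
  refine Eq.trans ?_ ((hπ.integral_bogoliubov (φ := fun x => starRingEnd ℂ (φ x) + ψ x +
    starRingEnd ℂ (φ x) * ψ x) ((hci.add hi').add hm)).trans (congrArg Complex.exp e))
  refine integral_congr_ae ?_
  filter_upwards [hπ.ae_summable hi, hπ.ae_summable hi', hπ.ae_summable hci] with γ hs hs' hsc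
  rw [bogoliubov_conj (f := φ) hs, bogoliubov_mul (f := fun x => starRingEnd ℂ (φ x)) hsc hs']

/-- Duality between `bogoliubovDeriv` and adding a point. -/
theorem integral_conj_mul_bogoliubovDeriv (hπ : IsPoissonMeasure ν π) [SFinite π] {φ ψ : E d → ℂ}
    (h1 : MemLp φ 1 ν) (h2 : MemLp φ 2 ν) (h1' : MemLp ψ 1 ν) (h2' : MemLp ψ 2 ν)
    {F : Config d → ℂ} (hF : MemLp F 2 π) :
    Integrable (fun p : Config d × E d =>
      starRingEnd ℂ (F (p.1.insertPt p.2)) * (ψ p.2 * bogoliubov φ p.1)) (π.prod ν) ∧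
    ∫ γ, starRingEnd ℂ (F γ) * bogoliubovDeriv φ ψ γ ∂π =
      ∫ p, starRingEnd ℂ (F (p.1.insertPt p.2)) * (ψ p.2 * bogoliubov φ p.1) ∂π.prod ν := by
  have hi := memLp_one_iff_integrable.1 h1
  have hi' := memLp_one_iff_integrable.1 h1'
  set h : Config d → E d → ℂ :=
    fun γ x => starRingEnd ℂ (F γ) * (ψ x * bogoliubov φ (γ.erasePt x)) with hh
  have hm : Measurable fun p : Config d × E d => (p.1.insertPt p.2, p.2) :=
    measurable_insertPt.prodMk measurable_snd
  have hmeas : AEStronglyMeasurable (Function.uncurry h) (π ⊗ₘ countingKernel d) :=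
    (hF.star.1.comp_quasiMeasurePreserving hπ.quasiMeasurePreserving_fst).mul
      (hπ.aestronglyMeasurable_mul_erasePt hi hi')
  have hR : MemLp (fun γ => (bogoliubovReal (fun x => ‖φ x‖ + ‖ψ x‖) γ : ℂ)) 2 π := by
    refine hπ.memLp_of_norm_le_bogoliubovReal (h1.norm.add h1'.norm) (h2.norm.add h2'.norm)
      (fun x => add_nonneg (norm_nonneg _) (norm_nonneg _)) ?_ ?_
    · exact (hπ.integrable_bogoliubovReal (hi.norm.add hi'.norm)
        fun x => add_nonneg (norm_nonneg _) (norm_nonneg _)).ofReal.1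
    · filter_upwards [hπ.ae_summable hi, hπ.ae_summable hi'] with γ hγ hγ'
      rw [Complex.norm_real, Real.norm_of_nonneg]
      · rfl
      · exact bogoliubovReal_nonneg (hγ.norm.add hγ'.norm)
          fun x => add_nonneg (norm_nonneg _) (norm_nonneg _)
  -- The sum over `x ∈ γ` of the norms of `h γ x` is at most `‖F‖` times a majorant in `L²(π)`, so
  -- Cauchy–Schwarz applies.
  have hint : Integrable (Function.uncurry h) (π ⊗ₘ countingKernel d) := by
    refine ⟨hmeas, ?_⟩
    have e1 : ∫⁻ p, ‖Function.uncurry h p‖ₑ ∂(π ⊗ₘ countingKernel d) =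
        ∫⁻ γ, ∫⁻ x, ‖h γ x‖ₑ ∂γ.counting ∂π := by
      have := Kernel.lintegral_compProd₀ (Kernel.const Unit π)
        (Kernel.prodMkLeft Unit (countingKernel d)) ()
        (f := fun p => ‖Function.uncurry h p‖ₑ) hmeas.enorm
      simp only [Kernel.const_apply, Kernel.prodMkLeft_apply, countingKernel_apply,
        Function.uncurry_apply_pair] at this
      exact this
    rw [HasFiniteIntegral, e1]
    have hFR := hF.star.integrable_mul hR
    refine lt_of_le_of_lt (lintegral_mono_ae ?_) hFR.hasFiniteIntegral
    filter_upwards [hπ.ae_summable hi, hπ.ae_summable hi'] with γ hγ hγ'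
    obtain ⟨hs, hle⟩ := summable_norm_bogoliubovDeriv hγ hγ'
    have h0 : 0 ≤ bogoliubovReal (fun x => ‖φ x‖ + ‖ψ x‖) γ :=
      bogoliubovReal_nonneg (hγ.norm.add hγ'.norm) fun x => add_nonneg (norm_nonneg _) (norm_nonneg _)
    rw [lintegral_counting]
    simp only [hh, enorm_mul (starRingEnd ℂ (F γ))]
    rw [ENNReal.tsum_mul_left, Pi.mul_apply, enorm_mul]
    refine mul_le_mul' (by simp) ?_
    simp only [← ofReal_norm]
    rw [← ENNReal.ofReal_tsum_of_nonneg (fun x => norm_nonneg _) hs]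
    refine ENNReal.ofReal_le_ofReal (hle.trans ?_)
    rw [Complex.norm_real]
    exact le_abs_self _
  have hint' : Integrable (fun p : Config d × E d => h (p.1.insertPt p.2) p.2) (π.prod ν) := by
    have h3 := hint
    rw [hπ.mecke] at h3 hmeas
    exact (integrable_map_measure hmeas hm.aemeasurable).1 h3
  have hae : (fun p : Config d × E d => h (p.1.insertPt p.2) p.2) =ᵐ[π.prod ν]
      fun p => starRingEnd ℂ (F (p.1.insertPt p.2)) * (ψ p.2 * bogoliubov φ p.1) := by
    filter_upwards [ae_prod_notMem (π := π) (ν := ν)] with p hp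
    simp only [hh, erasePt_insertPt hp]
  refine ⟨hint'.congr hae, ?_⟩
  rw [← integral_congr_ae hae, ← (hπ.integral_tsum hmeas hint').2.2]
  refine integral_congr_ae (ae_of_all _ fun γ => ?_)
  simp only [hh, bogoliubovDeriv, tsum_mul_left]

/-! ### Totality -/

theorem memLp_exp_pairing (hπ : IsPoissonMeasure ν π) {f : E d → ℝ} (hf : ContDiff ℝ ∞ f)
    (hc : HasCompactSupport f) : MemLp (fun γ => Real.exp (pairing f γ)) 2 π := by
  rw [memLp_two_iff_integrable_sq
    (continuous_pairing hf.continuous hc).measurable.exp.aestronglyMeasurable]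
  refine (hπ.integrable_exp (φ := fun x => 2 * f x) (contDiff_const.mul hf) hc.mul_left).congr
    (ae_of_all _ fun γ => ?_)
  simp only [pairing_const_mul]
  rw [sq, ← Real.exp_add, two_mul]

/-- The finite measures `F⁺ π` and `F⁻ π` have equal Laplace transforms, hence coincide. -/
theorem ae_eq_zero_of_integral_exp_mul_real (hπ : IsPoissonMeasure ν π) {F : Config d → ℝ}
    (hF : MemLp F 2 π) (h : ∀ f : E d → ℝ, ContDiff ℝ ∞ f → HasCompactSupport f →
      ∫ γ, Real.exp (pairing f γ) * F γ ∂π = 0) : F =ᵐ[π] 0 := by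
  have := hπ.isProbability
  have hi : Integrable F π := hF.integrable (by norm_num)
  have hden : ∀ {G : Config d → ℝ}, Integrable G π → ∀ H : Config d → ℝ,
      ∫ γ, H γ ∂π.withDensity (fun γ => ENNReal.ofReal (G γ)) = ∫ γ, max (G γ) 0 * H γ ∂π :=
    fun hG H => by
      rw [integral_withDensity_eq_integral_toReal_smul₀ hG.1.aemeasurable.ennreal_ofReal
        (ae_of_all _ fun _ => ENNReal.ofReal_lt_top)]
      simp [ENNReal.toReal_ofReal']
  have hpos : MemLp (fun γ => max (F γ) 0) 2 π := hF.pos_part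
  have hneg : MemLp (fun γ => max (-F γ) 0) 2 π := hF.neg_part
  have f1 := isFiniteMeasure_withDensity_ofReal hi.hasFiniteIntegral
  have f2 := isFiniteMeasure_withDensity_ofReal hi.neg.hasFiniteIntegral
  have heq : π.withDensity (fun γ => ENNReal.ofReal (F γ)) =
      π.withDensity fun γ => ENNReal.ofReal ((-F) γ) := by
    refine ext_of_laplace (fun f hf hc => ?_) fun f hf hc => ?_
    · rw [integrable_withDensity_iff_integrable_smul₀' hi.1.aemeasurable.ennreal_ofReal
        (ae_of_all _ fun _ => ENNReal.ofReal_lt_top)]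
      simp only [ENNReal.toReal_ofReal', smul_eq_mul]
      exact hpos.integrable_mul (hπ.memLp_exp_pairing hf hc)
    · have i1 : Integrable (fun γ => max (F γ) 0 * Real.exp (pairing f γ)) π :=
        hpos.integrable_mul (hπ.memLp_exp_pairing hf hc)
      have i2 : Integrable (fun γ => max ((-F) γ) 0 * Real.exp (pairing f γ)) π :=
        hneg.integrable_mul (hπ.memLp_exp_pairing hf hc)
      rw [hden hi, hden hi.neg, ← sub_eq_zero, ← integral_sub i1 i2]
      refine Eq.trans ?_ (h f hf hc)
      refine integral_congr_ae (ae_of_all _ fun γ => ?_)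
      simp only [Pi.neg_apply]
      rw [← sub_mul, max_zero_sub_max_neg_zero_eq_self, mul_comm]
  rw [withDensity_eq_iff_of_sigmaFinite hi.1.aemeasurable.ennreal_ofReal
    hi.neg.1.aemeasurable.ennreal_ofReal] at heq
  filter_upwards [heq] with γ hγ
  have h1 := congrArg ENNReal.toReal hγ
  simp only [ENNReal.toReal_ofReal', Pi.neg_apply] at h1
  have h2 := max_zero_sub_max_neg_zero_eq_self (F γ)
  rw [h1, sub_self] at h2
  exact h2.symm

theorem ae_eq_zero_of_integral_exp_mul (hπ : IsPoissonMeasure ν π) {F : Config d → ℂ}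
    (hF : MemLp F 2 π) (h : ∀ f : E d → ℝ, ContDiff ℝ ∞ f → HasCompactSupport f →
      ∫ γ, (Real.exp (pairing f γ) : ℂ) * F γ ∂π = 0) : F =ᵐ[π] 0 := by
  have hi : ∀ f : E d → ℝ, ContDiff ℝ ∞ f → HasCompactSupport f →
      Integrable (fun γ => (Real.exp (pairing f γ) : ℂ) * F γ) π := fun f hf hc =>
    ((hπ.memLp_exp_pairing hf hc).ofReal (K := ℂ)).integrable_mul hF
  have hre := hπ.ae_eq_zero_of_integral_exp_mul_real (F := fun γ => (F γ).re) hF.re fun f hf hc => by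
    have := congrArg Complex.re (h f hf hc)
    rw [← RCLike.re_eq_complex_re, ← integral_re (hi f hf hc)] at this
    simpa [-Complex.ofReal_exp] using this
  have him := hπ.ae_eq_zero_of_integral_exp_mul_real (F := fun γ => (F γ).im) hF.im fun f hf hc => by
    have := congrArg Complex.im (h f hf hc)
    rw [← RCLike.im_eq_complex_im, ← integral_im (hi f hf hc)] at this
    simpa [-Complex.ofReal_exp] using this
  filter_upwards [hre, him] with γ h1 h2
  exact Complex.ext h1 h2

/-! ### The classes in `L²(π)` -/

/-- The class of `e_B(φ)` in `L²(π)`. -/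
def bogoliubovLp (hπ : IsPoissonMeasure ν π) {φ : E d → ℂ} (h1 : MemLp φ 1 ν) (h2 : MemLp φ 2 ν) :
    Lp ℂ 2 π := (hπ.memLp_bogoliubov h1 h2).toLp _

theorem bogoliubovLp_coe (hπ : IsPoissonMeasure ν π) {φ : E d → ℂ} (h1 : MemLp φ 1 ν)
    (h2 : MemLp φ 2 ν) : hπ.bogoliubovLp h1 h2 =ᵐ[π] bogoliubov φ := MemLp.coeFn_toLp _

theorem inner_toLp {Ω : Type*} [MeasurableSpace Ω] {μ : Measure Ω} {F G : Ω → ℂ}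
    {f g : Lp ℂ 2 μ} (hf : f =ᵐ[μ] F) (hg : g =ᵐ[μ] G) :
    inner ℂ f g = ∫ o, starRingEnd ℂ (F o) * G o ∂μ := by
  rw [L2.inner_def]
  refine integral_congr_ae ?_
  filter_upwards [hf, hg] with o h1 h2
  rw [h1, h2, RCLike.inner_apply, mul_comm]

/-- The normalized exponential vector in `L²(π)`. -/
def expState (hπ : IsPoissonMeasure ν π) (f : {f : Lp ℂ 2 ν // MemLp f 1 ν}) : Lp ℂ 2 π :=
  Complex.exp (-∫ x, f.1 x ∂ν) • hπ.bogoliubovLp f.2 (Lp.memLp f.1)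

theorem inner_expState (hπ : IsPoissonMeasure ν π) (f g : {f : Lp ℂ 2 ν // MemLp f 1 ν}) :
    inner ℂ (hπ.expState f) (hπ.expState g) = Complex.exp (inner ℂ f.1 g.1) := by
  rw [expState, expState, inner_smul_left, inner_smul_right,
    inner_toLp (hπ.bogoliubovLp_coe f.2 (Lp.memLp f.1)) (hπ.bogoliubovLp_coe g.2 (Lp.memLp g.1)),
    hπ.integral_conj_bogoliubov_mul f.2 (Lp.memLp f.1) g.2 (Lp.memLp g.1),
    inner_toLp (ae_eq_refl f.1) (ae_eq_refl g.1), ← Complex.exp_conj, ← Complex.exp_add,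
    ← Complex.exp_add]
  congr 1
  rw [map_neg]
  ring

/-- For real smooth `f` the choice `φ = e^f - 1` gives `e_B(φ) = e^{⟨f, ·⟩}`; a vector orthogonal to
all of these vanishes by uniqueness of Laplace transforms. -/
theorem isTotal_expState (hπ : IsPoissonMeasure ν π) : IsTotal hπ.expState := by
  refine IsTotal.of_inner fun x hx => ?_
  have h0 : x =ᵐ[π] (0 : Config d → ℂ) := by
    refine hπ.ae_eq_zero_of_integral_exp_mul (Lp.memLp x) fun f hf hc => ?_
    have hcont : Continuous fun x => (Real.exp (f x) - 1 : ℂ) := by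
      have := hf.continuous
      fun_prop
    have hcs : HasCompactSupport fun x => (Real.exp (f x) - 1 : ℂ) :=
      hc.comp_left (g := fun r : ℝ => (Real.exp r - 1 : ℂ)) (by simp)
    have h1 : MemLp (fun x => (Real.exp (f x) - 1 : ℂ)) 1 ν := hcont.memLp_of_hasCompactSupport hcs
    have h2 : MemLp (fun x => (Real.exp (f x) - 1 : ℂ)) 2 ν := hcont.memLp_of_hasCompactSupport hcs
    have h3 := h2.coeFn_toLp
    have h4 := hx ⟨h2.toLp _, (memLp_congr_ae h3).2 h1⟩
    rw [expState, inner_smul_left, mul_eq_zero, or_iff_right (by simp),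
      inner_toLp (hπ.bogoliubovLp_coe _ _) (ae_eq_refl x)] at h4
    rw [← h4]
    refine integral_congr_ae ?_
    filter_upwards [hπ.bogoliubov_ae_congr h3] with γ hγ
    rw [hγ, bogoliubov_eq_exp_pairing hc, Complex.conj_ofReal]
  exact Lp.eq_zero_iff_ae_eq_zero.2 h0

end IsPoissonMeasure

end FreeKawasaki

namespace FreeKawasaki

/-! ### The one particle operator -/

section OneParticle

variable {d : ℕ} {z : ℝ≥0} {a : E d → ℝ}

theorem volume_absolutelyContinuous_intensity (hz : z ≠ 0) :
    (volume : Measure (E d)) ≪ intensity d z :=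
  Measure.absolutelyContinuous_smul (by exact_mod_cast hz)

theorem intensity_absolutelyContinuous : intensity d z ≪ (volume : Measure (E d)) :=
  Measure.smul_absolutelyContinuous

theorem intensity_zero : intensity d 0 = 0 := zero_smul _ _

theorem nullSingletonClass_intensity (hd : 0 < d) : NullSingletonClass (intensity d z) := by
  have : Nonempty (Fin d) := ⟨⟨0, hd⟩⟩
  exact ⟨fun x => intensity_absolutelyContinuous (measure_singleton x)⟩

theorem quasiMeasurePreserving_snd_intensity (hz : z ≠ 0) :
    Measure.QuasiMeasurePreserving Prod.snd
      ((intensity d z).prod (volume : Measure (E d))) (intensity d z) :=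
  Measure.quasiMeasurePreserving_snd.mono_right (volume_absolutelyContinuous_intensity hz)

/-- The second variable carries Lebesgue measure, which is absolutely continuous with respect to `z
dx` only for `z ≠ 0`; for `z = 0` the product measure is zero. -/
theorem ae_snd_intensity {p : E d → Prop} (h : ∀ᵐ x ∂intensity d z, p x) :
    ∀ᵐ q ∂(intensity d z).prod (volume : Measure (E d)), p q.2 := by
  rcases eq_or_ne z 0 with rfl | hz
  · simp [intensity_zero]
  · exact (quasiMeasurePreserving_snd_intensity hz).ae h

theorem aestronglyMeasurable_snd_intensity {M : Type*} [TopologicalSpace M] {f : E d → M}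
    (h : AEStronglyMeasurable f (intensity d z)) :
    AEStronglyMeasurable (fun q : E d × E d => f q.2) ((intensity d z).prod volume) := by
  rcases eq_or_ne z 0 with rfl | hz
  · exact ⟨fun q => h.mk f q.2, h.stronglyMeasurable_mk.comp_measurable measurable_snd, by
      simp [intensity_zero, Filter.EventuallyEq]⟩
  · exact h.comp_quasiMeasurePreserving (quasiMeasurePreserving_snd_intensity hz)

/-- The jump measure `a(x - y) z dx dy`. -/
def jumpMeasure (a : E d → ℝ) (z : ℝ≥0) : Measure (E d × E d) :=
  ((intensity d z).prod volume).withDensity fun p => ENNReal.ofReal (a (p.1 - p.2))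

theorem lintegral_sub_left (g : E d → ℝ≥0∞) (x : E d) : ∫⁻ y, g (x - y) = ∫⁻ y, g y :=
  lintegral_sub_left_eq_self g x

theorem lintegral_intensity (g : E d → ℝ≥0∞) : ∫⁻ x, g x ∂intensity d z = z * ∫⁻ x, g x := by
  rw [intensity, lintegral_smul_measure]
  rfl

theorem measurable_jumpDensity (ham : Measurable a) :
    Measurable fun p : E d × E d => ENNReal.ofReal (a (p.1 - p.2)) :=
  (ham.comp (measurable_fst.sub measurable_snd)).ennreal_ofReal

theorem lintegral_jumpMeasure (ham : Measurable a) {F : E d × E d → ℝ≥0∞} (hF : Measurable F) :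
    ∫⁻ p, F p ∂jumpMeasure a z =
      ∫⁻ x, (∫⁻ y, ENNReal.ofReal (a (x - y)) * F (x, y)) ∂intensity d z := by
  rw [jumpMeasure, lintegral_withDensity_eq_lintegral_mul _ (measurable_jumpDensity ham) hF,
    lintegral_prod _ ((measurable_jumpDensity ham).mul hF).aemeasurable]
  rfl

theorem map_fst_jumpMeasure (ham : Measurable a) :
    (jumpMeasure a z).map Prod.fst = (∫⁻ x, ENNReal.ofReal (a x)) • intensity d z := by
  refine Measure.ext_of_lintegral _ fun g hg => ?_
  rw [lintegral_map hg measurable_fst, lintegral_jumpMeasure ham (F := fun p => g p.1) (hg.comp measurable_fst),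
    lintegral_smul_measure, smul_eq_mul, ← lintegral_const_mul _ hg]
  refine lintegral_congr fun x => ?_
  dsimp only
  rw [lintegral_mul_const _ (by fun_prop), lintegral_sub_left (fun u => ENNReal.ofReal (a u))]

/-- By translation invariance both marginals of the jump measure are `(∫ a) z dx`. This gives `∫ Af
z dx = 0` and, later, dispersivity. -/
theorem map_snd_jumpMeasure (ham : Measurable a) :
    (jumpMeasure a z).map Prod.snd = (∫⁻ x, ENNReal.ofReal (a x)) • intensity d z := by
  refine Measure.ext_of_lintegral _ fun g hg => ?_
  rw [lintegral_map hg measurable_snd, lintegral_jumpMeasure ham (F := fun p => g p.2) (hg.comp measurable_snd),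
    lintegral_smul_measure, smul_eq_mul, lintegral_intensity, lintegral_intensity,
    lintegral_lintegral_swap]
  · rw [mul_left_comm, ← lintegral_const_mul _ hg]
    congr 1
    refine lintegral_congr fun y => ?_
    dsimp only
    rw [lintegral_mul_const _ (by fun_prop),
      lintegral_sub_right_eq_self (fun u => ENNReal.ofReal (a u))]
  · exact ((measurable_jumpDensity ham).mul (hg.comp measurable_snd)).aemeasurable

theorem jumpMeasure_map_swap (ham : Measurable a) :
    (jumpMeasure a z).map Prod.swap = jumpMeasure (fun x => a (-x)) z := by
  refine Measure.ext_of_lintegral _ fun g hg => ?_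
  rw [lintegral_map hg measurable_swap, lintegral_jumpMeasure ham (F := fun p => g p.swap) (hg.comp measurable_swap),
    lintegral_jumpMeasure (a := fun x => a (-x)) (ham.comp measurable_neg) hg, lintegral_intensity, lintegral_intensity,
    lintegral_lintegral_swap]
  · simp only [neg_sub]
    rfl
  · exact ((measurable_jumpDensity ham).mul (hg.comp measurable_swap)).aemeasurable

/-- Measurable nonnegative integrable jump rates. -/
structure IsJumpKernel (a : E d → ℝ) : Prop where
  measurable : Measurable a
  nonneg : ∀ x, 0 ≤ a x
  integrable : Integrable a

namespace IsJumpKernel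

theorem lintegral_ofReal_eq (ha : IsJumpKernel a) : ∫⁻ x, ENNReal.ofReal (a x) = ENNReal.ofReal (∫ x, a x) :=
  (ofReal_integral_eq_lintegral_ofReal ha.integrable (ae_of_all _ ha.nonneg)).symm

theorem integrable_fst_jumpMeasure (ha : IsJumpKernel a) {f : E d → ℂ} (hf : Integrable f (intensity d z)) :
    Integrable (fun p : E d × E d => f p.1) (jumpMeasure a z) ∧
    ∫ p, f p.1 ∂jumpMeasure a z = (∫ x, a x : ℝ) * ∫ x, f x ∂intensity d z := by
  have h1 : Integrable f ((jumpMeasure a z).map Prod.fst) := by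
    rw [map_fst_jumpMeasure ha.measurable, ha.lintegral_ofReal_eq]
    exact hf.smul_measure ENNReal.ofReal_ne_top
  refine ⟨(integrable_map_measure h1.1 measurable_fst.aemeasurable).1 h1, ?_⟩
  rw [← integral_map measurable_fst.aemeasurable h1.1, map_fst_jumpMeasure ha.measurable,
    ha.lintegral_ofReal_eq, integral_smul_measure,
    ENNReal.toReal_ofReal (integral_nonneg ha.nonneg), Complex.real_smul]

theorem integrable_snd_jumpMeasure (ha : IsJumpKernel a) {f : E d → ℂ} (hf : Integrable f (intensity d z)) :
    Integrable (fun p : E d × E d => f p.2) (jumpMeasure a z) ∧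
    ∫ p, f p.2 ∂jumpMeasure a z = (∫ x, a x : ℝ) * ∫ x, f x ∂intensity d z := by
  have h1 : Integrable f ((jumpMeasure a z).map Prod.snd) := by
    rw [map_snd_jumpMeasure ha.measurable, ha.lintegral_ofReal_eq]
    exact hf.smul_measure ENNReal.ofReal_ne_top
  refine ⟨(integrable_map_measure h1.1 measurable_snd.aemeasurable).1 h1, ?_⟩
  rw [← integral_map measurable_snd.aemeasurable h1.1, map_snd_jumpMeasure ha.measurable,
    ha.lintegral_ofReal_eq, integral_smul_measure,
    ENNReal.toReal_ofReal (integral_nonneg ha.nonneg), Complex.real_smul]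

theorem integral_jumpMeasure (ha : IsJumpKernel a) {F : E d × E d → ℂ} (hF : Integrable F (jumpMeasure a z)) :
    (∀ᵐ x ∂intensity d z, Integrable fun y => (a (x - y) : ℂ) * F (x, y)) ∧
    Integrable (fun x => ∫ y, (a (x - y) : ℂ) * F (x, y)) (intensity d z) ∧
    ∫ p, F p ∂jumpMeasure a z = ∫ x, (∫ y, (a (x - y) : ℂ) * F (x, y)) ∂intensity d z := by
  have hsm : ∀ p : E d × E d, (ENNReal.ofReal (a (p.1 - p.2))).toReal • F p =
      (a (p.1 - p.2) : ℂ) * F p := fun p => by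
    rw [ENNReal.toReal_ofReal (ha.nonneg _), Complex.real_smul]
  have h1 : Integrable (fun p => (a (p.1 - p.2) : ℂ) * F p) ((intensity d z).prod volume) := by
    have := (integrable_withDensity_iff_integrable_smul' (measurable_jumpDensity ha.measurable)
      (ae_of_all _ fun _ => ENNReal.ofReal_lt_top)).1 hF
    simpa only [hsm] using this
  refine ⟨h1.prod_right_ae, h1.integral_prod_left, ?_⟩
  rw [jumpMeasure, integral_withDensity_eq_integral_toReal_smul (measurable_jumpDensity ha.measurable)
    (ae_of_all _ fun _ => ENNReal.ofReal_lt_top)]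
  simp only [hsm]
  exact integral_prod _ h1

theorem aestronglyMeasurable_mul_snd (ha : IsJumpKernel a) {f : E d → ℂ} (hf : AEStronglyMeasurable f (intensity d z)) :
    AEStronglyMeasurable (fun p : E d × E d => (a (p.1 - p.2) : ℂ) * f p.2)
      ((intensity d z).prod volume) :=
  (Complex.measurable_ofReal.comp (ha.measurable.comp (measurable_fst.sub measurable_snd))).aestronglyMeasurable.mul
    (aestronglyMeasurable_snd_intensity hf)

theorem integrable_sub_left (ha : IsJumpKernel a) (x : E d) : Integrable fun y => (a (x - y) : ℂ) :=
  (ha.integrable.comp_sub_left x).ofReal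

theorem ae_integrable_mul (ha : IsJumpKernel a) {f : E d → ℂ} {p : ℝ≥0∞} (hp : p = 1 ∨ p = 2) (hf : MemLp f p (intensity d z)) :
    ∀ᵐ x ∂intensity d z, Integrable fun y => (a (x - y) : ℂ) * f y := by
  rcases hp with rfl | rfl
  · exact (ha.integral_jumpMeasure
      (ha.integrable_snd_jumpMeasure (memLp_one_iff_integrable.1 hf)).1).1
  -- The case `p = 2` follows from `p = 1` through `‖f‖ ≤ 1 + ‖f‖²`.
  · have h1 : Integrable (fun x => ((‖f x‖ ^ 2 : ℝ) : ℂ)) (intensity d z) :=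
      ((memLp_two_iff_integrable_sq_norm hf.1).1 hf).ofReal
    filter_upwards [(ha.integral_jumpMeasure (ha.integrable_snd_jumpMeasure h1).1).1,
      (ha.aestronglyMeasurable_mul_snd hf.1).prodMk_left] with x hx hm
    refine ((ha.integrable_sub_left x).norm.add hx.norm).mono' hm (ae_of_all _ fun y => ?_)
    simp only [Pi.add_apply, norm_mul, Complex.norm_real, Real.norm_of_nonneg (ha.nonneg _), norm_pow,
      norm_norm]
    nlinarith [mul_nonneg (ha.nonneg (x - y)) (sq_nonneg (‖f y‖ - 1)),
      mul_nonneg (ha.nonneg (x - y)) (sq_nonneg (‖f y‖)), ha.nonneg (x - y)]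

end IsJumpKernel

end OneParticle

end FreeKawasaki

/-! ### Convolution and the exponential of the jump operator -/

namespace FreeKawasaki

section OneParticle

variable {d : ℕ} {z : ℝ≥0} {a : E d → ℝ}

/-- The convolution `a * f`. -/
def convFun (a : E d → ℝ) (f : E d → ℂ) (x : E d) : ℂ := ∫ y, (a (x - y) : ℂ) * f y

/-- The function `x ↦ ∫ a(x - y) (f(y) - f(x)) dy`. -/
def hopFun (a : E d → ℝ) (f : E d → ℂ) (x : E d) : ℂ := ∫ y, (a (x - y) : ℂ) * (f y - f x)

theorem sq_lintegral_le {Ω : Type*} [MeasurableSpace Ω] (μ : Measure Ω) {g : Ω → ℝ≥0∞}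
    (hg : AEMeasurable g μ) : (∫⁻ x, g x ∂μ) ^ 2 ≤ μ univ * ∫⁻ x, g x ^ 2 ∂μ := by
  have h := ENNReal.lintegral_mul_le_Lp_mul_Lq μ Real.HolderConjugate.two_two
    (f := fun _ => 1) (g := g) aemeasurable_const hg
  simp only [Pi.mul_apply, one_mul, ENNReal.one_rpow, lintegral_one] at h
  have h2 := pow_le_pow_left₀ zero_le h 2
  refine h2.trans (le_of_eq ?_)
  rw [mul_pow, ← ENNReal.rpow_natCast, ← ENNReal.rpow_mul, ← ENNReal.rpow_natCast, ← ENNReal.rpow_mul]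
  norm_num

theorem convFun_ae_congr {f g : E d → ℂ} (h : f =ᵐ[intensity d z] g) :
    convFun a f =ᵐ[intensity d z] convFun a g := by
  filter_upwards [Measure.ae_ae_of_ae_prod (ae_snd_intensity h)] with x hx
  exact integral_congr_ae (hx.mono fun y hy => by simp only [hy])

theorem eLpNorm_two_sq {Ω : Type*} [MeasurableSpace Ω] {μ : Measure Ω} (f : Ω → ℂ) :
    eLpNorm f 2 μ ^ 2 = ∫⁻ x, ‖f x‖ₑ ^ 2 ∂μ := by
  have := eLpNorm_nnreal_pow_eq_lintegral (f := f) (μ := μ) (p := 2) (by norm_num)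
  simpa using this

theorem hasSum_exp_smul_apply {X : Type*} [NormedAddCommGroup X] [NormedSpace ℂ X] [CompleteSpace X]
    (C : X →L[ℂ] X) (t : ℂ) (f : X) :
    HasSum (fun n : ℕ => ((n.factorial : ℂ)⁻¹ * t ^ n) • (C ^ n) f) (NormedSpace.exp (t • C) f) := by
  have h1 : HasSum (fun n : ℕ => ((n.factorial : ℂ)⁻¹) • (t • C) ^ n) (NormedSpace.exp (t • C)) := by
    rw [NormedSpace.exp_eq_tsum ℂ]
    exact (NormedSpace.norm_expSeries_summable' (𝕂 := ℂ) (t • C)).of_norm.hasSum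
  have h2 := h1.mapL (ContinuousLinearMap.apply ℂ X f)
  refine h2.congr_fun fun n => ?_
  simp [smul_pow, smul_smul]

theorem norm_pow_apply_le {X : Type*} [NormedAddCommGroup X] [NormedSpace ℂ X]
    {C : X →L[ℂ] X} {K : ℝ} (hC : ‖C‖ ≤ K) (n : ℕ) (f : X) : ‖(C ^ n) f‖ ≤ K ^ n * ‖f‖ := by
  induction n with
  | zero => simp
  | succ n ih =>
    rw [pow_succ', mul_apply_eq_comp, pow_succ', mul_assoc]
    exact (C.le_of_opNorm_le hC _).trans
      (mul_le_mul_of_nonneg_left ih ((norm_nonneg _).trans hC))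

namespace IsJumpKernel

theorem neg (ha : IsJumpKernel a) : IsJumpKernel fun x => a (-x) :=
  ⟨ha.measurable.comp measurable_neg, fun _ => ha.nonneg _, ha.integrable.comp_neg⟩

theorem integral_nonneg (ha : IsJumpKernel a) : 0 ≤ ∫ x, a x :=
  MeasureTheory.integral_nonneg ha.nonneg

theorem lintegral_conv (ha : IsJumpKernel a) {g : E d → ℝ≥0∞} (hg : Measurable g) :
    ∫⁻ x, (∫⁻ y, ENNReal.ofReal (a (x - y)) * g y) ∂intensity d z =
      ENNReal.ofReal (∫ x, a x) * ∫⁻ x, g x ∂intensity d z := by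
  rw [← lintegral_jumpMeasure (z := z) ha.measurable (F := fun p => g p.2) (hg.comp measurable_snd),
    ← lintegral_map hg measurable_snd, map_snd_jumpMeasure ha.measurable, ha.lintegral_ofReal_eq,
    lintegral_smul_measure, smul_eq_mul]

theorem enorm_convFun_le (ha : IsJumpKernel a) (f : E d → ℂ) (x : E d) :
    ‖convFun a f x‖ₑ ≤ ∫⁻ y, ENNReal.ofReal (a (x - y)) * ‖f y‖ₑ := by
  refine (enorm_integral_le_lintegral_enorm _).trans (le_of_eq (lintegral_congr fun y => ?_))
  rw [enorm_mul, ← ofReal_norm (a (x - y) : ℂ), Complex.norm_real, Real.norm_of_nonneg (ha.nonneg _)]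

theorem aestronglyMeasurable_convFun (ha : IsJumpKernel a) {f : E d → ℂ}
    (hf : AEStronglyMeasurable f (intensity d z)) :
    AEStronglyMeasurable (convFun a f) (intensity d z) :=
  (ha.aestronglyMeasurable_mul_snd hf).integral_prod_right'

/-- Young's inequality for the two exponents needed. For `p = 2`, Cauchy–Schwarz against the measure
`a(x - y) dy` of mass `∫ a` is followed by the case `p = 1` for `‖f‖²`. -/
theorem eLpNorm_convFun_le (ha : IsJumpKernel a) {f : E d → ℂ} {p : ℝ≥0∞} (hp : p = 1 ∨ p = 2)
    (hf : AEStronglyMeasurable f (intensity d z)) :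
    eLpNorm (convFun a f) p (intensity d z) ≤
      ENNReal.ofReal (∫ x, a x) * eLpNorm f p (intensity d z) := by
  rw [eLpNorm_congr_ae (convFun_ae_congr hf.ae_eq_mk), eLpNorm_congr_ae hf.ae_eq_mk]
  obtain ⟨g, hg⟩ : ∃ g, g = hf.mk f := ⟨_, rfl⟩
  have hm : Measurable g := hg ▸ hf.stronglyMeasurable_mk.measurable
  rw [← hg]
  rcases hp with rfl | rfl
  · rw [eLpNorm_one_eq_lintegral_enorm, eLpNorm_one_eq_lintegral_enorm,
      ← ha.lintegral_conv hm.enorm]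
    exact lintegral_mono fun x => ha.enorm_convFun_le g x
  · rw [← ENNReal.pow_le_pow_left_iff two_ne_zero, mul_pow, eLpNorm_two_sq, eLpNorm_two_sq]
    calc ∫⁻ x, ‖convFun a g x‖ₑ ^ 2 ∂intensity d z
        ≤ ∫⁻ x, ENNReal.ofReal (∫ x, a x) *
            (∫⁻ y, ENNReal.ofReal (a (x - y)) * ‖g y‖ₑ ^ 2) ∂intensity d z := by
          refine lintegral_mono fun x => ?_
          refine (pow_le_pow_left₀ zero_le (ha.enorm_convFun_le g x) 2).trans ?_
          have hma : Measurable fun y => ENNReal.ofReal (a (x - y)) :=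
            (ha.measurable.comp (measurable_const.sub measurable_id)).ennreal_ofReal
          have h := sq_lintegral_le (volume.withDensity fun y => ENNReal.ofReal (a (x - y)))
            hm.enorm.aemeasurable
          rw [lintegral_withDensity_eq_lintegral_mul _ hma hm.enorm,
            lintegral_withDensity_eq_lintegral_mul _ hma (hm.enorm.pow_const 2),
            withDensity_apply _ MeasurableSet.univ, Measure.restrict_univ,
            lintegral_sub_left (fun u => ENNReal.ofReal (a u)), ha.lintegral_ofReal_eq] at h
          exact h
      _ = _ := by
          rw [lintegral_const_mul, ha.lintegral_conv (hm.enorm.pow_const 2), sq, mul_assoc]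
          exact Measurable.lintegral_prod_right' (f := fun p : E d × E d =>
            ENNReal.ofReal (a (p.1 - p.2)) * ‖g p.2‖ₑ ^ 2)
            ((measurable_jumpDensity ha.measurable).mul ((hm.comp measurable_snd).enorm.pow_const 2))

theorem memLp_convFun (ha : IsJumpKernel a) {f : E d → ℂ} {p : ℝ≥0∞} (hp : p = 1 ∨ p = 2)
    (hf : MemLp f p (intensity d z)) : MemLp (convFun a f) p (intensity d z) :=
  ⟨ha.aestronglyMeasurable_convFun hf.1, (ha.eLpNorm_convFun_le hp hf.1).trans_lt
    (ENNReal.mul_lt_top ENNReal.ofReal_lt_top hf.2)⟩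

theorem ae_hopFun_eq (ha : IsJumpKernel a) {f : E d → ℂ} {p : ℝ≥0∞} (hp : p = 1 ∨ p = 2)
    (hf : MemLp f p (intensity d z)) : ∀ᵐ x ∂intensity d z,
      Integrable (fun y => (a (x - y) : ℂ) * (f y - f x)) ∧
      hopFun a f x = convFun a f x - (∫ x, a x : ℝ) * f x := by
  filter_upwards [ha.ae_integrable_mul hp hf] with x hx
  have h2 := (ha.integrable_sub_left x).mul_const (f x)
  simp only [hopFun, mul_sub]
  refine ⟨hx.sub h2, ?_⟩
  rw [integral_sub hx h2, integral_mul_const, integral_complex_ofReal,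
    integral_sub_left_eq_self a volume x]
  rfl

theorem memLp_hopFun (ha : IsJumpKernel a) {f : E d → ℂ} {p : ℝ≥0∞} (hp : p = 1 ∨ p = 2)
    (hf : MemLp f p (intensity d z)) : MemLp (hopFun a f) p (intensity d z) :=
  ((ha.memLp_convFun hp hf).sub (hf.const_mul _)).ae_eq
    ((ha.ae_hopFun_eq hp hf).mono fun _ h => h.2.symm)

/-- Gain and loss cancel because the two marginals of the jump measure coincide. -/
theorem integral_hopFun (ha : IsJumpKernel a) {f : E d → ℂ} (hf : Integrable f (intensity d z)) :
    ∫ x, hopFun a f x ∂intensity d z = 0 := by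
  have hf1 := memLp_one_iff_integrable.2 hf
  have h1 := ha.integrable_snd_jumpMeasure hf
  have h2 := ha.integral_jumpMeasure h1.1
  rw [integral_congr_ae ((ha.ae_hopFun_eq (Or.inl rfl) hf1).mono fun _ h => h.2), integral_sub,
    integral_const_mul, ← h1.2, h2.2.2]
  · exact sub_self _
  · exact memLp_one_iff_integrable.1 (ha.memLp_convFun (Or.inl rfl) hf1)
  · exact hf.const_mul _

/-- Convolution with `a` as an operator on `L²(z dx)`. -/
def convOp (ha : IsJumpKernel a) : OneParticle d z →L[ℂ] OneParticle d z :=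
  LinearMap.mkContinuous
    { toFun := fun f => (ha.memLp_convFun (Or.inr rfl) (Lp.memLp f)).toLp _
      map_add' := fun f g => by
        refine Lp.ext ?_
        filter_upwards [MemLp.coeFn_toLp (ha.memLp_convFun (Or.inr rfl) (Lp.memLp (f + g))),
          MemLp.coeFn_toLp (ha.memLp_convFun (Or.inr rfl) (Lp.memLp f)),
          MemLp.coeFn_toLp (ha.memLp_convFun (Or.inr rfl) (Lp.memLp g)),
          Lp.coeFn_add ((ha.memLp_convFun (Or.inr rfl) (Lp.memLp f)).toLp _)
            ((ha.memLp_convFun (Or.inr rfl) (Lp.memLp g)).toLp _),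
          convFun_ae_congr (a := a) (Lp.coeFn_add f g),
          ha.ae_integrable_mul (Or.inr rfl) (Lp.memLp f),
          ha.ae_integrable_mul (Or.inr rfl) (Lp.memLp g)] with x h1 h2 h3 h4 h5 h6 h7
        rw [h1, h4, Pi.add_apply, h2, h3, h5, convFun, convFun, convFun, ← integral_add h6 h7]
        simp only [Pi.add_apply, mul_add]
      map_smul' := fun c f => by
        refine Lp.ext ?_
        filter_upwards [MemLp.coeFn_toLp (ha.memLp_convFun (Or.inr rfl) (Lp.memLp (c • f))),
          MemLp.coeFn_toLp (ha.memLp_convFun (Or.inr rfl) (Lp.memLp f)),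
          Lp.coeFn_smul c ((ha.memLp_convFun (Or.inr rfl) (Lp.memLp f)).toLp _),
          convFun_ae_congr (a := a) (Lp.coeFn_smul c f)] with x h1 h2 h3 h4
        rw [h1, RingHom.id_apply, h3, Pi.smul_apply, h2, h4, convFun, convFun, smul_eq_mul,
          ← integral_const_mul]
        simp only [Pi.smul_apply, smul_eq_mul, mul_left_comm] }
    (∫ x, a x) fun f => by
      change ‖(ha.memLp_convFun (Or.inr rfl) (Lp.memLp f)).toLp _‖ ≤ _
      rw [Lp.norm_toLp, Lp.norm_def]
      refine (ENNReal.toReal_mono (ENNReal.mul_ne_top ENNReal.ofReal_ne_top (Lp.eLpNorm_ne_top f))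
        (ha.eLpNorm_convFun_le (Or.inr rfl) (Lp.memLp f).1)).trans ?_
      rw [ENNReal.toReal_mul, ENNReal.toReal_ofReal ha.integral_nonneg]

theorem convOp_coe (ha : IsJumpKernel a) (f : OneParticle d z) :
    ha.convOp f =ᵐ[intensity d z] convFun a f :=
  MemLp.coeFn_toLp (ha.memLp_convFun (Or.inr rfl) (Lp.memLp f))

theorem norm_convOp_le (ha : IsJumpKernel a) :
    ‖(ha.convOp : OneParticle d z →L[ℂ] OneParticle d z)‖ ≤ ∫ x, a x :=
  LinearMap.mkContinuous_norm_le _ ha.integral_nonneg _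

/-- The one particle operator. -/
def hopOp (ha : IsJumpKernel a) : OneParticle d z →L[ℂ] OneParticle d z :=
  ha.convOp - ((∫ x, a x : ℝ) : ℂ) • ContinuousLinearMap.id ℂ _

theorem hopOp_coe (ha : IsJumpKernel a) (f : OneParticle d z) :
    ha.hopOp f =ᵐ[intensity d z] hopFun a f := by
  filter_upwards [ha.convOp_coe f, ha.ae_hopFun_eq (Or.inr rfl) (Lp.memLp f),
    Lp.coeFn_sub (ha.convOp f) (((∫ x, a x : ℝ) : ℂ) • f),
    Lp.coeFn_smul ((∫ x, a x : ℝ) : ℂ) f] with x h1 h2 h3 h4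
  rw [h2.2, ← h1]
  change (ha.convOp f - ((∫ x, a x : ℝ) : ℂ) • f : OneParticle d z) x = _
  rw [h3, Pi.sub_apply, h4]
  rfl

theorem isOneParticleOperator (ha : IsJumpKernel a) :
    IsOneParticleOperator a (ha.hopOp : OneParticle d z →L[ℂ] OneParticle d z) := fun f => by
  filter_upwards [ha.hopOp_coe f, ha.ae_hopFun_eq (Or.inr rfl) (Lp.memLp f)] with x h1 h2
  exact ⟨h2.1, h1⟩

theorem exp_hopOp (ha : IsJumpKernel a) (t : ℝ) :
    NormedSpace.exp ((t : ℂ) • (ha.hopOp : OneParticle d z →L[ℂ] OneParticle d z)) =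
      ((Real.exp (-(t * ∫ x, a x)) : ℝ) : ℂ) • NormedSpace.exp ((t : ℂ) • ha.convOp) := by
  have h1 : (t : ℂ) • (ha.hopOp : OneParticle d z →L[ℂ] OneParticle d z) =
      (t : ℂ) • ha.convOp + algebraMap ℂ _ ((-(t * ∫ x, a x) : ℝ) : ℂ) := by
    rw [hopOp, Algebra.algebraMap_eq_smul_one, smul_sub, sub_eq_add_neg, smul_smul]
    push_cast
    rw [neg_smul]
    rfl
  let _ : NormedAlgebra ℚ (OneParticle d z →L[ℂ] OneParticle d z) :=
    NormedAlgebra.restrictScalars ℚ ℂ _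
  rw [h1, NormedSpace.exp_add_of_commute (Algebra.commutes _ _).symm,
    ← NormedSpace.algebraMap_exp_comm, ← Algebra.commutes, ← Algebra.smul_def,
    ← Complex.exp_eq_exp_ℂ, Complex.ofReal_exp]

/-- The scalar part of `A` contributes the factor `e^{-t ∫ a}`, which absorbs the bound `e^{t ∫ a}`
for the exponential of the convolution. -/
theorem norm_exp_hopOp_le (ha : IsJumpKernel a) {t : ℝ} (ht : 0 ≤ t) :
    ‖NormedSpace.exp ((t : ℂ) • (ha.hopOp : OneParticle d z →L[ℂ] OneParticle d z))‖ ≤ 1 := by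
  rw [ha.exp_hopOp, norm_smul, Complex.norm_real, Real.norm_of_nonneg (Real.exp_pos _).le]
  have h1 : ‖NormedSpace.exp ((t : ℂ) • (ha.convOp : OneParticle d z →L[ℂ] OneParticle d z))‖ ≤
      Real.exp (t * ∫ x, a x) := by
    refine ContinuousLinearMap.opNorm_le_bound _ (Real.exp_pos _).le fun f => ?_
    rw [← (hasSum_exp_smul_apply _ _ f).tsum_eq]
    have h2 := (NormedSpace.expSeries_div_hasSum_exp (t * ∫ x, a x)).mul_right ‖f‖
    rw [← Real.exp_eq_exp_ℝ] at h2
    refine tsum_of_norm_bounded h2 fun n => ?_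
    rw [norm_smul, norm_mul, norm_pow, Complex.norm_real, Real.norm_of_nonneg ht, norm_inv,
      Complex.norm_natCast, mul_pow, div_eq_inv_mul, mul_assoc, mul_assoc, mul_assoc]
    gcongr
    exact norm_pow_apply_le ha.norm_convOp_le n f
  calc _ ≤ Real.exp (-(t * ∫ x, a x)) * Real.exp (t * ∫ x, a x) :=
        mul_le_mul_of_nonneg_left h1 (Real.exp_pos _).le
    _ = 1 := by rw [← Real.exp_add, neg_add_cancel, Real.exp_zero]

end IsJumpKernel

end OneParticle

end FreeKawasaki

/-! ### Invariance of `L¹ ∩ L²`, the adjoint, and dispersivity -/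

namespace FreeKawasaki

section OneParticle

variable {d : ℕ} {z : ℝ≥0} {a : E d → ℝ}

theorem eLpNorm_sum_smul_le {μ : Measure (E d)} {ι : Type*} (s : Finset ι) (c : ι → ℂ)
    (f : ι → Lp ℂ 2 μ) :
    eLpNorm (∑ i ∈ s, c i • f i : Lp ℂ 2 μ) 1 μ ≤ ∑ i ∈ s, ‖c i‖ₑ * eLpNorm (f i) 1 μ := by
  refine (Finset.le_sum_of_subadditive (fun g : Lp ℂ 2 μ => eLpNorm g 1 μ) ?_ ?_ s _).trans
    (Finset.sum_le_sum fun i _ => ?_)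
  · rw [eLpNorm_congr_ae (Lp.coeFn_zero ℂ 2 μ), eLpNorm_zero]
  · intro g h
    rw [eLpNorm_congr_ae (Lp.coeFn_add g h)]
    exact eLpNorm_add_le (Lp.memLp g).1 (Lp.memLp h).1 le_rfl
  · rw [eLpNorm_congr_ae (Lp.coeFn_smul (c i) (f i)), eLpNorm_const_smul]

/-- A subsequence converges almost everywhere, and Fatou's lemma bounds the `L¹` norm of the limit.
-/
theorem eLpNorm_le_of_tendsto {μ : Measure (E d)} {f : ℕ → Lp ℂ 2 μ} {g : Lp ℂ 2 μ}
    (hf : Tendsto f atTop (𝓝 g)) {C : ℝ≥0∞} (hC : ∀ n, eLpNorm (f n) 1 μ ≤ C) :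
    eLpNorm g 1 μ ≤ C := by
  have h1 : TendstoInMeasure μ (fun n => (f n : E d → ℂ)) atTop g :=
    tendstoInMeasure_of_tendsto_Lp hf
  obtain ⟨ns, -, hns⟩ := h1.exists_seq_tendsto_ae
  refine (Lp.eLpNorm_lim_le_liminf_eLpNorm (fun n => (Lp.memLp (f (ns n))).1) _ hns).trans ?_
  exact (liminf_le_liminf (Eventually.of_forall fun n => hC (ns n))).trans (by simp)

theorem dense_memLp_one : Dense {f : OneParticle d z | MemLp f 1 (intensity d z)} := by
  have : (intensity d z).Regular := by unfold intensity; infer_instance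
  refine Metric.dense_iff.2 fun f ε hε => ?_
  obtain ⟨g, hgc, hg, hcont, hmem⟩ := (Lp.memLp f).exists_hasCompactSupport_eLpNorm_sub_le
    (by norm_num) (ε := ENNReal.ofReal (ε / 2)) (by simpa using hε)
  refine ⟨hmem.toLp g, ?_, ?_⟩
  · rw [Metric.mem_ball, dist_comm, Lp.dist_def]
    have h1 : eLpNorm (f - hmem.toLp g : E d → ℂ) 2 (intensity d z) =
        eLpNorm (f - g : E d → ℂ) 2 (intensity d z) := by
      refine eLpNorm_congr_ae ?_
      filter_upwards [hmem.coeFn_toLp] with x hx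
      simp [hx]
    rw [h1]
    refine (ENNReal.toReal_mono ENNReal.ofReal_ne_top hg).trans_lt ?_
    rw [ENNReal.toReal_ofReal (by positivity)]
    linarith
  · exact (memLp_congr_ae hmem.coeFn_toLp).2 (hcont.memLp_of_hasCompactSupport hgc)

namespace IsJumpKernel

theorem eLpNorm_convOp_pow_le (ha : IsJumpKernel a) (n : ℕ) (f : OneParticle d z) :
    eLpNorm ((ha.convOp ^ n) f) 1 (intensity d z) ≤
      ENNReal.ofReal (∫ x, a x) ^ n * eLpNorm f 1 (intensity d z) := by
  induction n with
  | zero => simp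
  | succ n ih =>
    rw [pow_succ', mul_apply_eq_comp, eLpNorm_congr_ae (ha.convOp_coe _), pow_succ', mul_assoc]
    exact (ha.eLpNorm_convFun_le (Or.inl rfl) (Lp.memLp _).1).trans (mul_le_mul_right ih _)

/-- The partial sums of the exponential series converge in `L²` and are bounded in `L¹`, since
convolution with `a` has norm at most `∫ a` there too. This keeps the span of exponential vectors
invariant. -/
theorem memLp_exp_hopOp (ha : IsJumpKernel a) {t : ℝ} (ht : 0 ≤ t) {f : OneParticle d z}
    (hf : MemLp f 1 (intensity d z)) :
    MemLp (NormedSpace.exp ((t : ℂ) • ha.hopOp) f) 1 (intensity d z) := by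
  refine ⟨(Lp.memLp _).1, ?_⟩
  rw [ha.exp_hopOp, smul_apply, eLpNorm_congr_ae (Lp.coeFn_smul _ _),
    eLpNorm_const_smul]
  refine ENNReal.mul_lt_top enorm_lt_top ?_
  have hs := (hasSum_exp_smul_apply ha.convOp (t : ℂ) f).tendsto_sum_nat
  refine (eLpNorm_le_of_tendsto hs (C := ENNReal.ofReal (Real.exp (t * ∫ x, a x)) *
    eLpNorm f 1 (intensity d z)) fun N => ?_).trans_lt (ENNReal.mul_lt_top ENNReal.ofReal_lt_top hf.2)
  refine (eLpNorm_sum_smul_le _ _ _).trans ?_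
  have h1 : ∀ n : ℕ, ‖((n.factorial : ℂ)⁻¹ * (t : ℂ) ^ n)‖ₑ *
      eLpNorm ((ha.convOp ^ n) f) 1 (intensity d z) ≤
      ENNReal.ofReal ((t * ∫ x, a x) ^ n / n.factorial) * eLpNorm f 1 (intensity d z) := fun n => by
    refine (mul_le_mul_right (ha.eLpNorm_convOp_pow_le n f) _).trans (le_of_eq ?_)
    rw [← mul_assoc, ← ENNReal.ofReal_pow ha.integral_nonneg, ← ofReal_norm,
      ← ENNReal.ofReal_mul (norm_nonneg _)]
    congr 2
    rw [norm_mul, norm_pow, Complex.norm_real, Real.norm_of_nonneg ht, norm_inv,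
      Complex.norm_natCast, mul_pow]
    ring
  refine (Finset.sum_le_sum fun n _ => h1 n).trans ?_
  have hta := mul_nonneg ht ha.integral_nonneg
  rw [← Finset.sum_mul, ← ENNReal.ofReal_sum_of_nonneg fun n _ => by positivity]
  refine mul_le_mul_left (ENNReal.ofReal_le_ofReal ?_) _
  exact Real.sum_le_exp_of_nonneg hta N

theorem aestronglyMeasurable_jumpMeasure {M : Type*} [TopologicalSpace M] {F : E d × E d → M}
    (hF : AEStronglyMeasurable F ((intensity d z).prod volume)) :
    AEStronglyMeasurable F (jumpMeasure a z) :=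
  hF.mono_ac (withDensity_absolutelyContinuous _ _)

theorem integrable_conj_mul_jumpMeasure (ha : IsJumpKernel a) {f g : E d → ℂ}
    (hf : MemLp f 2 (intensity d z)) (hg : MemLp g 2 (intensity d z)) :
    Integrable (fun p : E d × E d => starRingEnd ℂ (g p.1) * f p.2) (jumpMeasure a z) := by
  have h1 := (ha.integrable_fst_jumpMeasure
    ((memLp_two_iff_integrable_sq_norm hg.1).1 hg).ofReal).1
  have h2 := (ha.integrable_snd_jumpMeasure
    ((memLp_two_iff_integrable_sq_norm hf.1).1 hf).ofReal).1
  refine (h1.norm.add h2.norm).mono' (aestronglyMeasurable_jumpMeasure ?_) (ae_of_all _ fun p => ?_)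
  · exact (hg.star.1.comp_quasiMeasurePreserving Measure.quasiMeasurePreserving_fst).mul
      (aestronglyMeasurable_snd_intensity hf.1)
  · simp only [norm_mul, RCLike.norm_conj, Pi.add_apply, RCLike.norm_ofReal, abs_pow, abs_norm]
    nlinarith [sq_nonneg (‖g p.1‖ - ‖f p.2‖), sq_nonneg (‖g p.1‖), sq_nonneg (‖f p.2‖)]

/-- Exchanging the two coordinates turns the jump measure of `a` into that of `x ↦ a(-x)`. -/
theorem integral_conj_mul_convFun (ha : IsJumpKernel a) {f g : E d → ℂ}
    (hf : MemLp f 2 (intensity d z)) (hg : MemLp g 2 (intensity d z)) :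
    ∫ x, starRingEnd ℂ (g x) * convFun a f x ∂intensity d z =
      ∫ x, starRingEnd ℂ (convFun (fun x => a (-x)) g x) * f x ∂intensity d z := by
  have hF := ha.integrable_conj_mul_jumpMeasure hf hg
  have h1 := (ha.integral_jumpMeasure hF).2.2
  have hswap : Integrable (fun p : E d × E d => starRingEnd ℂ (g p.2) * f p.1)
      (jumpMeasure (fun x => a (-x)) z) := by
    rw [← jumpMeasure_map_swap ha.measurable]
    refine (integrable_map_measure ?_ measurable_swap.aemeasurable).2 hF
    rw [jumpMeasure_map_swap ha.measurable]
    refine aestronglyMeasurable_jumpMeasure ?_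
    exact (aestronglyMeasurable_snd_intensity hg.star.1).mul
      (hf.1.comp_quasiMeasurePreserving Measure.quasiMeasurePreserving_fst)
  have h2 := (ha.neg.integral_jumpMeasure hswap).2.2
  rw [← jumpMeasure_map_swap ha.measurable, integral_map measurable_swap.aemeasurable
    (by rw [jumpMeasure_map_swap ha.measurable]; exact hswap.1)] at h2
  have e1 : ∫ x, starRingEnd ℂ (g x) * convFun a f x ∂intensity d z =
      ∫ x, (∫ y, (a (x - y) : ℂ) * (starRingEnd ℂ (g x) * f y)) ∂intensity d z := by
    refine integral_congr_ae (ae_of_all _ fun x => ?_)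
    simp only [convFun]
    rw [← integral_const_mul]
    simp only [mul_left_comm]
  have e2 : ∫ x, starRingEnd ℂ (convFun (fun x => a (-x)) g x) * f x ∂intensity d z =
      ∫ x, (∫ y, (a (-(x - y)) : ℂ) * (starRingEnd ℂ (g y) * f x)) ∂intensity d z := by
    refine integral_congr_ae (ae_of_all _ fun x => ?_)
    simp only [convFun]
    rw [← integral_conj, ← integral_mul_const]
    simp only [map_mul, Complex.conj_ofReal, mul_assoc]
  rw [e1, e2, ← h1, ← h2]
  rfl

theorem adjoint_hopOp (ha : IsJumpKernel a) :
    ContinuousLinearMap.adjoint (ha.hopOp : OneParticle d z →L[ℂ] OneParticle d z) =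
      ha.neg.hopOp := by
  symm
  rw [ContinuousLinearMap.eq_adjoint_iff]
  intro g f
  have h := ha.integral_conj_mul_convFun (Lp.memLp f) (Lp.memLp g)
  have h1 : inner ℂ g (ha.convOp f) = inner ℂ (ha.neg.convOp g) f := by
    rw [IsPoissonMeasure.inner_toLp (ae_eq_refl g) (ha.convOp_coe f),
      IsPoissonMeasure.inner_toLp (ha.neg.convOp_coe g) (ae_eq_refl f)]
    exact h
  have h2 : ∫ x, a (-x) = ∫ x, a x := integral_neg_eq_self a volume
  change inner ℂ (ha.neg.convOp g - ((∫ x, a (-x) : ℝ) : ℂ) • g) f =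
    inner ℂ g (ha.convOp f - ((∫ x, a x : ℝ) : ℂ) • f)
  rw [inner_sub_left, inner_sub_right, h1, inner_smul_left, inner_smul_right, h2,
    Complex.conj_ofReal]

/-- The jump operator is dispersive. -/
theorem integral_hopFun_mul_posPart_le (ha : IsJumpKernel a) {f : E d → ℂ}
    (h1 : MemLp f 1 (intensity d z)) (h2 : MemLp f 2 (intensity d z)) (c : ℂ) :
    ∫ x, (hopFun a f x).re * max (c + f x).re 0 ∂intensity d z ≤ 0 := by
  set k := c.re
  set w : E d → ℝ := fun x => max (k + (f x).re) 0
  -- The convex function `(t⁺)² / 2`, whose derivative is `t⁺`, at `t = Re(c + f)`. Its value at `f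
  -- = 0` is subtracted because `z dx` may be infinite; the factorisation of the difference of
  -- squares makes `Φ` integrable.
  set Φ : E d → ℝ := fun x => 1 / 2 * ((w x) ^ 2 - (max k 0) ^ 2)
  have hwm : AEStronglyMeasurable w (intensity d z) := by
    have := h1.1.re
    exact (aestronglyMeasurable_const.add this).sup aestronglyMeasurable_const
  have hfi := memLp_one_iff_integrable.1 h1
  have hsq := (memLp_two_iff_integrable_sq_norm h2.1).1 h2
  have hw : ∀ x, |w x| ≤ |k| + ‖f x‖ := fun x => by
    rw [abs_of_nonneg (le_max_right _ _)]
    refine max_le ?_ (by positivity)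
    exact add_le_add (le_abs_self _) ((le_abs_self _).trans (Complex.abs_re_le_norm _))
  have hΦ : Integrable (fun x => (Φ x : ℂ)) (intensity d z) := by
    refine Integrable.ofReal ?_
    refine ((hfi.norm.const_mul |k|).add hsq).mono' ?_ (ae_of_all _ fun x => ?_)
    · exact ((hwm.pow 2).sub aestronglyMeasurable_const).const_mul _
    · have hd : |w x - max k 0| ≤ ‖f x‖ := by
        refine (abs_max_sub_max_le_abs _ _ _).trans ?_
        simpa using Complex.abs_re_le_norm (f x)
      have hs : |w x + max k 0| ≤ 2 * |k| + ‖f x‖ := by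
        refine (abs_add_le _ _).trans ?_
        have : |max k 0| ≤ |k| := by
          rw [abs_of_nonneg (le_max_right _ _)]
          exact max_le (le_abs_self _) (abs_nonneg _)
        linarith [hw x]
      have : Φ x = (w x - max k 0) * (w x + max k 0) / 2 := by simp only [Φ]; ring
      change ‖Φ x‖ ≤ _
      rw [this, Real.norm_eq_abs, abs_div, abs_mul, abs_two, Pi.add_apply]
      have := mul_le_mul hd hs (abs_nonneg _) (norm_nonneg _)
      nlinarith [sq_nonneg ‖f x‖]
  have hF : Integrable (fun p : E d × E d => (f p.2 - f p.1) * (w p.1 : ℂ)) (jumpMeasure a z) := by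
    have i1 := (ha.integrable_snd_jumpMeasure hfi).1.norm
    have i2 := (ha.integrable_fst_jumpMeasure hfi).1.norm
    have i3 := (ha.integrable_snd_jumpMeasure hsq.ofReal).1.norm
    have i4 := (ha.integrable_fst_jumpMeasure hsq.ofReal).1.norm
    refine (((i1.add i2).const_mul |k|).add ((i3.add i4).const_mul 2)).mono'
      (aestronglyMeasurable_jumpMeasure ?_) (ae_of_all _ fun p => ?_)
    · have hq := Measure.quasiMeasurePreserving_fst (μ := intensity d z) (ν := (volume : Measure (E d)))
      exact ((aestronglyMeasurable_snd_intensity h1.1).sub (h1.1.comp_quasiMeasurePreserving hq)).mul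
        (Complex.continuous_ofReal.comp_aestronglyMeasurable (hwm.comp_quasiMeasurePreserving hq))
    · simp only [norm_mul, Pi.add_apply, RCLike.norm_ofReal, abs_pow, abs_norm, Complex.norm_real,
        Real.norm_eq_abs]
      have j1 : ‖f p.2 - f p.1‖ ≤ ‖f p.2‖ + ‖f p.1‖ := norm_sub_le _ _
      have := mul_le_mul j1 (hw p.1) (abs_nonneg _) (by positivity)
      nlinarith [sq_nonneg (‖f p.2‖ - ‖f p.1‖), sq_nonneg (‖f p.2‖), sq_nonneg (‖f p.1‖)]
  have e1 : ∫ x, (hopFun a f x).re * max (c + f x).re 0 ∂intensity d z =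
      (∫ p, (f p.2 - f p.1) * (w p.1 : ℂ) ∂jumpMeasure a z).re := by
    have hJ := ha.integral_jumpMeasure hF
    rw [hJ.2.2, ← RCLike.re_eq_complex_re, ← integral_re hJ.2.1]
    refine integral_congr_ae (ae_of_all _ fun x => ?_)
    have : ∫ y, (a (x - y) : ℂ) * ((f y - f x) * (w x : ℂ)) = hopFun a f x * (w x : ℂ) := by
      rw [hopFun, ← integral_mul_const]
      simp only [mul_assoc]
    simp only
    rw [this, RCLike.re_eq_complex_re, Complex.re_mul_ofReal]
    rfl
  have iS := (ha.integrable_snd_jumpMeasure hΦ)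
  have iF := (ha.integrable_fst_jumpMeasure hΦ)
  -- Equality of the marginals again. Convexity bounds the integrand `Re(f(y) - f(x)) w(x)` by `Φ(y)
  -- - Φ(x)` pointwise.
  have e2 : (∫ p : E d × E d, (Φ p.2 - Φ p.1) ∂jumpMeasure a z) = 0 := by
    have h3 := integral_sub iS.1 iF.1
    rw [iS.2, iF.2, sub_self] at h3
    rw [← Complex.ofReal_inj, ← integral_complex_ofReal]
    simpa using h3
  rw [e1, ← RCLike.re_eq_complex_re, ← integral_re hF, ← e2]
  refine integral_mono hF.re (by simpa using (iS.1.sub iF.1).re) fun p => ?_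
  simp only [RCLike.re_eq_complex_re, Complex.re_mul_ofReal, Complex.sub_re]
  have hp1 : w p.1 * (w p.1 - (k + (f p.1).re)) = 0 := by
    rcases le_total (k + (f p.1).re) 0 with h | h
    · simp [w, max_eq_right h]
    · simp [w, max_eq_left h]
  have hp2 : k + (f p.2).re ≤ w p.2 := le_max_left _ _
  have hp0 : 0 ≤ w p.1 := le_max_right _ _
  simp only [Φ]
  nlinarith [mul_le_mul_of_nonneg_right hp2 hp0, sq_nonneg (w p.2 - w p.1)]

end IsJumpKernel

end OneParticle

end FreeKawasaki

namespace FreeKawasaki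

/-! ### The second quantized semigroup on `L²(π)` -/

/-- The semigroup law is an identity of bounded operators, and orbits of general vectors are uniform
limits of orbits from the span, by the common norm bound. -/
theorem isContractionSemigroup_of_isTotal {X ι : Type*} [NormedAddCommGroup X]
    [InnerProductSpace ℂ X] [CompleteSpace X] {u : ι → X} (hu : IsTotal u) {S : ℝ → X →L[ℂ] X}
    (hn : ∀ t, 0 ≤ t → ‖S t‖ ≤ 1) (h0 : ∀ i, S 0 (u i) = u i)
    (hadd : ∀ s t, 0 ≤ s → 0 ≤ t → ∀ i, S (s + t) (u i) = S s (S t (u i)))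
    (hc : ∀ i, ContinuousOn (fun t => S t (u i)) (Ici 0)) : IsContractionSemigroup S where
  zero := hu.ext_clm fun i => by simp [h0]
  add s t hs ht := hu.ext_clm fun i => by simp [hadd s t hs ht]
  contraction := hn
  continuous f := by
    have hspan : ∀ y ∈ Submodule.span ℂ (range u), ContinuousOn (fun t => S t y) (Ici 0) := by
      intro y hy
      induction hy using Submodule.span_induction with
      | mem y hy => obtain ⟨i, rfl⟩ := hy; exact hc i
      | zero => simpa using continuousOn_const
      | add y w _ _ h1 h2 => exact (h1.add h2).congr fun t _ => by simp
      | smul c y _ h => exact (h.const_smul c).congr fun t _ => by simp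
    refine continuousOn_of_uniform_approx_of_continuousOn fun V hV => ?_
    obtain ⟨ε, hε, hεV⟩ := Metric.mem_uniformity_dist.1 hV
    obtain ⟨y, hy, hy'⟩ := Metric.dense_iff.1 hu f ε hε
    refine ⟨fun t => S t y, hspan y hy', fun t ht => hεV ?_⟩
    rw [dist_eq_norm, ← map_sub]
    refine ((S t).le_of_opNorm_le (hn t ht) _).trans_lt ?_
    rwa [one_mul, ← dist_eq_norm, dist_comm, ← Metric.mem_ball]

section

variable {d : ℕ} {z : ℝ≥0} {a : E d → ℝ} {π : Measure (Config d)}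

theorem IsJumpKernel.exp_hopOp_add (ha : IsJumpKernel a) (s t : ℝ) :
    NormedSpace.exp (((s + t : ℝ) : ℂ) • (ha.hopOp : OneParticle d z →L[ℂ] OneParticle d z)) =
      NormedSpace.exp ((s : ℂ) • ha.hopOp) * NormedSpace.exp ((t : ℂ) • ha.hopOp) := by
  let _ : NormedAlgebra ℚ (OneParticle d z →L[ℂ] OneParticle d z) :=
    NormedAlgebra.restrictScalars ℚ ℂ _
  rw [← NormedSpace.exp_add_of_commute, ← add_smul, Complex.ofReal_add]
  exact ((Commute.refl ha.hopOp).smul_left _).smul_right _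

/-- `exp (t A)` on `L¹ ∩ L²`. -/
def IsJumpKernel.hopExp (ha : IsJumpKernel a) {t : ℝ} (ht : 0 ≤ t)
    (f : {f : OneParticle d z // MemLp f 1 (intensity d z)}) :
    {f : OneParticle d z // MemLp f 1 (intensity d z)} :=
  ⟨NormedSpace.exp ((t : ℂ) • ha.hopOp) f.1, ha.memLp_exp_hopOp ht f.2⟩

theorem IsJumpKernel.inner_exp_hopOp (ha : IsJumpKernel a) (t : ℝ) (f g : OneParticle d z) :
    inner ℂ g (NormedSpace.exp ((t : ℂ) • ha.hopOp) f) =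
      inner ℂ (NormedSpace.exp ((t : ℂ) • ha.neg.hopOp) g) f := by
  rw [← ContinuousLinearMap.adjoint_inner_left, ← ContinuousLinearMap.star_eq_adjoint,
    NormedSpace.star_exp, star_smul, ContinuousLinearMap.star_eq_adjoint, ha.adjoint_hopOp]
  congr 5
  exact Complex.conj_ofReal t

variable [NullSingletonClass (intensity d z)]

namespace IsPoissonMeasure

theorem exists_fockIso (hπ : IsPoissonMeasure (intensity d z) π) :
    ∃ I : Lp ℂ 2 π ≃ₗᵢ[ℂ] Fock d z, ∀ f, I (hπ.expState f) = expVector f.1 :=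
  exists_isometryEquiv_of_inner hπ.isTotal_expState (isTotal_expVector dense_memLp_one)
    fun f g => by rw [hπ.inner_expState, inner_expVector]

/-- `S` is the semigroup obtained from `exp (t A)` by second quantization. -/
structure IsHopSemigroup (hπ : IsPoissonMeasure (intensity d z) π) (ha : IsJumpKernel a)
    (S : ℝ → Lp ℂ 2 π →L[ℂ] Lp ℂ 2 π) : Prop where
  norm_le : ∀ t, 0 ≤ t → ‖S t‖ ≤ 1
  apply : ∀ {t} (ht : 0 ≤ t) f, S t (hπ.expState f) = hπ.expState (ha.hopExp ht f)

theorem exists_isHopSemigroup (hπ : IsPoissonMeasure (intensity d z) π) (ha : IsJumpKernel a)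
    {I : Lp ℂ 2 π ≃ₗᵢ[ℂ] Fock d z} (hI : ∀ f, I (hπ.expState f) = expVector f.1) :
    ∃ S, hπ.IsHopSemigroup ha S ∧ ∀ t : ℝ, 0 ≤ t → ∃ U : Fock d z →L[ℂ] Fock d z,
      IsSecondQuantization (NormedSpace.exp ((t : ℂ) • ha.hopOp)) U ∧
      ∀ F : Lp ℂ 2 π, S t F = I.symm (U (I F)) := by
  have h : ∀ t : ℝ, ∃ U : Fock d z →L[ℂ] Fock d z, 0 ≤ t →
      IsSecondQuantization (NormedSpace.exp ((t : ℂ) • ha.hopOp)) U ∧ ‖U‖ ≤ 1 ∧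
      ∀ f, U (expVector f) = expVector (NormedSpace.exp ((t : ℂ) • ha.hopOp) f) := fun t => by
    by_cases ht : 0 ≤ t
    · obtain ⟨U, hU⟩ := exists_secondQuantization _ (ha.norm_exp_hopOp_le (z := z) ht)
      exact ⟨U, fun _ => hU⟩
    -- Negative times are ignored; any operator serves there.
    · exact ⟨0, fun h => absurd h ht⟩
  choose U hU using h
  refine ⟨fun t => (I.symm.toContinuousLinearEquiv : Fock d z →L[ℂ] Lp ℂ 2 π) ∘L U t ∘L
    (I.toContinuousLinearEquiv : Lp ℂ 2 π →L[ℂ] Fock d z), ⟨fun t ht => ?_, fun {t} ht f => ?_⟩,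
    fun t ht => ⟨U t, (hU t ht).1, fun F => rfl⟩⟩
  · refine ContinuousLinearMap.opNorm_le_bound _ zero_le_one fun F => ?_
    change ‖I.symm (U t (I F))‖ ≤ _
    rw [I.symm.norm_map]
    exact ((U t).le_of_opNorm_le (hU t ht).2.1 _).trans (by rw [I.norm_map])
  · change I.symm (U t (I (hπ.expState f))) = _
    rw [hI, (hU t ht).2.2, LinearIsometryEquiv.symm_apply_eq, hI]
    rfl

variable {hπ : IsPoissonMeasure (intensity d z) π} {ha : IsJumpKernel a}
  {S : ℝ → Lp ℂ 2 π →L[ℂ] Lp ℂ 2 π}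

theorem IsHopSemigroup.isContractionSemigroup (hS : hπ.IsHopSemigroup ha S) :
    IsContractionSemigroup S := by
  refine isContractionSemigroup_of_isTotal hπ.isTotal_expState hS.norm_le (fun f => ?_)
    (fun s t hs ht f => ?_) fun f => ?_
  · rw [hS.apply le_rfl]
    congr 1
    refine Subtype.ext ?_
    simp [IsJumpKernel.hopExp]
  · rw [hS.apply ht, hS.apply hs, hS.apply (add_nonneg hs ht)]
    congr 1
    refine Subtype.ext ?_
    simp only [IsJumpKernel.hopExp]
    rw [ha.exp_hopOp_add]
    rfl
  -- In Fock space the orbit of `e(f)` is `expVector (exp (t A) f)`, a composition of continuous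
  -- maps.
  · obtain ⟨I, hI⟩ := hπ.exists_fockIso
    have h1 : ContinuousOn (fun t : ℝ => I.symm (expVector
        (NormedSpace.exp ((t : ℂ) • ha.hopOp) f.1))) (Ici 0) := by
      refine (I.symm.continuous.comp (continuous_expVector.comp ?_)).continuousOn
      have h2 : Continuous fun t : ℝ =>
          NormedSpace.exp ((t : ℂ) • (ha.hopOp : OneParticle d z →L[ℂ] OneParticle d z)) :=
        (differentiable_exp_smul_const ℂ (ha.hopOp : OneParticle d z →L[ℂ] OneParticle d z)).continuous.comp Complex.continuous_ofReal
      exact h2.clm_apply continuous_const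
    refine h1.congr fun t ht => ?_
    simp only
    rw [hS.apply ht, LinearIsometryEquiv.eq_symm_apply, hI]
    rfl

/-- On exponential vectors the adjoint of `S t` is the second quantization of `exp (t A*)`, and `A*`
is the jump operator of `x ↦ a(-x)`. -/
theorem IsHopSemigroup.inner_apply (hS : hπ.IsHopSemigroup ha S) {t : ℝ} (ht : 0 ≤ t) (g)
    (F : Lp ℂ 2 π) :
    inner ℂ (hπ.expState g) (S t F) = inner ℂ (hπ.expState (ha.neg.hopExp ht g)) F := by
  rw [← ContinuousLinearMap.adjoint_inner_left]
  congr 1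
  refine hπ.isTotal_expState.ext_inner fun f => ?_
  rw [ContinuousLinearMap.adjoint_inner_right, hS.apply ht, hπ.inner_expState, hπ.inner_expState,
    ← inner_conj_symm, ← inner_conj_symm f.1]
  congr 2
  exact ha.inner_exp_hopOp t f.1 g.1

/-! ### The generator on Bogoliubov exponentials -/

/-- The Mecke identity and `e_B(g, γ ∪ x) = (1 + g(x)) e_B(g, γ)` decouple `x` from `γ`. As `∫ ψ =
0`, only `∫ ḡ ψ` survives. -/
theorem inner_expState_bogoliubovDeriv (hπ : IsPoissonMeasure (intensity d z) π)
    (f g : {f : OneParticle d z // MemLp f 1 (intensity d z)}) {ψ : E d → ℂ}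
    (h1 : MemLp ψ 1 (intensity d z)) (h2 : MemLp ψ 2 (intensity d z)) (h0 : ∫ x, ψ x ∂intensity d z = 0)
    {H : Lp ℂ 2 π} (hH : H =ᵐ[π] bogoliubovDeriv f.1 ψ) :
    inner ℂ (hπ.expState g) (Complex.exp (-∫ x, f.1 x ∂intensity d z) • H) =
      (∫ x, starRingEnd ℂ (g.1 x) * ψ x ∂intensity d z) * Complex.exp (inner ℂ g.1 f.1) := by
  have := hπ.isProbability
  have hg1 := memLp_one_iff_integrable.1 g.2
  have hd := (hπ.integral_conj_mul_bogoliubovDeriv f.2 (Lp.memLp f.1) h1 h2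
    (hπ.memLp_bogoliubov g.2 (Lp.memLp g.1))).2
  have hi : Integrable (fun x => starRingEnd ℂ (g.1 x) * ψ x) (intensity d z) :=
    (Lp.memLp g.1).star.integrable_mul h2
  have e1 : ∫ p, starRingEnd ℂ (bogoliubov g.1 (p.1.insertPt p.2)) * (ψ p.2 * bogoliubov f.1 p.1)
        ∂π.prod (intensity d z) =
      ∫ p, (starRingEnd ℂ (bogoliubov g.1 p.1) * bogoliubov f.1 p.1) *
        (ψ p.2 + starRingEnd ℂ (g.1 p.2) * ψ p.2) ∂π.prod (intensity d z) := by
    refine integral_congr_ae ?_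
    filter_upwards [hπ.ae_bogoliubov_insertPt hg1] with p hp
    rw [hp, map_mul, map_add, map_one]
    ring
  rw [expState, inner_smul_left, inner_smul_right,
    inner_toLp (hπ.bogoliubovLp_coe g.2 (Lp.memLp g.1)) hH, hd, e1,
    integral_prod_mul (μ := π) (ν := intensity d z)
      (fun γ => starRingEnd ℂ (bogoliubov g.1 γ) * bogoliubov f.1 γ)
      (fun x => ψ x + starRingEnd ℂ (g.1 x) * ψ x),
    integral_add (memLp_one_iff_integrable.1 h1) hi, h0, zero_add,
    hπ.integral_conj_bogoliubov_mul g.2 (Lp.memLp g.1) f.2 (Lp.memLp f.1),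
    inner_toLp (ae_eq_refl g.1) (ae_eq_refl f.1), ← Complex.exp_conj, Complex.exp_add,
    Complex.exp_add, map_neg, Complex.exp_neg, Complex.exp_neg]
  have n1 := Complex.exp_ne_zero (∫ x, f.1 x ∂intensity d z)
  have n2 := Complex.exp_ne_zero (starRingEnd ℂ (∫ x, g.1 x ∂intensity d z))
  field_simp

/-- `⟨e(g), S_t e(f)⟩ = exp ⟨g, e^{tA} f⟩` has derivative `⟨g, e^{tA} A f⟩ exp ⟨g, e^{tA} f⟩`. The
preceding formula, with `e^{tA*} g` for `g` and `A f` for `ψ`, gives the same number. -/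
theorem IsHopSemigroup.expState_mem_graph (hS : hπ.IsHopSemigroup ha S)
    (f : {f : OneParticle d z // MemLp f 1 (intensity d z)})
    {H : Lp ℂ 2 π} (hH : H =ᵐ[π] bogoliubovDeriv f.1 (hopFun a f.1)) :
    (hπ.expState f, Complex.exp (-∫ x, f.1 x ∂intensity d z) • H) ∈ generatorGraph S := by
  have hf2 := Lp.memLp f.1
  refine hS.isContractionSemigroup.mem_graph_of_weak hπ.isTotal_expState fun g t ht => ?_
  rw [hS.inner_apply ht, hπ.inner_expState_bogoliubovDeriv f _ (ha.memLp_hopFun (Or.inl rfl) f.2)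
    (ha.memLp_hopFun (Or.inr rfl) hf2) (ha.integral_hopFun (memLp_one_iff_integrable.1 f.2)) hH]
  have e1 : ∫ x, starRingEnd ℂ ((ha.neg.hopExp ht g).1 x) * hopFun a f.1 x ∂intensity d z =
      inner ℂ g.1 (NormedSpace.exp ((t : ℂ) • ha.hopOp) (ha.hopOp f.1)) := by
    rw [ha.inner_exp_hopOp, inner_toLp (ae_eq_refl _) (ha.hopOp_coe f.1)]
    rfl
  have e2 : inner ℂ (ha.neg.hopExp ht g).1 f.1 =
      inner ℂ g.1 (NormedSpace.exp ((t : ℂ) • ha.hopOp) f.1) := (ha.inner_exp_hopOp t f.1 g.1).symm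
  rw [e1, e2]
  have hd : HasDerivAt (fun r : ℝ => inner ℂ g.1 (NormedSpace.exp ((r : ℂ) • ha.hopOp) f.1))
      (inner ℂ g.1 (NormedSpace.exp ((t : ℂ) • ha.hopOp) (ha.hopOp f.1))) t := by
    have h1 : HasDerivAt (fun r : ℝ => NormedSpace.exp
        ((r : ℂ) • (ha.hopOp : OneParticle d z →L[ℂ] OneParticle d z)))
        (NormedSpace.exp ((t : ℂ) • ha.hopOp) * ha.hopOp) t := by
      have h := (hasDerivAt_exp_smul_const (𝕂 := ℂ)
        (ha.hopOp : OneParticle d z →L[ℂ] OneParticle d z) (t : ℂ)).scomp t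
        Complex.ofRealCLM.hasDerivAt
      simpa [Function.comp_def] using h
    have h2 := ((innerSL ℂ g.1).hasFDerivAt (x := NormedSpace.exp ((t : ℂ) • ha.hopOp) f.1)).restrictScalars ℝ
    have h3 : HasDerivAt (fun r : ℝ => NormedSpace.exp ((r : ℂ) • ha.hopOp) f.1)
        (NormedSpace.exp ((t : ℂ) • ha.hopOp) (ha.hopOp f.1)) t :=
      (((ContinuousLinearMap.apply ℂ (OneParticle d z) f.1).restrictScalars ℝ).hasFDerivAt.comp_hasDerivAt
        t h1)
    exact h2.comp_hasDerivAt t h3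
  have hd2 := hd.cexp
  rw [mul_comm] at hd2
  refine hd2.hasDerivWithinAt.congr (fun r hr => ?_) ?_
  · rw [hS.apply (ht.trans (le_of_lt hr)), hπ.inner_expState]
    rfl
  · rw [hS.apply ht, hπ.inner_expState]
    rfl

end IsPoissonMeasure

end

end FreeKawasaki

namespace FreeKawasaki

open Config

/-! ### The generator on the span of the Bogoliubov exponentials -/

section Pointwise

variable {d : ℕ} {a b : E d → ℝ} {F G : Config d → ℂ} {γ : Config d}

theorem kawasakiConverges_congr
    (h : ∀ x ∈ γ.carrier, jumpTerm a F γ x =ᵐ[volume] jumpTerm b G γ x) :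
    KawasakiConverges a F γ ↔ KawasakiConverges b G γ := by
  unfold KawasakiConverges
  refine and_congr (forall₂_congr fun x hx => integrable_congr (h x hx)) ?_
  exact summable_congr fun x => integral_congr_ae ((h x x.2).fun_comp norm)

theorem kawasaki_congr (h : ∀ x ∈ γ.carrier, jumpTerm a F γ x =ᵐ[volume] jumpTerm b G γ x) :
    kawasaki a F γ = kawasaki b G γ :=
  tsum_congr fun x => integral_congr_ae (h x x.2)

theorem KawasakiConverges.summable (h : KawasakiConverges a F γ) :
    Summable fun x : γ.carrier => ∫ y, jumpTerm a F γ x y :=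
  .of_norm_bounded h.2 fun _ => norm_integral_le_integral_norm _

theorem jumpTerm_add (x y : E d) :
    jumpTerm a (fun γ => F γ + G γ) γ x y = jumpTerm a F γ x y + jumpTerm a G γ x y := by
  unfold jumpTerm; ring

theorem jumpTerm_smul (c : ℂ) (x y : E d) :
    jumpTerm a (fun γ => c * F γ) γ x y = c * jumpTerm a F γ x y := by
  unfold jumpTerm; ring

theorem KawasakiConverges.add (hF : KawasakiConverges a F γ) (hG : KawasakiConverges a G γ) :
    KawasakiConverges a (fun γ => F γ + G γ) γ ∧
    kawasaki a (fun γ => F γ + G γ) γ = kawasaki a F γ + kawasaki a G γ := by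
  refine ⟨⟨fun x hx => ?_, ?_⟩, ?_⟩
  · simp only [jumpTerm_add]
    exact (hF.1 x hx).add (hG.1 x hx)
  · refine .of_nonneg_of_le (fun x => integral_nonneg fun y => norm_nonneg _) (fun x => ?_)
      (hF.2.add hG.2)
    rw [← integral_add (hF.1 x x.2).norm (hG.1 x x.2).norm]
    simp only [jumpTerm_add]
    exact integral_mono ((hF.1 x x.2).add (hG.1 x x.2)).norm
      ((hF.1 x x.2).norm.add (hG.1 x x.2).norm) fun y => norm_add_le _ _
  · unfold kawasaki
    rw [← hF.summable.tsum_add hG.summable]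
    refine tsum_congr fun x => ?_
    simp only [jumpTerm_add]
    exact integral_add (hF.1 x x.2) (hG.1 x x.2)

theorem KawasakiConverges.const_mul (hF : KawasakiConverges a F γ) (c : ℂ) :
    KawasakiConverges a (fun γ => c * F γ) γ ∧
    kawasaki a (fun γ => c * F γ) γ = c * kawasaki a F γ := by
  refine ⟨⟨fun x hx => ?_, ?_⟩, ?_⟩
  · simp only [jumpTerm_smul]
    exact (hF.1 x hx).const_mul c
  · simp only [jumpTerm_smul, norm_mul, integral_const_mul]
    exact hF.2.mul_left _
  · simp only [kawasaki, jumpTerm_smul, integral_const_mul, tsum_mul_left]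

end Pointwise

section

variable {d : ℕ} {z : ℝ≥0} {a : E d → ℝ} {π : Measure (Config d)}

/-- Almost every `y` lies outside `γ`, so the jump replaces the factor `1 + φ(x)` by `1 + φ(y)` and
leaves the rest of the product. -/
theorem jumpTerm_bogoliubov [NullSingletonClass (volume : Measure (E d))] {φ : E d → ℂ}
    {γ : Config d} (hs : Summable fun x : γ.carrier => φ x) {x : E d} (hx : x ∈ γ.carrier) :
    jumpTerm a (bogoliubov φ) γ x =ᵐ[volume]
      fun y => ((a (x - y) : ℂ) * (φ y - φ x)) * bogoliubov φ (γ.erasePt x) := by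
  filter_upwards [γ.ae_notMem volume] with y hy
  have hs' : Summable fun w : (γ.erasePt x).carrier => φ w := summable_of_subset sdiff_subset hs
  rw [jumpTerm, move_eq, bogoliubov_insertPt hs' fun h => hy h.1, bogoliubov_eq_mul_erasePt hs hx]
  ring

variable [NullSingletonClass (intensity d z)]

namespace IsPoissonMeasure

/-- Makes `L` well defined on classes. Moving a point respects null sets when Lebesgue measure is
absolutely continuous with respect to `z dx`; for `z = 0` almost every configuration is empty. -/
theorem ae_kawasaki_congr (hπ : IsPoissonMeasure (intensity d z) π) {F G : Config d → ℂ}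
    (h : F =ᵐ[π] G) : ∀ᵐ γ ∂π, (KawasakiConverges a F γ ↔ KawasakiConverges a G γ) ∧
      kawasaki a F γ = kawasaki a G γ := by
  have h1 : ∀ᵐ γ ∂π, ∀ x ∈ γ.carrier, jumpTerm a F γ x =ᵐ[volume] jumpTerm a G γ x := by
    by_cases hz : z = 0
    · subst hz
      filter_upwards [hπ.ae_forall_mem_of_ae (P := fun _ => False)
        (by rw [intensity_zero]; simp)] with γ hγ x hx
      exact (hγ x hx).elim
    · filter_upwards [h, hπ.ae_forall_mem_ae_move (volume_absolutelyContinuous_intensity hz) h]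
        with γ h1 h2 x hx
      filter_upwards [h2 x hx] with y hy
      rw [jumpTerm, jumpTerm, hy, h1]
  filter_upwards [h1] with γ hγ using ⟨kawasakiConverges_congr hγ, kawasaki_congr hγ⟩

theorem ae_kawasaki_bogoliubov [NullSingletonClass (volume : Measure (E d))]
    (hπ : IsPoissonMeasure (intensity d z) π) (ha : IsJumpKernel a) {φ : E d → ℂ}
    (hφ : Integrable φ (intensity d z)) : ∀ᵐ γ ∂π, KawasakiConverges a (bogoliubov φ) γ ∧
      kawasaki a (bogoliubov φ) γ = bogoliubovDeriv φ (hopFun a φ) γ := by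
  have h1 : Integrable (fun p : E d × E d => ((‖φ p.2 - φ p.1‖ : ℝ) : ℂ)) (jumpMeasure a z) :=
    ((ha.integrable_snd_jumpMeasure hφ).1.sub (ha.integrable_fst_jumpMeasure hφ).1).norm.ofReal
  have h2 := (ha.integral_jumpMeasure h1).2.1
  have h3 : ∀ᵐ x ∂intensity d z, Integrable fun y => (a (x - y) : ℂ) * (φ y - φ x) :=
    (ha.ae_hopFun_eq (Or.inl rfl) (memLp_one_iff_integrable.2 hφ)).mono fun _ h => h.1
  have h4 := hπ.ae_summable h2
  have h5 := hπ.ae_forall_mem_of_ae h3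
  filter_upwards [hπ.ae_summable hφ, h4, h5] with γ hs hs2 hi
  refine ⟨⟨fun x hx => ?_, ?_⟩, ?_⟩
  · exact ((hi x hx).mul_const _).congr (jumpTerm_bogoliubov hs hx).symm
  -- Absolute convergence is the domination lemma with the absolute jump integral `∫ a(x - y) ‖φ(y)
  -- - φ(x)‖ dy` in the role of `ψ`.
  · refine (summable_norm_bogoliubovDeriv
      (ψ := fun x => ∫ y, (a (x - y) : ℂ) * ((‖φ y - φ x‖ : ℝ) : ℂ)) hs hs2).1.congr fun x => ?_
    refine Eq.trans ?_ (integral_congr_ae ((jumpTerm_bogoliubov hs x.2).fun_comp norm)).symm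
    simp only [Function.comp_def, norm_mul, integral_mul_const]
    congr 1
    simp only [← Complex.ofReal_mul, integral_complex_ofReal, Complex.norm_real,
      Real.norm_of_nonneg (ha.nonneg _)]
    exact Real.norm_of_nonneg (integral_nonneg fun y => mul_nonneg (ha.nonneg _) (norm_nonneg _))
  · refine tsum_congr fun x => ?_
    rw [integral_congr_ae (jumpTerm_bogoliubov hs x.2), integral_mul_const]
    rfl

theorem eq_smul_expState (hπ : IsPoissonMeasure (intensity d z) π) {φ : E d → ℂ}
    (h1 : MemLp φ 1 (intensity d z)) (h2 : MemLp φ 2 (intensity d z)) {F : Lp ℂ 2 π}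
    (hF : F =ᵐ[π] bogoliubov φ) :
    ∃ f, (f.1 : E d → ℂ) =ᵐ[intensity d z] φ ∧
      F = Complex.exp (∫ x, f.1 x ∂intensity d z) • hπ.expState f := by
  have hae := MemLp.coeFn_toLp h2
  refine ⟨⟨h2.toLp φ, h1.ae_eq hae.symm⟩, hae, ?_⟩
  rw [expState, smul_smul, ← Complex.exp_add, add_neg_cancel, Complex.exp_zero, one_smul]
  refine Lp.ext ?_
  exact hF.trans (((hπ.bogoliubov_ae_congr hae).symm).trans (hπ.bogoliubovLp_coe _ _).symm)

theorem coherentSpan_eq (hπ : IsPoissonMeasure (intensity d z) π) :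
    coherentSpan z π = Submodule.span ℂ (range hπ.expState) := by
  refine le_antisymm (Submodule.span_le.2 ?_) (Submodule.span_le.2 ?_)
  · rintro F ⟨φ, h1, h2, hF⟩
    obtain ⟨f, -, rfl⟩ := hπ.eq_smul_expState h1 h2 hF
    exact Submodule.smul_mem _ _ (Submodule.subset_span ⟨f, rfl⟩)
  · rintro _ ⟨f, rfl⟩
    refine Submodule.smul_mem _ _ (Submodule.subset_span ⟨f.1, f.2, Lp.memLp _, ?_⟩)
    exact hπ.bogoliubovLp_coe _ _

theorem dense_coherentSpan (hπ : IsPoissonMeasure (intensity d z) π) :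
    Dense (coherentSpan z π : Set (Lp ℂ 2 π)) := by
  rw [hπ.coherentSpan_eq]
  exact hπ.isTotal_expState

variable {hπ : IsPoissonMeasure (intensity d z) π} {ha : IsJumpKernel a}
  {S : ℝ → Lp ℂ 2 π →L[ℂ] Lp ℂ 2 π}

theorem IsHopSemigroup.apply_mem_coherentSpan (hS : hπ.IsHopSemigroup ha S) (t : ℝ) (ht : 0 ≤ t)
    (F : Lp ℂ 2 π) (hF : F ∈ coherentSpan z π) : S t F ∈ coherentSpan z π := by
  rw [hπ.coherentSpan_eq] at *
  induction hF using Submodule.span_induction with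
  | mem y hy =>
    obtain ⟨f, rfl⟩ := hy
    rw [hS.apply ht]
    exact Submodule.subset_span ⟨_, rfl⟩
  | zero => simp
  | add y w _ _ h1 h2 => rw [map_add]; exact add_mem h1 h2
  | smul c y _ h => rw [map_smul]; exact Submodule.smul_mem _ _ h

variable [NullSingletonClass (volume : Measure (E d))]

theorem IsHopSemigroup.exists_mem_graph_expState (hS : hπ.IsHopSemigroup ha S)
    (f : {f : OneParticle d z // MemLp f 1 (intensity d z)}) :
    ∃ H, (hπ.expState f, H) ∈ generatorGraph S ∧ H =ᵐ[π] fun γ =>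
      Complex.exp (-∫ x, f.1 x ∂intensity d z) * bogoliubovDeriv f.1 (hopFun a f.1) γ := by
  have h := hπ.memLp_bogoliubovDeriv f.2 (Lp.memLp f.1) (ha.memLp_hopFun (Or.inl rfl) f.2)
    (ha.memLp_hopFun (Or.inr rfl) (Lp.memLp f.1))
  refine ⟨_, hS.expState_mem_graph f (MemLp.coeFn_toLp h), ?_⟩
  filter_upwards [Lp.coeFn_smul (Complex.exp (-∫ x, f.1 x ∂intensity d z)) (h.toLp _),
    MemLp.coeFn_toLp h] with γ h1 h2
  rw [h1, Pi.smul_apply, h2, smul_eq_mul]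

theorem IsHopSemigroup.exists_mem_graph (hS : hπ.IsHopSemigroup ha S) (F : Lp ℂ 2 π)
    (hF : F ∈ coherentSpan z π) : ∃ H, (F, H) ∈ generatorGraph S ∧
      ∀ᵐ γ ∂π, KawasakiConverges a F γ ∧ kawasaki a F γ = H γ := by
  rw [hπ.coherentSpan_eq] at hF
  induction hF using Submodule.span_induction with
  | mem y hy =>
    obtain ⟨f, rfl⟩ := hy
    obtain ⟨H, hH, hH'⟩ := hS.exists_mem_graph_expState f
    refine ⟨H, hH, ?_⟩
    have hae : hπ.expState f =ᵐ[π] fun γ =>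
        Complex.exp (-∫ x, f.1 x ∂intensity d z) * bogoliubov f.1 γ := by
      filter_upwards [Lp.coeFn_smul (Complex.exp (-∫ x, f.1 x ∂intensity d z))
        (hπ.bogoliubovLp f.2 (Lp.memLp f.1)), hπ.bogoliubovLp_coe f.2 (Lp.memLp f.1)] with γ h1 h2
      rw [expState, h1, Pi.smul_apply, h2, smul_eq_mul]
    filter_upwards [hπ.ae_kawasaki_congr (a := a) hae, hH',
      hπ.ae_kawasaki_bogoliubov ha (memLp_one_iff_integrable.1 f.2)] with γ h1 h2 h3
    have h4 := h3.1.const_mul (Complex.exp (-∫ x, f.1 x ∂intensity d z))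
    exact ⟨h1.1.2 h4.1, by rw [h1.2, h4.2, h3.2, h2]⟩
  | zero =>
    refine ⟨0, (generatorGraph S).zero_mem, ?_⟩
    filter_upwards [hπ.ae_kawasaki_congr (a := a) (Lp.coeFn_zero ℂ 2 π), Lp.coeFn_zero ℂ 2 π]
      with γ h1 h2
    rw [h1.1, h1.2, h2]
    simp [KawasakiConverges, kawasaki, jumpTerm, summable_zero]
  | add y w _ _ h1 h2 =>
    obtain ⟨H, hH, hH'⟩ := h1
    obtain ⟨K, hK, hK'⟩ := h2
    refine ⟨H + K, Prod.mk_add_mk y w H K ▸ add_mem hH hK, ?_⟩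
    filter_upwards [hπ.ae_kawasaki_congr (a := a) (Lp.coeFn_add y w), Lp.coeFn_add H K, hH', hK']
      with γ h1 h2 h3 h4
    obtain ⟨h5, h6⟩ := h3.1.add h4.1
    rw [h3.2, h4.2] at h6
    rw [h2]
    exact ⟨h1.1.2 h5, h1.2.trans h6⟩
  | smul c y _ h =>
    obtain ⟨H, hH, hH'⟩ := h
    refine ⟨c • H, Prod.smul_mk c y H ▸ Submodule.smul_mem _ c hH, ?_⟩
    filter_upwards [hπ.ae_kawasaki_congr (a := a) (Lp.coeFn_smul c y), Lp.coeFn_smul c H, hH']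
      with γ h1 h2 h3
    obtain ⟨h5, h6⟩ := h3.1.const_mul c
    rw [h3.2] at h6
    rw [h2]
    exact ⟨h1.1.2 h5, h1.2.trans h6⟩

/-- `L` is the generator restricted to the coherent span. It is closable because the generator is
closed, and its closure is the whole generator because the span is dense and invariant, hence a
core. -/
theorem IsHopSemigroup.exists_linearPMap (hS : hπ.IsHopSemigroup ha S) :
    ∃ L : Lp ℂ 2 π →ₗ.[ℂ] Lp ℂ 2 π, L.domain = coherentSpan z π ∧
      (∀ (F : L.domain) (G : Config d → ℂ), (F : Lp ℂ 2 π) =ᵐ[π] G →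
        ∀ᵐ γ ∂π, KawasakiConverges a G γ ∧ L F γ = kawasaki a G γ) ∧
      L.IsClosable ∧ L.closure.graph = generatorGraph S := by
  have hc := hS.isContractionSemigroup
  have hfun : ∀ p ∈ generatorGraph S, p.1 = 0 → p.2 = 0 := fun p hp h0 => by
    obtain ⟨p1, p2⟩ := p
    obtain rfl : p1 = 0 := h0
    exact generatorGraph_snd_eq hp (generatorGraph S).zero_mem
  set G0 : Submodule ℂ (Lp ℂ 2 π × Lp ℂ 2 π) :=
    generatorGraph S ⊓ (coherentSpan z π).comap (LinearMap.fst ℂ _ _) with hG0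
  have hfun0 : ∀ p ∈ G0, p.1 = 0 → p.2 = 0 := fun p hp => hfun p hp.1
  have hcl : G0.topologicalClosure = generatorGraph S := by
    refine le_antisymm (Submodule.topologicalClosure_minimal _ inf_le_left hc.isClosed_graph) ?_
    intro p hp
    exact hc.mem_closure_of_core hπ.dense_coherentSpan hS.apply_mem_coherentSpan
      (fun u hu => (hS.exists_mem_graph u hu).imp fun _ h => h.1) hp
  have hgr : G0.toLinearPMap.graph = G0 := Submodule.toLinearPMap_graph_eq _ hfun0
  have hclosable : G0.toLinearPMap.IsClosable :=
    ⟨(generatorGraph S).toLinearPMap, by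
      rw [hgr, hcl, Submodule.toLinearPMap_graph_eq _ hfun]⟩
  refine ⟨G0.toLinearPMap, ?_, fun F G hFG => ?_, hclosable, ?_⟩
  · rw [Submodule.toLinearPMap_domain]
    ext u
    simp only [Submodule.mem_map, LinearMap.fst_apply]
    refine ⟨?_, fun hu => ?_⟩
    · rintro ⟨p, hp, rfl⟩
      exact hp.2
    · obtain ⟨g, hg, -⟩ := hS.exists_mem_graph u hu
      exact ⟨(u, g), ⟨hg, hu⟩, rfl⟩
  · have hmem : ((F : Lp ℂ 2 π), G0.toLinearPMap F) ∈ G0 := by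
      have h := LinearPMap.mem_graph _ F
      rwa [hgr] at h
    obtain ⟨H, hH, hH'⟩ := hS.exists_mem_graph (F : Lp ℂ 2 π) hmem.2
    rw [generatorGraph_snd_eq hmem.1 hH]
    filter_upwards [hH', hπ.ae_kawasaki_congr (a := a) hFG] with γ h1 h2
    exact ⟨h2.1.1 h1.1, by rw [← h1.2, h2.2]⟩
  · rw [← hclosable.graph_closure_eq_closure_graph, hgr, hcl]

end IsPoissonMeasure

end

end FreeKawasaki

namespace FreeKawasaki

open Config

/-! ### Cylinder functions -/

section

variable {d : ℕ} {z : ℝ≥0} {a : E d → ℝ}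

/-- The difference `F(γ ∪ x) - F(γ)`. -/
def discreteDiff (F : Config d → ℂ) (γ : Config d) (x : E d) : ℂ := F (γ.insertPt x) - F γ

/-- `∏_{x ∈ γ ∩ Λ} (1 + c)`. -/
def localExp (Λ : Set (E d)) (c : ℝ) (γ : Config d) : ℝ := bogoliubovReal (Λ.indicator fun _ => c) γ

/-- `F` depends only on the points in the bounded set `Λ` and has exponential growth. -/
structure IsCylinderBounded (F : Config d → ℂ) (Λ : Set (E d)) (c C : ℝ) : Prop where
  measurable : Measurable F
  measurableSet : MeasurableSet Λ
  isCompact_closure : IsCompact (closure Λ)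
  nonneg : 0 ≤ c
  nonneg' : 0 ≤ C
  norm_le : ∀ γ, ‖F γ‖ ≤ C * localExp Λ c γ
  norm_diff_le : ∀ γ x, ‖discreteDiff F γ x‖ ≤ Λ.indicator (fun _ => C) x * localExp Λ c γ

theorem hasCompactSupport_indicator {M : Type*} [Zero M] [TopologicalSpace M] {Λ : Set (E d)}
    (hΛ : IsCompact (closure Λ)) (c : M) : HasCompactSupport (Λ.indicator fun _ => c) :=
  HasCompactSupport.intro hΛ fun _ hx => indicator_of_notMem (fun h => hx (subset_closure h)) _

theorem exp_ncard_le_localExp {Λ : Set (E d)} (hΛ : IsCompact (closure Λ)) {c : ℝ} (hc : 0 ≤ c)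
    (γ : Config d) :
    Real.exp (c * ((γ.restrict Λ).carrier.ncard : ℝ)) ≤ localExp Λ (Real.exp c - 1) γ := by
  have hfin : (γ.carrier ∩ Λ).Finite :=
    (γ.finite_inter _ hΛ).subset (inter_subset_inter_right _ subset_closure)
  have hfin' : ((fun x : γ.carrier => (x : E d)) ⁻¹' Λ).Finite :=
    Set.Finite.of_finite_image (hfin.subset (by rintro _ ⟨x, hx, rfl⟩; exact ⟨x.2, hx⟩))
      Subtype.val_injective.injOn
  have hcard : (γ.restrict Λ).carrier.ncard = hfin'.toFinset.card := by
    rw [← ncard_eq_toFinset_card _ hfin', ← ncard_image_of_injective _ Subtype.val_injective,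
      Subtype.image_preimage_coe]
    rfl
  have h0 : ∀ x : E d, 0 ≤ Λ.indicator (fun _ => Real.exp c - 1) x := fun x =>
    indicator_nonneg (fun _ _ => by linarith [Real.add_one_le_exp c]) x
  refine le_trans (le_of_eq ?_) (prod_le_bogoliubovReal
    (γ.summable_of_hasCompactSupport (hasCompactSupport_indicator hΛ _)) h0 hfin'.toFinset)
  rw [hcard, mul_comm, Real.exp_nat_mul, Finset.prod_congr rfl fun x hx => ?_, Finset.prod_const]
  have : (x : E d) ∈ Λ := by simpa using hx
  rw [indicator_of_mem this]
  ring

theorem IsCylinderExpBounded.exists_isCylinderBounded {F : Config d → ℂ}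
    (hF : IsCylinderExpBounded F) : ∃ Λ c C, IsCylinderBounded F Λ c C := by
  obtain ⟨hm, Λ, ho, hΛ, hloc, C, c, hC, hc, hb⟩ := hF
  have he : 0 ≤ Real.exp c - 1 := by linarith [Real.add_one_le_exp c]
  have hE := exp_ncard_le_localExp hΛ hc.le
  have hle : ∀ γ, ‖F γ‖ ≤ C * localExp Λ (Real.exp c - 1) γ := fun γ =>
    (hb γ).trans (mul_le_mul_of_nonneg_left (hE γ) hC.le)
  have hE0 : ∀ γ : Config d, 0 ≤ localExp Λ (Real.exp c - 1) γ := fun γ =>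
    (Real.exp_pos _).le.trans (hE γ)
  -- One more point in `Λ` multiplies the bound by at most `e^c`, so the difference costs `C e^c +
  -- C`. The product `∏ (1 + (e^c - 1))` over the points in `Λ` restores `e^{c |γ ∩ Λ|}`.
  refine ⟨Λ, Real.exp c - 1, C * (Real.exp c + 1), hm, ho.measurableSet, hΛ, he, by positivity,
    fun γ => (hle γ).trans (mul_le_mul_of_nonneg_right ?_ (hE0 γ)), fun γ x => ?_⟩
  · nlinarith [Real.exp_pos c]
  · by_cases hx : x ∈ Λ
    · rw [indicator_of_mem hx, discreteDiff]
      have h1 : ((γ.insertPt x).restrict Λ).carrier.ncard ≤ (γ.restrict Λ).carrier.ncard + 1 := by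
        change (insert x γ.carrier ∩ Λ).ncard ≤ (γ.carrier ∩ Λ).ncard + 1
        rw [insert_inter_of_mem hx]
        exact ncard_insert_le _ _
      have h2 : ‖F (γ.insertPt x)‖ ≤ C * (Real.exp c * localExp Λ (Real.exp c - 1) γ) := by
        refine (hb _).trans (mul_le_mul_of_nonneg_left ?_ hC.le)
        refine le_trans ?_ (mul_le_mul_of_nonneg_left (hE γ) (Real.exp_pos c).le)
        rw [← Real.exp_add, Real.exp_le_exp]
        have : (((γ.insertPt x).restrict Λ).carrier.ncard : ℝ) ≤ (γ.restrict Λ).carrier.ncard + 1 := by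
          exact_mod_cast h1
        nlinarith
      calc _ ≤ ‖F (γ.insertPt x)‖ + ‖F γ‖ := norm_sub_le _ _
        _ ≤ _ := add_le_add h2 (hle γ)
        _ = _ := by ring
    · rw [indicator_of_notMem hx, zero_mul, discreteDiff, hloc, hloc γ]
      have : (γ.insertPt x).restrict Λ = γ.restrict Λ := by
        ext w
        change w ∈ insert x γ.carrier ∩ Λ ↔ w ∈ γ.carrier ∩ Λ
        rw [insert_inter_of_notMem hx]
      rw [this, sub_self, norm_zero]

/-- An upper bound for the jump rates into and out of `Λ`. -/
def exchangeRate (a : E d → ℝ) (Λ : Set (E d)) (C : ℝ) (x : E d) : ℝ :=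
  ∫ y, a (x - y) * (Λ.indicator (fun _ => C) y + Λ.indicator (fun _ => C) x)

/-- Both `γ \ x ∪ y` and `γ` arise from `γ \ x` by inserting one point. With `γ \ x` frozen, the
jump becomes the one-particle jump operator on the function `discreteDiff F (γ \ x)`. -/
theorem jumpTerm_eq_discreteDiff {F : Config d → ℂ} {γ : Config d} {x : E d} (hx : x ∈ γ.carrier)
    (y : E d) : jumpTerm a F γ x y =
      (a (x - y) : ℂ) * (discreteDiff F (γ.erasePt x) y - discreteDiff F (γ.erasePt x) x) := by
  rw [jumpTerm, discreteDiff, discreteDiff, insertPt_erasePt hx, move_eq]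
  ring

namespace IsCylinderBounded

variable {F : Config d → ℂ} {Λ : Set (E d)} {c C : ℝ} (hF : IsCylinderBounded F Λ c C)


theorem indicator_nonneg (hF : IsCylinderBounded F Λ c C) (x : E d) :
    0 ≤ Λ.indicator (fun _ => C) x := Set.indicator_nonneg (fun _ _ => hF.nonneg') x

theorem indicator_le (hF : IsCylinderBounded F Λ c C) (x : E d) :
    Λ.indicator (fun _ => C) x ≤ C := indicator_le_self' (fun _ _ => hF.nonneg') x

theorem memLp_indicator (hF : IsCylinderBounded F Λ c C) {M : Type*} [NormedAddCommGroup M]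
    (p : ℝ≥0∞) (r : M) : MemLp (Λ.indicator fun _ => r) p (intensity d z) :=
  memLp_indicator_const p hF.measurableSet r (Or.inr
    ((measure_mono subset_closure).trans_lt hF.isCompact_closure.measure_lt_top).ne)

theorem localExp_nonneg (hF : IsCylinderBounded F Λ c C) (γ : Config d) : 0 ≤ localExp Λ c γ :=
  bogoliubovReal_nonneg
    (γ.summable_of_hasCompactSupport (hasCompactSupport_indicator hF.isCompact_closure _))
    fun x => Set.indicator_nonneg (fun _ _ => hF.nonneg) x

theorem localExp_eq (hF : IsCylinderBounded F Λ c C) (γ : Config d) :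
    (localExp Λ c γ : ℂ) = bogoliubov (Λ.indicator fun _ => (c : ℂ)) γ := by
  rw [localExp, ← bogoliubov_ofReal
    (γ.summable_of_hasCompactSupport (hasCompactSupport_indicator hF.isCompact_closure _))]
  refine bogoliubov_congr fun x _ => ?_
  by_cases hx : x ∈ Λ <;> simp [hx]

theorem measurable_discreteDiff (hF : IsCylinderBounded F Λ c C) :
    Measurable fun p : Config d × E d => discreteDiff F p.1 p.2 :=
  (hF.measurable.comp measurable_insertPt).sub (hF.measurable.comp measurable_fst)

theorem measurable_discreteDiff_right (hF : IsCylinderBounded F Λ c C) (γ : Config d) :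
    Measurable (discreteDiff F γ) := hF.measurable_discreteDiff.comp measurable_prodMk_left

theorem memLp_discreteDiff (hF : IsCylinderBounded F Λ c C) (p : ℝ≥0∞) (γ : Config d) :
    MemLp (discreteDiff F γ) p (intensity d z) := by
  refine (hF.memLp_indicator p (C * localExp Λ c γ)).of_le
    (hF.measurable_discreteDiff_right γ).aestronglyMeasurable (ae_of_all _ fun x => ?_)
  refine (hF.norm_diff_le γ x).trans ((le_of_eq ?_).trans (le_abs_self _))
  by_cases hx : x ∈ Λ <;> simp [hx]

theorem integrable_jump (hF : IsCylinderBounded F Λ c C) (ha : IsJumpKernel a) (γ : Config d)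
    (x : E d) :
    Integrable fun y => (a (x - y) : ℂ) * (discreteDiff F γ y - discreteDiff F γ x) := by
  refine (ha.integrable_sub_left x).mul_bdd (c := C * localExp Λ c γ + ‖discreteDiff F γ x‖)
    ((hF.measurable_discreteDiff_right γ).sub_const _).aestronglyMeasurable
    (ae_of_all _ fun y => (norm_sub_le _ _).trans (add_le_add_left ?_ _))
  exact (hF.norm_diff_le γ y).trans
    (mul_le_mul_of_nonneg_right (hF.indicator_le y) (hF.localExp_nonneg γ))

theorem integrable_exchangeRate (hF : IsCylinderBounded F Λ c C) (ha : IsJumpKernel a) (x : E d) :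
    Integrable fun y => a (x - y) * (Λ.indicator (fun _ => C) y + Λ.indicator (fun _ => C) x) := by
  refine (ha.integrable.comp_sub_left x).mul_bdd (c := C + C)
    ((measurable_const.indicator hF.measurableSet).add_const _).aestronglyMeasurable
    (ae_of_all _ fun y => ?_)
  rw [Real.norm_of_nonneg (add_nonneg (hF.indicator_nonneg y) (hF.indicator_nonneg x))]
  exact add_le_add (hF.indicator_le y) (hF.indicator_le x)

theorem exchangeRate_nonneg (hF : IsCylinderBounded F Λ c C) (ha : IsJumpKernel a) (x : E d) :
    0 ≤ exchangeRate a Λ C x :=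
  integral_nonneg fun y => mul_nonneg (ha.nonneg _)
    (add_nonneg (hF.indicator_nonneg y) (hF.indicator_nonneg x))

theorem integral_norm_jump_le (hF : IsCylinderBounded F Λ c C) (ha : IsJumpKernel a) (γ : Config d)
    (x : E d) : ∫ y, ‖(a (x - y) : ℂ) * (discreteDiff F γ y - discreteDiff F γ x)‖ ≤
      exchangeRate a Λ C x * localExp Λ c γ := by
  rw [exchangeRate, ← integral_mul_const]
  refine integral_mono (hF.integrable_jump ha γ x).norm
    ((hF.integrable_exchangeRate ha x).mul_const _) fun y => ?_
  simp only
  rw [norm_mul, Complex.norm_real, Real.norm_of_nonneg (ha.nonneg _), mul_assoc, add_mul]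
  exact mul_le_mul_of_nonneg_left ((norm_sub_le _ _).trans
    (add_le_add (hF.norm_diff_le γ y) (hF.norm_diff_le γ x))) (ha.nonneg _)

theorem norm_hopFun_discreteDiff_le (hF : IsCylinderBounded F Λ c C) (ha : IsJumpKernel a)
    (γ : Config d) (x : E d) :
    ‖hopFun a (discreteDiff F γ) x‖ ≤ exchangeRate a Λ C x * localExp Λ c γ :=
  (norm_integral_le_integral_norm _).trans (hF.integral_norm_jump_le ha γ x)

theorem ofReal_exchangeRate (hF : IsCylinderBounded F Λ c C) (ha : IsJumpKernel a) (x : E d) :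
    ENNReal.ofReal (exchangeRate a Λ C x) =
      (∫⁻ y, ENNReal.ofReal (a (x - y)) * Λ.indicator (fun _ => ENNReal.ofReal C) y) +
        ENNReal.ofReal (∫ y, a y) * Λ.indicator (fun _ => ENNReal.ofReal C) x := by
  have hi : ∀ y, ENNReal.ofReal (Λ.indicator (fun _ => C) y) =
      Λ.indicator (fun _ => ENNReal.ofReal C) y := fun y => by
    by_cases hy : y ∈ Λ <;> simp [hy]
  have hm : Measurable fun y => ENNReal.ofReal (a (x - y)) :=
    (ha.measurable.comp (measurable_const.sub measurable_id)).ennreal_ofReal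
  rw [exchangeRate, ofReal_integral_eq_lintegral_ofReal (hF.integrable_exchangeRate ha x)
    (ae_of_all _ fun y => mul_nonneg (ha.nonneg _)
      (add_nonneg (hF.indicator_nonneg y) (hF.indicator_nonneg x)))]
  simp only [ENNReal.ofReal_mul (ha.nonneg _), ENNReal.ofReal_add (hF.indicator_nonneg _)
    (hF.indicator_nonneg _), hi]
  simp only [mul_add]
  rw [lintegral_add_left (f := fun y => ENNReal.ofReal (a (x - y)) *
      Λ.indicator (fun _ => ENNReal.ofReal C) y)
      (hm.mul (measurable_const.indicator hF.measurableSet)),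
    lintegral_mul_const _ hm, lintegral_sub_left fun y => ENNReal.ofReal (a y),
    ha.lintegral_ofReal_eq]

/-- The rates into `Λ` sum to at most `C ∫_{closure Λ} ∑ₓ a(x - y) dy`, finite by the definition of
`Γ_a`. The rates out of `Λ` involve only the finitely many points of `γ` in `Λ`. -/
theorem summable_exchangeRate (hF : IsCylinderBounded F Λ c C) (ha : IsJumpKernel a) {γ : Config d}
    (hγ : γ ∈ admissible a) : Summable fun x : γ.carrier => exchangeRate a Λ C x := by
  have hcount : Countable γ.carrier := γ.countable_carrier.to_subtype
  have hle : ∑' x : γ.carrier, ENNReal.ofReal (exchangeRate a Λ C x) ≠ ⊤ := by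
    simp only [hF.ofReal_exchangeRate ha]
    rw [ENNReal.tsum_add, ENNReal.tsum_mul_left, ← lintegral_tsum fun x => by
      exact (((ha.measurable.comp (measurable_const.sub measurable_id)).ennreal_ofReal).mul
        (measurable_const.indicator hF.measurableSet)).aemeasurable]
    refine ENNReal.add_ne_top.2 ⟨?_, ENNReal.mul_ne_top ENNReal.ofReal_ne_top ?_⟩
    · have h1 := hγ _ hF.isCompact_closure
      refine ((?_ : _ ≤ ENNReal.ofReal C * ∫⁻ y in closure Λ,
        ∑' x : γ.carrier, ENNReal.ofReal (a (x - y))).trans_lt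
        (ENNReal.mul_lt_top ENNReal.ofReal_lt_top h1)).ne
      rw [← lintegral_const_mul' _ _ ENNReal.ofReal_ne_top,
        ← lintegral_indicator hF.isCompact_closure.measurableSet]
      refine lintegral_mono fun y => ?_
      by_cases hy : y ∈ Λ
      · rw [indicator_of_mem (subset_closure hy), indicator_of_mem hy, ENNReal.tsum_mul_right,
          mul_comm]
      · simp [hy]
    · have hs := γ.summable_of_hasCompactSupport
        (hasCompactSupport_indicator hF.isCompact_closure C)
      have h2 : ∀ x : γ.carrier, Λ.indicator (fun _ => ENNReal.ofReal C) (x : E d) =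
          ENNReal.ofReal (Λ.indicator (fun _ => C) (x : E d)) := fun x => by
        by_cases hx : (x : E d) ∈ Λ <;> simp [hx]
      simp only [h2]
      rw [← ENNReal.ofReal_tsum_of_nonneg (fun x => hF.indicator_nonneg _) hs]
      exact ENNReal.ofReal_ne_top
  refine (ENNReal.summable_toReal hle).congr fun x => ?_
  exact ENNReal.toReal_ofReal (hF.exchangeRate_nonneg ha x)

theorem summable_exchangeRate_mul_localExp (hF : IsCylinderBounded F Λ c C) (ha : IsJumpKernel a)
    {γ : Config d} (hγ : Summable fun x : γ.carrier => exchangeRate a Λ C x) :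
    Summable (fun x : γ.carrier => exchangeRate a Λ C x * localExp Λ c (γ.erasePt x)) ∧
    ∑' x : γ.carrier, exchangeRate a Λ C x * localExp Λ c (γ.erasePt x) ≤
      bogoliubovReal (fun x => Λ.indicator (fun _ => c) x + exchangeRate a Λ C x) γ := by
  have h := summable_norm_bogoliubovDeriv (φ := Λ.indicator fun _ => (c : ℂ))
    (ψ := fun x => (exchangeRate a Λ C x : ℂ))
    (γ.summable_of_hasCompactSupport (hasCompactSupport_indicator hF.isCompact_closure _))
    (Complex.ofRealCLM.summable hγ)
  have e1 : ∀ x : γ.carrier, ‖(exchangeRate a Λ C x : ℂ) *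
      bogoliubov (Λ.indicator fun _ => (c : ℂ)) (γ.erasePt x)‖ =
      exchangeRate a Λ C x * localExp Λ c (γ.erasePt x) := fun x => by
    rw [← hF.localExp_eq, norm_mul, Complex.norm_real, Complex.norm_real,
      Real.norm_of_nonneg (hF.exchangeRate_nonneg ha _), Real.norm_of_nonneg (hF.localExp_nonneg _)]
  have e2 : (fun x => ‖Λ.indicator (fun _ => (c : ℂ)) x‖ + ‖(exchangeRate a Λ C x : ℂ)‖) =
      fun x => Λ.indicator (fun _ => c) x + exchangeRate a Λ C x := funext fun x => by
    rw [Complex.norm_real, Real.norm_of_nonneg (hF.exchangeRate_nonneg ha _)]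
    by_cases hx : x ∈ Λ <;> simp [hx, abs_of_nonneg hF.nonneg]
  simp only [e1, e2] at h
  exact h

theorem integral_jumpTerm {γ : Config d} {x : E d} (hx : x ∈ γ.carrier) :
    ∫ y, jumpTerm a F γ x y = hopFun a (discreteDiff F (γ.erasePt x)) x :=
  integral_congr_ae (ae_of_all _ fun y => jumpTerm_eq_discreteDiff hx y)

theorem integral_norm_jumpTerm_le (hF : IsCylinderBounded F Λ c C) (ha : IsJumpKernel a)
    {γ : Config d} {x : E d} (hx : x ∈ γ.carrier) : ∫ y, ‖jumpTerm a F γ x y‖ ≤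
      exchangeRate a Λ C x * localExp Λ c (γ.erasePt x) := by
  simp only [jumpTerm_eq_discreteDiff hx]
  exact hF.integral_norm_jump_le ha _ x

theorem kawasakiConverges (hF : IsCylinderBounded F Λ c C) (ha : IsJumpKernel a)
    {γ : Config d} (hγ : γ ∈ admissible a) : KawasakiConverges a F γ := by
  refine ⟨fun x hx => ?_, ?_⟩
  · simp only [jumpTerm_eq_discreteDiff hx]
    exact hF.integrable_jump ha _ x
  · exact .of_nonneg_of_le (fun x => integral_nonneg fun y => norm_nonneg _)
      (fun x => hF.integral_norm_jumpTerm_le ha x.2)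
      (hF.summable_exchangeRate_mul_localExp ha (hF.summable_exchangeRate ha hγ)).1

theorem norm_kawasaki_le (hF : IsCylinderBounded F Λ c C) (ha : IsJumpKernel a)
    {γ : Config d} (hγ : Summable fun x : γ.carrier => exchangeRate a Λ C x) :
    ‖kawasaki a F γ‖ ≤
      bogoliubovReal (fun x => Λ.indicator (fun _ => c) x + exchangeRate a Λ C x) γ := by
  have h := hF.summable_exchangeRate_mul_localExp ha hγ
  refine le_trans ?_ h.2
  exact tsum_of_norm_bounded h.1.hasSum fun x =>
    (norm_integral_le_integral_norm _).trans (hF.integral_norm_jumpTerm_le ha x.2)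

theorem memLp_exchangeRate (hF : IsCylinderBounded F Λ c C) (ha : IsJumpKernel a) {p : ℝ≥0∞}
    (hp : p = 1 ∨ p = 2) : MemLp (exchangeRate a Λ C) p (intensity d z) := by
  have h1 := (ha.memLp_convFun hp (hF.memLp_indicator (z := z) p (C : ℂ))).add
    ((hF.memLp_indicator (z := z) p (C : ℂ)).const_mul ((∫ y, a y : ℝ) : ℂ))
  refine h1.re.ae_eq (ae_of_all _ fun x => ?_)
  have e : ((exchangeRate a Λ C x : ℝ) : ℂ) = convFun a (Λ.indicator fun _ => (C : ℂ)) x +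
      ((∫ y, a y : ℝ) : ℂ) * Λ.indicator (fun _ => (C : ℂ)) x := by
    have hi : ∀ y, ((Λ.indicator (fun _ => C) y : ℝ) : ℂ) = Λ.indicator (fun _ => (C : ℂ)) y :=
      fun y => by by_cases hy : y ∈ Λ <;> simp [hy]
    rw [exchangeRate, ← integral_complex_ofReal]
    simp only [Complex.ofReal_mul, Complex.ofReal_add, hi, mul_add]
    rw [integral_add, integral_mul_const, integral_complex_ofReal,
      integral_sub_left_eq_self a volume x]
    · rfl
    · exact (ha.integrable_sub_left x).mul_bdd (c := ‖(C : ℂ)‖)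
        (measurable_const.indicator hF.measurableSet).aestronglyMeasurable
        (ae_of_all _ fun y => norm_indicator_le_norm_self _ _)
    · exact (ha.integrable_sub_left x).mul_const _
  change (convFun a (Λ.indicator fun _ => (C : ℂ)) x +
      ((∫ y, a y : ℝ) : ℂ) * Λ.indicator (fun _ => (C : ℂ)) x).re = _
  rw [← e, Complex.ofReal_re]

end IsCylinderBounded

end

end FreeKawasaki

/-! ### Duality between cylinder functions and Bogoliubov exponentials -/

namespace FreeKawasaki

open Config ProbabilityTheory

section

variable {d : ℕ} {z : ℝ≥0} {a : E d → ℝ} {π : Measure (Config d)}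

theorem IsJumpKernel.integral_conj_mul_hopFun (ha : IsJumpKernel a) {f g : E d → ℂ}
    (hf : MemLp f 2 (intensity d z)) (hg : MemLp g 2 (intensity d z)) :
    ∫ x, starRingEnd ℂ (g x) * hopFun a f x ∂intensity d z =
      ∫ x, starRingEnd ℂ (hopFun (fun x => a (-x)) g x) * f x ∂intensity d z := by
  have e := ha.integral_conj_mul_convFun hf hg
  have hgc : MemLp (fun x => starRingEnd ℂ (g x)) 2 (intensity d z) := hg.star
  have h1 := hgc.integrable_mul (ha.memLp_convFun (Or.inr rfl) hf)
  have h2 : Integrable (fun x => starRingEnd ℂ (g x) * (((∫ x, a x : ℝ) : ℂ) * f x))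
      (intensity d z) := hgc.integrable_mul (hf.const_mul _)
  have hc := ha.neg.memLp_convFun (Or.inr rfl) hg
  have hcc : MemLp (fun x => starRingEnd ℂ (convFun (fun x => a (-x)) g x)) 2 (intensity d z) :=
    hc.star
  have h3 := hcc.integrable_mul hf
  have e1 : ∫ x, starRingEnd ℂ (g x) * hopFun a f x ∂intensity d z =
      ∫ x, (starRingEnd ℂ (g x) * convFun a f x -
        starRingEnd ℂ (g x) * (((∫ x, a x : ℝ) : ℂ) * f x)) ∂intensity d z :=
    integral_congr_ae ((ha.ae_hopFun_eq (Or.inr rfl) hf).mono fun x hx => by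
      simp only [hx.2, mul_sub])
  have e2 : ∫ x, starRingEnd ℂ (hopFun (fun x => a (-x)) g x) * f x ∂intensity d z =
      ∫ x, (starRingEnd ℂ (convFun (fun x => a (-x)) g x) * f x -
        starRingEnd ℂ (g x) * (((∫ x, a x : ℝ) : ℂ) * f x)) ∂intensity d z :=
    integral_congr_ae ((ha.neg.ae_hopFun_eq (Or.inr rfl) hg).mono fun x hx => by
      simp only [hx.2, map_sub, map_mul, Complex.conj_ofReal, integral_neg_eq_self a volume]
      ring)
  rw [e1, e2, integral_sub (f := fun x => starRingEnd ℂ (g x) * convFun a f x) h1 h2,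
    integral_sub (f := fun x => starRingEnd ℂ (convFun (fun x => a (-x)) g x) * f x) h3 h2, e]

namespace IsCylinderBounded

variable {F : Config d → ℂ} {Λ : Set (E d)} {c C : ℝ}

theorem stronglyMeasurable_hopFun_discreteDiff (hF : IsCylinderBounded F Λ c C)
    (ha : IsJumpKernel a) :
    StronglyMeasurable fun p : Config d × E d => hopFun a (discreteDiff F p.1) p.2 := by
  have hm : Measurable fun q : (Config d × E d) × E d =>
      (a (q.1.2 - q.2) : ℂ) * (discreteDiff F q.1.1 q.2 - discreteDiff F q.1.1 q.1.2) := by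
    refine (Complex.measurable_ofReal.comp (ha.measurable.comp
      ((measurable_snd.comp measurable_fst).sub measurable_snd))).mul (Measurable.sub ?_ ?_)
    · exact hF.measurable_discreteDiff.comp
        ((measurable_fst.comp measurable_fst).prodMk measurable_snd)
    · exact hF.measurable_discreteDiff.comp measurable_fst
  exact hm.stronglyMeasurable.integral_prod_right' (ν := volume)

theorem stronglyMeasurable_integral_jumpTerm (hF : IsCylinderBounded F Λ c C)
    (ha : IsJumpKernel a) :
    StronglyMeasurable fun p : Config d × E d => ∫ y, jumpTerm a F p.1 p.2 y := by
  have hm : Measurable fun q : (Config d × E d) × E d => jumpTerm a F q.1.1 q.1.2 q.2 := by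
    refine (Complex.measurable_ofReal.comp (ha.measurable.comp
      ((measurable_snd.comp measurable_fst).sub measurable_snd))).mul (Measurable.sub ?_ ?_)
    · exact hF.measurable.comp measurable_move
    · exact hF.measurable.comp (measurable_fst.comp measurable_fst)
  exact hm.stronglyMeasurable.integral_prod_right' (ν := volume)

variable [NullSingletonClass (intensity d z)]

theorem memLp_localExp (hF : IsCylinderBounded F Λ c C) (hπ : IsPoissonMeasure (intensity d z) π) :
    MemLp (localExp Λ c) 2 π := by
  refine (hπ.memLp_bogoliubov (hF.memLp_indicator 1 (c : ℂ)) (hF.memLp_indicator 2 (c : ℂ))).norm.ae_eq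
    (ae_of_all _ fun γ => ?_)
  rw [← hF.localExp_eq, Complex.norm_real, Real.norm_of_nonneg (hF.localExp_nonneg γ)]

theorem memLp (hF : IsCylinderBounded F Λ c C) (hπ : IsPoissonMeasure (intensity d z) π) :
    MemLp F 2 π :=
  ((hF.memLp_localExp hπ).const_mul C).of_le hF.measurable.aestronglyMeasurable
    (ae_of_all _ fun γ => (hF.norm_le γ).trans (le_abs_self _))

theorem ae_integral_jumpTerm_insertPt (hπ : IsPoissonMeasure (intensity d z) π) :
    ∀ᵐ p ∂π.prod (intensity d z), ∫ y, jumpTerm a F (p.1.insertPt p.2) p.2 y =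
      hopFun a (discreteDiff F p.1) p.2 := by
  have := hπ.isProbability
  filter_upwards [ae_prod_notMem (π := π) (ν := intensity d z)] with p hp
  rw [integral_jumpTerm (mem_insert _ _), erasePt_insertPt hp]

theorem integrable_mul_hopFun (hF : IsCylinderBounded F Λ c C)
    (hπ : IsPoissonMeasure (intensity d z) π) (ha : IsJumpKernel a) {w : E d → ℂ}
    (h1 : MemLp w 1 (intensity d z)) (h2 : MemLp w 2 (intensity d z)) :
    Integrable (fun p : Config d × E d => starRingEnd ℂ (bogoliubov w p.1) *
      ((1 + starRingEnd ℂ (w p.2)) * hopFun a (discreteDiff F p.1) p.2))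
      (π.prod (intensity d z)) := by
  have := hπ.isProbability
  have hw := hπ.memLp_bogoliubov h1 h2
  have hi1 : Integrable (fun γ => ‖bogoliubov w γ‖ * localExp Λ c γ) π :=
    hw.norm.integrable_mul (hF.memLp_localExp hπ)
  have hr1 := memLp_one_iff_integrable.1 (hF.memLp_exchangeRate (z := z) ha (Or.inl rfl))
  have hr2 : Integrable (fun x => exchangeRate a Λ C x * ‖w x‖) (intensity d z) :=
    (hF.memLp_exchangeRate (z := z) ha (Or.inr rfl)).integrable_mul h2.norm
  have hwm : AEStronglyMeasurable (fun x => starRingEnd ℂ (w x)) (intensity d z) := h2.star.1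
  have hBm : AEStronglyMeasurable (fun γ => starRingEnd ℂ (bogoliubov w γ)) π := hw.star.1
  refine (hi1.mul_prod (hr1.add hr2)).mono' ?_ (ae_of_all _ fun p => ?_)
  · exact (hBm.comp_quasiMeasurePreserving Measure.quasiMeasurePreserving_fst).mul
      (((aestronglyMeasurable_const.add hwm).comp_quasiMeasurePreserving
        Measure.quasiMeasurePreserving_snd).mul
        (hF.stronglyMeasurable_hopFun_discreteDiff ha).aestronglyMeasurable)
  · rw [norm_mul, norm_mul, RCLike.norm_conj, Pi.add_apply, mul_assoc]
    refine mul_le_mul_of_nonneg_left ?_ (norm_nonneg _)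
    have hn : ‖1 + starRingEnd ℂ (w p.2)‖ ≤ 1 + ‖w p.2‖ := (norm_add_le _ _).trans (by simp)
    refine (mul_le_mul hn (hF.norm_hopFun_discreteDiff_le ha p.1 p.2) (norm_nonneg _)
      (by positivity)).trans (le_of_eq ?_)
    ring

theorem aestronglyMeasurable_conj_mul_jumpTerm (hF : IsCylinderBounded F Λ c C)
    (hπ : IsPoissonMeasure (intensity d z) π) [SFinite π] (ha : IsJumpKernel a) {w : E d → ℂ}
    (h1 : Integrable w (intensity d z)) :
    AEStronglyMeasurable (Function.uncurry fun (γ : Config d) x =>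
      starRingEnd ℂ (bogoliubov w γ) * ∫ y, jumpTerm a F γ x y) (π ⊗ₘ countingKernel d) := by
  have hBm : AEStronglyMeasurable (fun γ => starRingEnd ℂ (bogoliubov w γ)) π :=
    (hπ.aestronglyMeasurable_bogoliubov h1).star
  exact (hBm.comp_quasiMeasurePreserving hπ.quasiMeasurePreserving_fst).mul
    (hF.stronglyMeasurable_integral_jumpTerm ha).aestronglyMeasurable

theorem ae_conj_mul_jumpTerm (hπ : IsPoissonMeasure (intensity d z) π) {w : E d → ℂ}
    (h1 : Integrable w (intensity d z)) :
    (fun p : Config d × E d => starRingEnd ℂ (bogoliubov w (p.1.insertPt p.2)) *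
      ∫ y, jumpTerm a F (p.1.insertPt p.2) p.2 y) =ᵐ[π.prod (intensity d z)]
    fun p => starRingEnd ℂ (bogoliubov w p.1) *
      ((1 + starRingEnd ℂ (w p.2)) * hopFun a (discreteDiff F p.1) p.2) := by
  filter_upwards [ae_integral_jumpTerm_insertPt (a := a) (F := F) hπ,
    hπ.ae_bogoliubov_insertPt h1] with p hp hp'
  rw [hp, hp', map_mul, map_add, map_one]
  ring

theorem memLp_kawasaki (hF : IsCylinderBounded F Λ c C) (hπ : IsPoissonMeasure (intensity d z) π)
    (ha : IsJumpKernel a) : MemLp (kawasaki a F) 2 π := by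
  have := hπ.isProbability
  -- With `w = 0` the exponential is `1`, and the general Mecke computation yields measurability of
  -- `kawasaki a F`.
  have h0 : MemLp (fun _ : E d => (0 : ℂ)) 1 (intensity d z) := MemLp.zero
  have hi := (hF.integrable_mul_hopFun hπ ha h0 MemLp.zero).congr
    (ae_conj_mul_jumpTerm hπ (memLp_one_iff_integrable.1 h0)).symm
  have hm := (hπ.integral_tsum (h := fun γ x => starRingEnd ℂ (bogoliubov _ γ) *
      ∫ y, jumpTerm a F γ x y) (hF.aestronglyMeasurable_conj_mul_jumpTerm hπ ha
    (memLp_one_iff_integrable.1 h0)) hi).2.1.1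
  simp only [bogoliubov_zero, map_one, one_mul] at hm
  refine hπ.memLp_of_norm_le_bogoliubovReal
    ((hF.memLp_indicator 1 c).add (hF.memLp_exchangeRate ha (Or.inl rfl)))
    ((hF.memLp_indicator 2 c).add (hF.memLp_exchangeRate ha (Or.inr rfl)))
    (fun x => add_nonneg (Set.indicator_nonneg (fun _ _ => hF.nonneg) x)
      (hF.exchangeRate_nonneg ha x)) hm ?_
  have hs := hπ.ae_summable (φ := fun x => (exchangeRate a Λ C x : ℂ))
    (memLp_one_iff_integrable.1 (hF.memLp_exchangeRate ha (Or.inl rfl))).ofReal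
  filter_upwards [hs] with γ hγ
  exact hF.norm_kawasaki_le ha (by exact_mod_cast hγ)

/-- The Mecke identity turns both sides into integrals over `γ` and one inserted point. For fixed
`γ` the terms without `w`, respectively with the constant `F(γ)`, vanish because the jump operator
has integral zero. The rest is the one-particle adjoint relation between `discreteDiff F γ` and `w`.
-/
theorem integral_conj_bogoliubov_mul_kawasaki (hF : IsCylinderBounded F Λ c C)
    (hπ : IsPoissonMeasure (intensity d z) π) (ha : IsJumpKernel a) {w : E d → ℂ}
    (h1 : MemLp w 1 (intensity d z)) (h2 : MemLp w 2 (intensity d z)) :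
    ∫ γ, starRingEnd ℂ (bogoliubov w γ) * kawasaki a F γ ∂π =
      ∫ γ, starRingEnd ℂ (bogoliubovDeriv w (hopFun (fun x => a (-x)) w) γ) * F γ ∂π := by
  have := hπ.isProbability
  have hi1 := memLp_one_iff_integrable.1 h1
  have hk := hF.integrable_mul_hopFun hπ ha h1 h2
  have hm1 := ha.neg.memLp_hopFun (Or.inl rfl) h1
  have hm2 := ha.neg.memLp_hopFun (Or.inr rfl) h2
  have hw2 : MemLp (fun x => starRingEnd ℂ (w x)) 2 (intensity d z) := h2.star
  have e1 := (hπ.integral_tsum (h := fun γ x => starRingEnd ℂ (bogoliubov _ γ) *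
      ∫ y, jumpTerm a F γ x y) (hF.aestronglyMeasurable_conj_mul_jumpTerm hπ ha hi1)
    (hk.congr (ae_conj_mul_jumpTerm hπ hi1).symm)).2.2
  simp only [tsum_mul_left] at e1
  have e2 := hπ.integral_conj_mul_bogoliubovDeriv h1 h2 hm1 hm2 (hF.memLp hπ)
  have e3 : ∫ γ, starRingEnd ℂ (bogoliubovDeriv w (hopFun (fun x => a (-x)) w) γ) * F γ ∂π =
      starRingEnd ℂ (∫ γ, starRingEnd ℂ (F γ) *
        bogoliubovDeriv w (hopFun (fun x => a (-x)) w) γ ∂π) := by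
    rw [← integral_conj]
    exact integral_congr_ae (ae_of_all _ fun γ => by simp [mul_comm])
  rw [e3, e2.2, integral_prod _ e2.1, ← integral_conj]
  refine e1.trans ((integral_congr_ae (ae_conj_mul_jumpTerm hπ hi1)).trans ?_)
  rw [integral_prod _ hk]
  refine integral_congr_ae (ae_of_all _ fun γ => ?_)
  have hg1 := hF.memLp_discreteDiff (z := z) 1 γ
  have hg2 := hF.memLp_discreteDiff (z := z) 2 γ
  have hh1 := memLp_one_iff_integrable.1 (ha.memLp_hopFun (Or.inl rfl) hg1)
  have hh2 : Integrable (fun x => starRingEnd ℂ (w x) * hopFun a (discreteDiff F γ) x)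
      (intensity d z) := hw2.integrable_mul (ha.memLp_hopFun (Or.inr rfl) hg2)
  have l1 : ∫ x, starRingEnd ℂ (bogoliubov w γ) *
      ((1 + starRingEnd ℂ (w x)) * hopFun a (discreteDiff F γ) x) ∂intensity d z =
      starRingEnd ℂ (bogoliubov w γ) *
        ∫ x, starRingEnd ℂ (w x) * hopFun a (discreteDiff F γ) x ∂intensity d z := by
    rw [integral_const_mul]
    congr 1
    simp only [add_mul, one_mul]
    rw [integral_add hh1 hh2, ha.integral_hopFun (memLp_one_iff_integrable.1 hg1), zero_add]
  have hc2 : MemLp (fun x => starRingEnd ℂ (discreteDiff F γ x)) 2 (intensity d z) := hg2.star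
  have hh3 : Integrable (fun x => starRingEnd ℂ (discreteDiff F γ x) *
      hopFun (fun x => a (-x)) w x) (intensity d z) := hc2.integrable_mul hm2
  have l2 : ∫ x, starRingEnd ℂ (F (γ.insertPt x)) *
      (hopFun (fun x => a (-x)) w x * bogoliubov w γ) ∂intensity d z =
      bogoliubov w γ * ∫ x, starRingEnd ℂ (discreteDiff F γ x) *
        hopFun (fun x => a (-x)) w x ∂intensity d z := by
    have : ∀ x, starRingEnd ℂ (F (γ.insertPt x)) * (hopFun (fun x => a (-x)) w x * bogoliubov w γ) =
        bogoliubov w γ * (starRingEnd ℂ (F γ) * hopFun (fun x => a (-x)) w x +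
          starRingEnd ℂ (discreteDiff F γ x) * hopFun (fun x => a (-x)) w x) := fun x => by
      rw [discreteDiff, map_sub]; ring
    simp only [this]
    rw [integral_const_mul, integral_add ((memLp_one_iff_integrable.1 hm1).const_mul _) hh3,
      integral_const_mul, ha.neg.integral_hopFun hi1, mul_zero, zero_add]
  simp only
  rw [l1, l2, map_mul, ha.integral_conj_mul_hopFun hg2 h2, ← integral_conj]
  congr 1
  exact integral_congr_ae (ae_of_all _ fun x => by simp [mul_comm])

end IsCylinderBounded

end

end FreeKawasaki

/-! ### Admissible configurations, and cylinder functions in the domain -/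

namespace FreeKawasaki

open Config ProbabilityTheory

section

variable {d : ℕ} {z : ℝ≥0} {a : E d → ℝ} {π : Measure (Config d)}
  [NullSingletonClass (intensity d z)]

namespace IsPoissonMeasure

/-- By the Mecke identity the expectation of the integral over a ball is `z (∫ a)` times the volume
of the ball; countably many balls suffice. -/
theorem ae_mem_admissible (hπ : IsPoissonMeasure (intensity d z) π) (ha : IsJumpKernel a) :
    ∀ᵐ γ ∂π, γ ∈ admissible a := by
  have := hπ.isProbability
  have hm2 : Measurable fun p : E d × E d => ENNReal.ofReal (a (p.1 - p.2)) :=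
    measurable_jumpDensity ha.measurable
  have hK : ∀ n : ℕ, ∀ᵐ γ ∂π,
      ∫⁻ y in Metric.closedBall 0 n, ∑' x : γ.carrier, ENNReal.ofReal (a (x - y)) < ⊤ := fun n => by
    have hm : Measurable fun x : E d => ∫⁻ y in Metric.closedBall 0 n, ENNReal.ofReal (a (x - y)) :=
      hm2.lintegral_prod_right'
    have hsum : ∀ γ : Config d,
        ∫⁻ y in Metric.closedBall 0 n, ∑' x : γ.carrier, ENNReal.ofReal (a (x - y)) =
          ∑' x : γ.carrier, ∫⁻ y in Metric.closedBall 0 n, ENNReal.ofReal (a (x - y)) := fun γ => by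
      have : Countable γ.carrier := γ.countable_carrier.to_subtype
      exact MeasureTheory.lintegral_tsum fun x => (hm2.comp measurable_prodMk_left).aemeasurable
    have hint : ∫⁻ x, (∫⁻ y in Metric.closedBall 0 n, ENNReal.ofReal (a (x - y))) ∂intensity d z
        < ⊤ := by
      rw [lintegral_intensity, lintegral_lintegral_swap hm2.aemeasurable]
      have h1 : ∀ y, ∫⁻ x, ENNReal.ofReal (a (x - y)) = ENNReal.ofReal (∫ x, a x) := fun y => by
        rw [lintegral_sub_right_eq_self (fun x => ENNReal.ofReal (a x)) y, ha.lintegral_ofReal_eq]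
      simp only [h1, lintegral_const, Measure.restrict_apply_univ]
      exact ENNReal.mul_lt_top ENNReal.coe_lt_top (ENNReal.mul_lt_top ENNReal.ofReal_lt_top
        (isCompact_closedBall 0 (n : ℝ)).measure_lt_top)
    have h2 := hπ.lintegral_tsum
      (h := fun _ x => ∫⁻ y in Metric.closedBall 0 n, ENNReal.ofReal (a (x - y)))
      (hm.comp measurable_snd)
    simp only [hsum]
    refine ae_lt_top' ?_ ?_
    · have hm3 := (Measure.measurable_lintegral hm).comp measurable_counting
      refine AEMeasurable.congr hm3.aemeasurable (ae_of_all _ fun γ => ?_)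
      exact lintegral_counting γ _
    · rw [h2, lintegral_const, measure_univ, mul_one]
      exact hint.ne
  filter_upwards [ae_all_iff.2 hK] with γ hγ K hcK
  obtain ⟨r, hr⟩ := hcK.isBounded.subset_closedBall 0
  obtain ⟨n, hn⟩ := exists_nat_ge r
  exact (lintegral_mono_set (hr.trans (Metric.closedBall_subset_closedBall hn))).trans_lt (hγ n)

theorem expState_coe (hπ : IsPoissonMeasure (intensity d z) π)
    (f : {f : OneParticle d z // MemLp f 1 (intensity d z)}) :
    hπ.expState f =ᵐ[π] coherent z f.1 := by
  filter_upwards [Lp.coeFn_smul (Complex.exp (-∫ x, f.1 x ∂intensity d z))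
    (hπ.bogoliubovLp f.2 (Lp.memLp f.1)), hπ.bogoliubovLp_coe f.2 (Lp.memLp f.1)] with γ h1 h2
  rw [expState, h1, Pi.smul_apply, h2, smul_eq_mul, coherent]

variable {hπ : IsPoissonMeasure (intensity d z) π} {ha : IsJumpKernel a}
  {S S' : ℝ → Lp ℂ 2 π →L[ℂ] Lp ℂ 2 π} [NullSingletonClass (volume : Measure (E d))]

/-- In `⟨e(g), S_t f⟩ = ⟨S'_t e(g), f⟩` the time derivative falls on an exponential vector, where
the generator of the adjoint semigroup `S'` is known. The duality identity returns it to `kawasaki a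
F`. -/
theorem IsHopSemigroup.mem_graph_of_isCylinderBounded (hS : hπ.IsHopSemigroup ha S)
    (hS' : hπ.IsHopSemigroup ha.neg S') {F : Config d → ℂ} {Λ : Set (E d)} {c C : ℝ}
    (hF : IsCylinderBounded F Λ c C) {f h : Lp ℂ 2 π} (hf : f =ᵐ[π] F)
    (hh : h =ᵐ[π] kawasaki a F) : (f, h) ∈ generatorGraph S := by
  have key : ∀ k H, (hπ.expState k, H) ∈ generatorGraph S' →
      inner ℂ H f = inner ℂ (hπ.expState k) h := fun k H hH => by
    obtain ⟨H', hH1, hH2⟩ := hS'.exists_mem_graph_expState k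
    rw [generatorGraph_snd_eq hH hH1, inner_toLp hH2 hf, inner_toLp (hπ.expState_coe k) hh]
    simp only [coherent, map_mul, mul_assoc, integral_const_mul]
    rw [hF.integral_conj_bogoliubov_mul_kawasaki hπ ha k.2 (Lp.memLp k.1)]
  have hc' := hS'.isContractionSemigroup
  refine hS.isContractionSemigroup.mem_graph_of_weak hπ.isTotal_expState fun g t ht => ?_
  obtain ⟨H, hH, -⟩ := hS'.exists_mem_graph_expState g
  have h1 := (hc'.hasDerivWithinAt hH ht).inner ℂ (hasDerivWithinAt_const t (Ioi t) f)
  have h2 := hc'.mem_graph_apply hH ht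
  rw [hS'.apply ht] at h2
  rw [inner_zero_right, zero_add, key _ _ h2, ← hS.inner_apply ht] at h1
  refine h1.congr (fun r hr => ?_) ?_
  · rw [hS.inner_apply (ht.trans (le_of_lt hr)), hS'.apply]
  · rw [hS.inner_apply ht, hS'.apply ht]

end IsPoissonMeasure

end

end FreeKawasaki

namespace FreeKawasaki

open Config ProbabilityTheory

/-! ### The Markov property -/

section RePos

variable {Ω : Type*} [MeasurableSpace Ω] {μ : Measure Ω}

/-- The positive part of the real part. -/
def rePos (w : ℂ) : ℂ := ((max w.re 0 : ℝ) : ℂ)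

theorem lipschitzWith_rePos : LipschitzWith 1 rePos := by
  refine LipschitzWith.of_dist_le_mul fun v w => ?_
  rw [NNReal.coe_one, one_mul, Complex.dist_eq, Complex.dist_eq, rePos, rePos,
    ← Complex.ofReal_sub, Complex.norm_real]
  refine (abs_max_sub_max_le_abs _ _ _).trans ?_
  rw [← Complex.sub_re]
  exact Complex.abs_re_le_norm _

theorem rePos_zero : rePos 0 = 0 := by simp [rePos]

/-- The positive part of the real part, on `L²`. -/
def rePosLp (f : Lp ℂ 2 μ) : Lp ℂ 2 μ := lipschitzWith_rePos.compLp rePos_zero f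

theorem rePosLp_coe (f : Lp ℂ 2 μ) : rePosLp f =ᵐ[μ] fun x => rePos (f x) :=
  lipschitzWith_rePos.coeFn_compLp rePos_zero f

theorem continuous_rePosLp : Continuous (rePosLp : Lp ℂ 2 μ → Lp ℂ 2 μ) :=
  lipschitzWith_rePos.continuous_compLp rePos_zero

theorem integrable_inner_and_re_inner_eq (f g : Lp ℂ 2 μ) :
    Integrable (fun x => (starRingEnd ℂ (f x) * g x).re) μ ∧
    (inner ℂ f g).re = ∫ x, (starRingEnd ℂ (f x) * g x).re ∂μ := by
  have hf : MemLp (fun x => starRingEnd ℂ (f x)) 2 μ := (Lp.memLp f).star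
  have h : Integrable (fun x => starRingEnd ℂ (f x) * g x) μ := hf.integrable_mul (Lp.memLp g)
  refine ⟨h.re, ?_⟩
  rw [IsPoissonMeasure.inner_toLp (ae_eq_refl f) (ae_eq_refl g)]
  exact (integral_re h).symm

/-- Pointwise convexity of `t ↦ (t⁺)²`, integrated. -/
theorem norm_rePosLp_sq_sub_le (f g : Lp ℂ 2 μ) :
    ‖rePosLp f‖ ^ 2 - ‖rePosLp g‖ ^ 2 ≤ 2 * (inner ℂ (rePosLp f) (f - g)).re := by
  have e : ∀ h : Lp ℂ 2 μ, ‖h‖ ^ 2 = (inner ℂ h h).re := fun h => by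
    rw [inner_self_eq_ofReal, Complex.ofReal_re]
  have h1 := integrable_inner_and_re_inner_eq (rePosLp f) (rePosLp f)
  have h2 := integrable_inner_and_re_inner_eq (rePosLp g) (rePosLp g)
  have h3 := integrable_inner_and_re_inner_eq (rePosLp f) (f - g)
  rw [e, e, h1.2, h2.2, h3.2, ← integral_const_mul, ← integral_sub h1.1 h2.1]
  refine integral_mono_ae (h1.1.sub h2.1) (h3.1.const_mul 2) ?_
  filter_upwards [rePosLp_coe f, rePosLp_coe g, Lp.coeFn_sub f g] with x hf hg hs
  rw [hf, hg, hs, Pi.sub_apply]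
  simp only [rePos, Complex.conj_ofReal, Complex.re_ofReal_mul, Complex.ofReal_re, Complex.sub_re]
  rcases max_cases (f x).re 0 with ⟨h, h'⟩ | ⟨h, h'⟩ <;>
    rcases max_cases (g x).re 0 with ⟨k, k'⟩ | ⟨k, k'⟩ <;> rw [h, k] <;>
    nlinarith [sq_nonneg ((f x).re - (g x).re), sq_nonneg (f x).re, sq_nonneg (g x).re]

theorem rePosLp_eq_zero_iff (f : Lp ℂ 2 μ) : rePosLp f = 0 ↔ ∀ᵐ x ∂μ, (f x).re ≤ 0 := by
  rw [Lp.eq_zero_iff_ae_eq_zero]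
  have h : ∀ w : ℂ, rePos w = 0 ↔ w.re ≤ 0 := fun w => by
    rw [rePos, Complex.ofReal_eq_zero, max_eq_right_iff]
  constructor
  · intro h0
    filter_upwards [h0, rePosLp_coe f] with x h1 h2
    exact (h _).1 (h2.symm.trans h1)
  · intro h0
    filter_upwards [h0, rePosLp_coe f] with x h1 h2
    exact h2.trans ((h _).2 h1)

theorem ae_finsupp_sum {ι : Type*} (c : ι →₀ ℂ) {f : ι → Lp ℂ 2 μ} {G : ι → Ω → ℂ}
    (hf : ∀ i, f i =ᵐ[μ] G i) :
    ∀ᵐ x ∂μ, (c.sum fun i r => r • f i : Lp ℂ 2 μ) x = ∑ i : c.support, c i * G i x := by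
  have h1 : ∀ᵐ x ∂μ, ∀ i : c.support, (c i • f i : Lp ℂ 2 μ) x = c i * G i x := by
    refine ae_all_iff.2 fun i => ?_
    filter_upwards [hf i, Lp.coeFn_smul (c i) (f i)] with x h1 h2
    rw [h2, Pi.smul_apply, h1, smul_eq_mul]
  filter_upwards [h1, Lp.coeFn_finsetSum c.support fun i => c i • f i] with x hx hs
  rw [Finsupp.sum, hs, Finset.sum_apply, ← Finset.sum_coe_sort]
  exact Finset.sum_congr rfl fun i _ => hx i

/-- An operator which preserves negativity of the real part and fixes `1` is sub-Markovian. -/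
theorem isUnitValued_apply {T : Lp ℂ 2 μ →L[ℂ] Lp ℂ 2 μ}
    (hT : ∀ f : Lp ℂ 2 μ, (∀ᵐ x ∂μ, (f x).re ≤ 0) → ∀ᵐ x ∂μ, (T f x).re ≤ 0) {e : Lp ℂ 2 μ}
    (he : e =ᵐ[μ] fun _ => 1) (hTe : T e = e) {f : Lp ℂ 2 μ} (hf : IsUnitValued f) :
    IsUnitValued (T f) := by
  have h1 := hT (-f) (by
    filter_upwards [hf, Lp.coeFn_neg f] with x hx hn
    rw [hn, Pi.neg_apply, Complex.neg_re]
    linarith [hx.2.1])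
  have h2 := hT (f - e) (by
    filter_upwards [hf, Lp.coeFn_sub f e, he] with x hx hs hx1
    rw [hs, Pi.sub_apply, hx1, Complex.sub_re, Complex.one_re]
    linarith [hx.2.2])
  -- The multiples `i f` and `-i f` have zero real part; both signs together make the imaginary part
  -- of `T f` vanish.
  have h3 := hT (Complex.I • f) (by
    filter_upwards [hf, Lp.coeFn_smul Complex.I f] with x hx hs
    rw [hs, Pi.smul_apply, smul_eq_mul, Complex.I_mul_re, hx.1, neg_zero])
  have h4 := hT ((-Complex.I) • f) (by
    filter_upwards [hf, Lp.coeFn_smul (-Complex.I) f] with x hx hs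
    rw [hs, Pi.smul_apply, smul_eq_mul, neg_mul, Complex.neg_re, Complex.I_mul_re, hx.1, neg_zero,
      neg_zero])
  rw [map_neg] at h1
  rw [map_sub, hTe] at h2
  rw [map_smul] at h3 h4
  filter_upwards [h1, h2, h3, h4, Lp.coeFn_neg (T f), Lp.coeFn_sub (T f) e,
    Lp.coeFn_smul Complex.I (T f), Lp.coeFn_smul (-Complex.I) (T f), he]
    with x k1 k2 k3 k4 e1 e2 e3 e4 e5
  rw [e1, Pi.neg_apply, Complex.neg_re] at k1
  rw [e2, Pi.sub_apply, e5, Complex.sub_re, Complex.one_re] at k2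
  rw [e3, Pi.smul_apply, smul_eq_mul, Complex.I_mul_re] at k3
  rw [e4, Pi.smul_apply, smul_eq_mul, neg_mul, Complex.neg_re, Complex.I_mul_re] at k4
  exact ⟨by linarith, by linarith, by linarith⟩

end RePos

section

variable {d : ℕ} {z : ℝ≥0} {a : E d → ℝ} {π : Measure (Config d)}

/-- The exceptional null set must not depend on the coefficients, which will later be values of
exponentials at `γ`. -/
theorem IsJumpKernel.ae_hopFun_sum (ha : IsJumpKernel a) {ι : Type*} [Fintype ι]
    (k : ι → OneParticle d z) : ∀ᵐ x ∂intensity d z, ∀ b : ι → ℂ,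
      hopFun a (fun y => ∑ i, b i * k i y) x = ∑ i, b i * hopFun a (k i) x := by
  filter_upwards [ae_all_iff.2 fun i => ha.ae_hopFun_eq (Or.inr rfl) (Lp.memLp (k i))] with x hx b
  have : ∀ y, (a (x - y) : ℂ) * (∑ i, b i * k i y - ∑ i, b i * k i x) =
      ∑ i, b i * ((a (x - y) : ℂ) * (k i y - k i x)) := fun y => by
    rw [← Finset.sum_sub_distrib, Finset.mul_sum]
    exact Finset.sum_congr rfl fun i _ => by ring
  simp only [hopFun, this]
  rw [integral_finsetSum _ fun i _ => (hx i).1.const_mul (b i)]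
  exact Finset.sum_congr rfl fun i _ => integral_const_mul _ _

variable [NullSingletonClass (intensity d z)] [NullSingletonClass (volume : Measure (E d))]

namespace IsPoissonMeasure

variable {hπ : IsPoissonMeasure (intensity d z) π} {ha : IsJumpKernel a}
  {S : ℝ → Lp ℂ 2 π →L[ℂ] Lp ℂ 2 π}

/-- For frozen `γ` the sum of exponentials at `γ ∪ x` is `c + f(x)`, with `c` its value at `γ` and
`f` a combination of the `k i`. After the Mecke identity the inner integral is the one-particle
dispersivity inequality for this `c` and `f`. -/
theorem re_inner_rePosLp_nonpos_aux (hπ : IsPoissonMeasure (intensity d z) π) (ha : IsJumpKernel a)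
    {ι : Type*} [Fintype ι] (b : ι → ℂ) (k : ι → OneParticle d z)
    (hk : ∀ i, MemLp (k i) 1 (intensity d z)) {F : Config d → ℂ} (hF : MemLp F 2 π)
    (hFu : ∀ᵐ γ ∂π, F γ = rePos (∑ i, b i * bogoliubov (k i) γ)) :
    (∫ γ, starRingEnd ℂ (F γ) * ∑ i, b i * bogoliubovDeriv (k i) (hopFun a (k i)) γ ∂π).re ≤ 0 := by
  have := hπ.isProbability
  have hk2 : ∀ i, MemLp (k i) 2 (intensity d z) := fun i => Lp.memLp (k i)
  have hh1 : ∀ i, MemLp (hopFun a (k i)) 1 (intensity d z) := fun i =>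
    ha.memLp_hopFun (Or.inl rfl) (hk i)
  have hh2 : ∀ i, MemLp (hopFun a (k i)) 2 (intensity d z) := fun i =>
    ha.memLp_hopFun (Or.inr rfl) (hk2 i)
  have hFs : MemLp (fun γ => starRingEnd ℂ (F γ)) 2 π := hF.star
  have hd := fun i => hπ.integral_conj_mul_bogoliubovDeriv (hk i) (hk2 i) (hh1 i) (hh2 i) hF
  have e1 : ∫ γ, starRingEnd ℂ (F γ) * ∑ i, b i * bogoliubovDeriv (k i) (hopFun a (k i)) γ ∂π =
      ∫ p, (∑ i, b i * (starRingEnd ℂ (F (p.1.insertPt p.2)) *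
        (hopFun a (k i) p.2 * bogoliubov (k i) p.1))) ∂π.prod (intensity d z) := by
    rw [integral_finsetSum _ fun i _ => (hd i).1.const_mul (b i)]
    have h : ∀ γ, starRingEnd ℂ (F γ) * ∑ i, b i * bogoliubovDeriv (k i) (hopFun a (k i)) γ =
        ∑ i, b i * (starRingEnd ℂ (F γ) * bogoliubovDeriv (k i) (hopFun a (k i)) γ) := fun γ => by
      rw [Finset.mul_sum]
      exact Finset.sum_congr rfl fun i _ => by ring
    simp only [h]
    rw [integral_finsetSum]
    · exact Finset.sum_congr rfl fun i _ => by rw [integral_const_mul, integral_const_mul, (hd i).2]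
    · exact fun i _ => Integrable.const_mul (hFs.integrable_mul
        (hπ.memLp_bogoliubovDeriv (hk i) (hk2 i) (hh1 i) (hh2 i))) (b i)
  have hint : Integrable (fun p : Config d × E d => ∑ i, b i *
      (starRingEnd ℂ (F (p.1.insertPt p.2)) * (hopFun a (k i) p.2 * bogoliubov (k i) p.1)))
      (π.prod (intensity d z)) := integrable_finsetSum _ fun i _ => (hd i).1.const_mul (b i)
  rw [e1, ← RCLike.re_eq_complex_re, ← integral_re hint, integral_prod _ hint.re]
  refine integral_nonpos_of_ae ?_
  have hae : ∀ᵐ p ∂π.prod (intensity d z), F (p.1.insertPt p.2) =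
      rePos (∑ i, b i * bogoliubov (k i) p.1 + ∑ i, (b i * bogoliubov (k i) p.1) * k i p.2) := by
    filter_upwards [hπ.quasiMeasurePreserving_insertPt.ae hFu,
      ae_all_iff.2 fun i => hπ.ae_bogoliubov_insertPt (memLp_one_iff_integrable.1 (hk i))] with p h1 h2
    rw [h1, ← Finset.sum_add_distrib]
    congr 1
    exact Finset.sum_congr rfl fun i _ => by rw [h2]; ring
  filter_upwards [Measure.ae_ae_of_ae_prod hae] with γ hγ
  have hf1 : MemLp (fun x => ∑ i, (b i * bogoliubov (k i) γ) * k i x) 1 (intensity d z) :=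
    memLp_finsetSum Finset.univ fun i _ => (hk i).const_mul _
  have hf2 : MemLp (fun x => ∑ i, (b i * bogoliubov (k i) γ) * k i x) 2 (intensity d z) :=
    memLp_finsetSum Finset.univ fun i _ => (hk2 i).const_mul _
  refine le_trans (le_of_eq ?_) (ha.integral_hopFun_mul_posPart_le hf1 hf2
    (∑ i, b i * bogoliubov (k i) γ))
  refine integral_congr_ae ?_
  filter_upwards [hγ, ha.ae_hopFun_sum k] with x hx hs
  rw [hs, hx, RCLike.re_eq_complex_re]
  have : ∀ w v : ℂ, w.re * max v.re 0 = (starRingEnd ℂ (rePos v) * w).re := fun w v => by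
    rw [rePos, Complex.conj_ofReal, Complex.re_ofReal_mul, mul_comm]
  rw [this, Finset.mul_sum]
  congr 1
  exact Finset.sum_congr rfl fun i _ => by ring

theorem IsHopSemigroup.re_inner_rePosLp_nonpos (hS : hπ.IsHopSemigroup ha S) (u g : Lp ℂ 2 π)
    (hu : u ∈ coherentSpan z π) (hg : (u, g) ∈ generatorGraph S) :
    (inner ℂ (rePosLp u) g).re ≤ 0 := by
  rw [hπ.coherentSpan_eq, Finsupp.mem_span_range_iff_exists_finsupp] at hu
  obtain ⟨c, hc⟩ := hu
  choose H hH hH' using fun f => hS.exists_mem_graph_expState f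
  have hg' : g = c.sum fun f r => r • H f := by
    refine generatorGraph_snd_eq hg ?_
    have : (u, c.sum fun f r => r • H f) = c.sum fun f r => r • (hπ.expState f, H f) := by
      rw [← hc]
      simp only [Finsupp.sum, Prod.smul_mk]
      exact Prod.ext (by rw [Prod.fst_sum]) (by rw [Prod.snd_sum])
    rw [this]
    exact Submodule.sum_mem _ fun f _ => Submodule.smul_mem _ _ (hH f)
  set b : c.support → ℂ := fun i => c i * Complex.exp (-∫ x, i.1.1 x ∂intensity d z) with hb
  have hu' : ∀ᵐ γ ∂π, u γ = ∑ i, b i * bogoliubov i.1.1 γ := by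
    rw [← hc]
    filter_upwards [ae_finsupp_sum c hπ.expState_coe] with γ hγ
    rw [hγ]
    exact Finset.sum_congr rfl fun i _ => (mul_assoc _ _ _).symm
  have hg2 : ∀ᵐ γ ∂π, g γ = ∑ i, b i * bogoliubovDeriv i.1.1 (hopFun a i.1.1) γ := by
    rw [hg']
    filter_upwards [ae_finsupp_sum c hH'] with γ hγ
    rw [hγ]
    exact Finset.sum_congr rfl fun i _ => (mul_assoc _ _ _).symm
  have h0 := hπ.re_inner_rePosLp_nonpos_aux ha b (fun i => i.1.1) (fun i => i.1.2)
    (Lp.memLp (rePosLp u)) (by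
      filter_upwards [rePosLp_coe u, hu'] with γ h1 h2
      rw [h1, h2])
  rw [inner_toLp (ae_eq_refl (rePosLp u)) hg2]
  exact h0

/-- The norm of the positive part decreases along the semigroup, so it stays zero. -/
theorem IsHopSemigroup.ae_re_apply_nonpos (hS : hπ.IsHopSemigroup ha S) {t : ℝ} (ht : 0 ≤ t)
    (f : Lp ℂ 2 π) (hf : ∀ᵐ γ ∂π, (f γ).re ≤ 0) : ∀ᵐ γ ∂π, (S t f γ).re ≤ 0 := by
  rw [← rePosLp_eq_zero_iff] at hf ⊢
  have h := hS.isContractionSemigroup.norm_comp_apply_le hπ.dense_coherentSpan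
    hS.apply_mem_coherentSpan (fun u hu => (hS.exists_mem_graph u hu).imp fun _ h => h.1)
    continuous_rePosLp norm_rePosLp_sq_sub_le hS.re_inner_rePosLp_nonpos ht f
  rw [hf, norm_zero] at h
  exact norm_le_zero_iff.1 h

theorem IsHopSemigroup.isMarkovSemigroup (hS : hπ.IsHopSemigroup ha S) : IsMarkovSemigroup S := by
  set k : {f : OneParticle d z // MemLp f 1 (intensity d z)} :=
    ⟨0, MemLp.zero.ae_eq (Lp.coeFn_zero ℂ 2 _).symm⟩ with hk
  have he : hπ.expState k =ᵐ[π] fun _ => 1 := by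
    have h0 : (k.1 : E d → ℂ) =ᵐ[intensity d z] fun _ => 0 := Lp.coeFn_zero ℂ 2 _
    filter_upwards [hπ.expState_coe k, hπ.bogoliubov_ae_congr h0] with γ h1 h2
    rw [h1, coherent, h2, bogoliubov_zero, integral_congr_ae h0]
    simp
  have hSe : ∀ t, 0 ≤ t → S t (hπ.expState k) = hπ.expState k := fun t ht => by
    rw [hS.apply ht]
    congr 1
    exact Subtype.ext (map_zero _)
  -- The constant `1 = e(0)` lies in `L²(π)` and is fixed by `S`, so the constant sequence serves
  -- for conservativity.
  have hone : IncreasesToOne fun _ : ℕ => hπ.expState k := by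
    filter_upwards [he] with γ hγ
    simp only [hγ]
    exact ⟨fun _ => rfl, monotone_const, tendsto_const_nhds⟩
  refine { toIsContractionSemigroup := hS.isContractionSemigroup
           subMarkov := fun t ht f hf =>
             isUnitValued_apply (hS.ae_re_apply_nonpos ht) he (hSe t ht) hf
           conservative := ⟨_, hone, fun t ht => ?_⟩ }
  simp only [hSe t ht]
  exact hone

end IsPoissonMeasure

end

end FreeKawasaki

namespace FreeKawasaki

open Config ProbabilityTheory

/-! ### Charlier polynomials and chaos components -/

/-- The identity is required only at the points `1 / (k + 1)`: countably many, so that one null set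
suffices in the application, yet accumulating at `0`, so that the identity theorem applies. -/
theorem iteratedDeriv_eq_of_eq_tsum {h : ℂ → ℂ} (hd : Differentiable ℂ h) {w : ℕ → ℂ}
    (hw : Summable fun n => ‖w n‖)
    (he : ∀ k : ℕ, h ((k : ℂ) + 1)⁻¹ = ∑' n, ((k : ℂ) + 1)⁻¹ ^ n * w n) (n : ℕ) :
    iteratedDeriv n h 0 = n.factorial * w n := by
  let p : FormalMultilinearSeries ℂ ℂ ℂ := fun n => ContinuousMultilinearMap.mkPiRing ℂ (Fin n) (w n)
  have hp : ∀ n, p.coeff n = w n := fun n => by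
    simp [p, FormalMultilinearSeries.coeff]
  have hg : HasFPowerSeriesAt (fun s : ℂ => ∑' n, s ^ n * w n) p 0 := by
    rw [hasFPowerSeriesAt_iff]
    filter_upwards [Metric.ball_mem_nhds (0 : ℂ) one_pos] with s hs
    rw [mem_ball_zero_iff] at hs
    simp only [hp, zero_add, smul_eq_mul]
    refine (Summable.of_norm_bounded hw fun n => ?_).hasSum
    rw [norm_mul, norm_pow]
    exact mul_le_of_le_one_left (norm_nonneg _) (pow_le_one₀ (norm_nonneg _) hs.le)
  have hfr : ∃ᶠ s in 𝓝[≠] (0 : ℂ), h s = ∑' n, s ^ n * w n := by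
    have hlim : Tendsto (fun k : ℕ => ((k : ℂ) + 1)⁻¹) atTop (𝓝[≠] 0) := by
      refine tendsto_nhdsWithin_iff.2 ⟨?_, Eventually.of_forall fun k => ?_⟩
      · have := (tendsto_one_div_add_atTop_nhds_zero_nat (𝕜 := ℝ))
        have h2 := (Complex.continuous_ofReal.tendsto 0).comp this
        refine (h2.congr fun k => ?_)
        simp
      · exact inv_ne_zero (Nat.cast_add_one_ne_zero k)
    exact hlim.frequently (Frequently.of_forall he)
  have heq := ((hd.analyticAt 0).frequently_eq_iff_eventually_eq hg.analyticAt).1 hfr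
  obtain ⟨r, hr⟩ := hg.congr (EventuallyEq.symm heq)
  rw [iteratedDeriv_eq_iteratedFDeriv, ← hr.factorial_smul 1 n, nsmul_eq_mul]
  congr 1
  exact hp n

section

variable {Ω : Type*} [MeasurableSpace Ω] {μ : Measure Ω} [IsProbabilityMeasure μ]

theorem ae_summable_norm_of_summable {w : ℕ → Lp ℂ 2 μ} (hw : Summable fun n => ‖w n‖) :
    ∀ᵐ x ∂μ, Summable fun n => ‖w n x‖ := by
  have h1 : ∫⁻ x, ∑' n, ‖w n x‖ₑ ∂μ ≠ ⊤ := by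
    rw [lintegral_tsum fun n => (Lp.aestronglyMeasurable (w n)).enorm]
    have h2 : ∑' n, ENNReal.ofReal ‖w n‖ ≠ ⊤ := by
      rw [← ENNReal.ofReal_tsum_of_nonneg (fun n => norm_nonneg _) hw]
      exact ENNReal.ofReal_ne_top
    refine ne_top_of_le_ne_top h2 (ENNReal.tsum_le_tsum fun n => ?_)
    rw [Lp.norm_def, ENNReal.ofReal_toReal (Lp.eLpNorm_ne_top _), ← eLpNorm_one_eq_lintegral_enorm]
    exact eLpNorm_le_eLpNorm_of_exponent_le (by norm_num) (Lp.aestronglyMeasurable _)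
  have hm : AEMeasurable (fun x => ∑' n, ‖w n x‖ₑ) μ :=
    AEMeasurable.tsum fun n => (Lp.aestronglyMeasurable (w n)).enorm
  filter_upwards [ae_lt_top' hm h1] with x hx
  exact (ENNReal.summable_toReal hx.ne).congr fun n => by simp

theorem ae_eq_tsum_of_hasSum {v : ℕ → Lp ℂ 2 μ} (hv : ∀ᵐ x ∂μ, Summable fun n => ‖v n x‖)
    {V : Lp ℂ 2 μ} (hV : HasSum v V) : ∀ᵐ x ∂μ, V x = ∑' n, v n x := by
  have h1 : TendstoInMeasure μ (fun N => ((∑ n ∈ Finset.range N, v n : Lp ℂ 2 μ) : Ω → ℂ)) atTop V :=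
    tendstoInMeasure_of_tendsto_Lp hV.tendsto_sum_nat
  obtain ⟨ns, hns, hlim⟩ := h1.exists_seq_tendsto_ae
  filter_upwards [hlim, hv, ae_all_iff.2 fun N => Lp.coeFn_finsetSum (Finset.range N) v]
    with x hx hs hN
  refine tendsto_nhds_unique hx ?_
  refine (hs.of_norm.hasSum.tendsto_sum_nat.comp hns.tendsto_atTop).congr fun k => ?_
  rw [hN, Finset.sum_apply]
  rfl

end

section

variable {d : ℕ} {z : ℝ≥0} {π : Measure (Config d)}

theorem differentiable_coherent {φ : E d → ℂ} (hc : HasCompactSupport φ) (γ : Config d) :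
    Differentiable ℂ fun s : ℂ => coherent z (fun x => s * φ x) γ := by
  unfold coherent
  simp only [integral_const_mul]
  refine Differentiable.mul (by fun_prop) fun s => ?_
  exact (hasDerivAt_bogoliubov hc γ s).differentiableAt

/-- Convergence at the point `2` bounds the terms there, hence `‖w n‖` by a constant times `2⁻ⁿ`. -/
theorem summable_norm_of_hasSum {X : Type*} [NormedAddCommGroup X] [NormedSpace ℂ X] {w : ℕ → X}
    {W : X} (h : HasSum (fun n => (2 : ℂ) ^ n • w n) W) : Summable fun n => ‖w n‖ := by
  obtain ⟨M, hM⟩ := (h.summable.tendsto_atTop_zero.norm).bddAbove_range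
  refine Summable.of_nonneg_of_le (fun n => norm_nonneg _) (fun n => ?_)
    ((summable_geometric_of_lt_one (by norm_num) (by norm_num : (1 / 2 : ℝ) < 1)).mul_left M)
  have h1 : ‖(2 : ℂ) ^ n • w n‖ ≤ M := hM ⟨n, rfl⟩
  rw [norm_smul, norm_pow, Complex.norm_two] at h1
  rw [one_div, inv_pow, ← div_eq_mul_inv, le_div_iff₀ (by positivity)]
  linarith

variable [NullSingletonClass (intensity d z)]

/-- The expansion of `e(sφ)` in powers of `s` holds in `L²(π)` with coefficients transported from
Fock space, while for fixed `γ` the function `s ↦ e(sφ)(γ)` is entire. Almost sure absolute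
summability of the coefficients identifies the two Taylor series off one null set. -/
theorem IsPoissonMeasure.isPoissonFockIso (hπ : IsPoissonMeasure (intensity d z) π)
    {I : Lp ℂ 2 π ≃ₗᵢ[ℂ] Fock d z} (hI : ∀ f, I (hπ.expState f) = expVector f.1) :
    IsPoissonFockIso π I := by
  have := hπ.isProbability
  intro φ hφ hc n
  set f : OneParticle d z := testLp z φ hφ.continuous hc
  have hfφ : f =ᵐ[intensity d z] φ := MemLp.coeFn_toLp _
  have hf1 : MemLp f 1 (intensity d z) := (hφ.continuous.memLp_of_hasCompactSupport hc).ae_eq hfφ.symm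
  have hs1 : ∀ s : ℂ, MemLp (s • f : OneParticle d z) 1 (intensity d z) := fun s =>
    (hf1.const_smul s).ae_eq (Lp.coeFn_smul s f).symm
  set w : ℕ → Lp ℂ 2 π := fun n => I.symm (((n.factorial : ℂ)⁻¹) • lp.single 2 n (diagTensor n f))
  have hsum : ∀ s : ℂ, HasSum (fun n => s ^ n • w n) (hπ.expState ⟨s • f, hs1 s⟩) := fun s => by
    have h := (hasSum_expVector f s).mapL (I.symm.toContinuousLinearEquiv : Fock d z →L[ℂ] Lp ℂ 2 π)
    have e : (I.symm.toContinuousLinearEquiv : Fock d z →L[ℂ] Lp ℂ 2 π) (expVector (s • f)) =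
        hπ.expState ⟨s • f, hs1 s⟩ := by
      rw [← hI ⟨s • f, hs1 s⟩]
      exact I.symm_apply_apply _
    rw [e] at h
    exact h.congr_fun fun n => (I.symm.map_smul _ _).symm
  have hexp : ∀ s : ℂ, hπ.expState ⟨s • f, hs1 s⟩ =ᵐ[π] coherent z fun x => s * φ x := fun s => by
    have h1 : ((s • f : OneParticle d z) : E d → ℂ) =ᵐ[intensity d z] fun x => s * φ x := by
      filter_upwards [Lp.coeFn_smul s f, hfφ] with x h1 h2
      rw [h1, Pi.smul_apply, h2, smul_eq_mul]
    filter_upwards [hπ.expState_coe ⟨s • f, hs1 s⟩, hπ.bogoliubov_ae_congr h1] with γ h2 h3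
    rw [h2, coherent, coherent, h3, integral_congr_ae h1]
  have hw := summable_norm_of_hasSum (hsum 2)
  have hae := ae_summable_norm_of_summable hw
  have hk : ∀ᵐ γ ∂π, ∀ k : ℕ, coherent z (fun x => ((k : ℂ) + 1)⁻¹ * φ x) γ =
      ∑' n, ((k : ℂ) + 1)⁻¹ ^ n * w n γ := by
    refine ae_all_iff.2 fun k => ?_
    have hsm : ∀ᵐ γ ∂π, ∀ n, (((k : ℂ) + 1)⁻¹ ^ n • w n : Lp ℂ 2 π) γ =
        ((k : ℂ) + 1)⁻¹ ^ n * w n γ := ae_all_iff.2 fun n => Lp.coeFn_smul _ (w n)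
    have hs2 : ∀ᵐ γ ∂π, Summable fun n => ‖(((k : ℂ) + 1)⁻¹ ^ n • w n : Lp ℂ 2 π) γ‖ := by
      filter_upwards [hae, hsm] with γ h1 h2
      refine h1.of_nonneg_of_le (fun n => norm_nonneg _) fun n => ?_
      rw [h2, norm_mul, norm_pow]
      refine mul_le_of_le_one_left (norm_nonneg _) (pow_le_one₀ (norm_nonneg _) ?_)
      rw [norm_inv, ← Nat.cast_succ, Complex.norm_natCast]
      exact inv_le_one_of_one_le₀ (by exact_mod_cast Nat.succ_pos k)
    filter_upwards [hexp ((k : ℂ) + 1)⁻¹, ae_eq_tsum_of_hasSum hs2 (hsum _), hsm] with γ h1 h2 h3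
    rw [← h1, h2]
    exact tsum_congr h3
  have hn : (n.factorial : ℂ) ≠ 0 := Nat.cast_ne_zero.2 n.factorial_ne_zero
  have e : I.symm (lp.single 2 n (symTensor fun _ : Fin n => f)) = (n.factorial : ℂ) • w n := by
    simp only [w]
    rw [map_smul, smul_inv_smul₀ hn]
    rfl
  rw [e]
  filter_upwards [hae, hk, Lp.coeFn_smul (n.factorial : ℂ) (w n)] with γ h1 h2 h3
  rw [h3, Pi.smul_apply, smul_eq_mul, charlier]
  exact (iteratedDeriv_eq_of_eq_tsum (differentiable_coherent hc γ) h1 h2 n).symm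

end

end FreeKawasaki

namespace FreeKawasaki

open Config ProbabilityTheory

/-! ### Integrable jump rates -/

section

variable {d : ℕ} {z : ℝ≥0} {a b : E d → ℝ}

/-- The rate `a` is only almost everywhere equal to a measurable function. The objects built from it
do not change under modification on a null set, so a measurable nonnegative version may be used. -/
theorem exists_isJumpKernel_ae_eq (h0 : ∀ x, 0 ≤ a x) (ha : Integrable a) :
    ∃ b : E d → ℝ, IsJumpKernel b ∧ a =ᵐ[volume] b := by
  have hae : a =ᵐ[volume] fun x => max (ha.1.mk a x) 0 := by
    filter_upwards [ha.1.ae_eq_mk] with x hx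
    rw [← hx, max_eq_left (h0 x)]
  exact ⟨_, ⟨ha.1.stronglyMeasurable_mk.measurable.max measurable_const,
    fun x => le_max_right _ _, ha.congr hae⟩, hae⟩

theorem ae_eq_sub_left (h : a =ᵐ[volume] b) (x : E d) : ∀ᵐ y, a (x - y) = b (x - y) :=
  (Measure.measurePreserving_sub_left volume x).quasiMeasurePreserving.ae h

theorem jumpTerm_ae_congr (h : a =ᵐ[volume] b) (F : Config d → ℂ) (γ : Config d) (x : E d) :
    jumpTerm a F γ x =ᵐ[volume] jumpTerm b F γ x :=
  (ae_eq_sub_left h x).mono fun y hy => by rw [jumpTerm, jumpTerm, hy]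

theorem admissible_congr (h : a =ᵐ[volume] b) : admissible a = admissible b := by
  ext γ
  have : Countable γ.carrier := γ.countable_carrier.to_subtype
  have hae : (fun y => ∑' x : γ.carrier, ENNReal.ofReal (a (x - y))) =ᵐ[volume]
      fun y => ∑' x : γ.carrier, ENNReal.ofReal (b (x - y)) :=
    (ae_all_iff.2 fun x : γ.carrier => ae_eq_sub_left h x).mono fun y hy =>
      tsum_congr fun x => by rw [hy x]
  refine forall₂_congr fun K _ => ?_
  rw [lintegral_congr_ae (ae_restrict_of_ae hae)]

theorem IsOneParticleOperator.congr {A : OneParticle d z →L[ℂ] OneParticle d z}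
    (hA : IsOneParticleOperator b A) (h : a =ᵐ[volume] b) : IsOneParticleOperator a A := fun f => by
  filter_upwards [hA f] with x hx
  have hae : (fun y => (a (x - y) : ℂ) * (f y - f x)) =ᵐ[volume]
      fun y => (b (x - y) : ℂ) * (f y - f x) :=
    (ae_eq_sub_left h x).mono fun y hy => by simp only [hy]
  exact ⟨(integrable_congr hae).2 hx.1, hx.2.trans (integral_congr_ae hae).symm⟩

end

end FreeKawasaki

end

theorem mainTheorem9 (d : ℕ) (hd : 0 < d) (a : E d → ℝ) (ha_nonneg : ∀ x, 0 ≤ a x)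
    (ha : Integrable a) (z : ℝ≥0) (π : Measure (Config d))
    (hπ : IsPoissonMeasure (intensity d z) π) :
    -- the Bogoliubov exponentials are well defined elements of `L²(π_z)`
    (∀ φ : E d → ℂ, MemLp φ 1 (intensity d z) → MemLp φ 2 (intensity d z) →
      (∀ᵐ γ ∂π, Summable fun x : γ.carrier => φ x) ∧ MemLp (bogoliubov φ) 2 π) ∧
    -- `Γ_a` has full measure, and `L` is well defined on cylinder exponentially bounded functions
    (∀ᵐ γ ∂π, γ ∈ admissible a) ∧
    (∀ F : Config d → ℂ, IsCylinderExpBounded F → ∀ γ ∈ admissible a, KawasakiConverges a F γ) ∧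
    -- `L` is the operator with domain the span of the Bogoliubov exponentials
    ∃ L : Lp ℂ 2 π →ₗ.[ℂ] Lp ℂ 2 π,
      L.domain = coherentSpan z π ∧
      (∀ (F : L.domain) (G : Config d → ℂ), (F : Lp ℂ 2 π) =ᵐ[π] G →
        ∀ᵐ γ ∂π, KawasakiConverges a G γ ∧ L F γ = kawasaki a G γ) ∧
      L.IsClosable ∧
      -- its closure extends `L` on cylinder exponentially bounded functions
      (∀ F : Config d → ℂ, IsCylinderExpBounded F →
        ∃ f : L.closure.domain, (f : Lp ℂ 2 π) =ᵐ[π] F ∧ L.closure f =ᵐ[π] kawasaki a F) ∧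
      -- its closure generates a Markov semigroup, the second quantization of `exp (t A)`
      ∃ S : ℝ → Lp ℂ 2 π →L[ℂ] Lp ℂ 2 π,
        IsMarkovSemigroup S ∧ IsGenerator S L.closure ∧
        ∃ (A : OneParticle d z →L[ℂ] OneParticle d z) (I : Lp ℂ 2 π ≃ₗᵢ[ℂ] Fock d z),
          IsOneParticleOperator a A ∧ IsPoissonFockIso π I ∧
          ∀ t : ℝ, 0 ≤ t → ∃ U : Fock d z →L[ℂ] Fock d z,
            IsSecondQuantization (NormedSpace.exp ((t : ℂ) • A)) U ∧
            ∀ F : Lp ℂ 2 π, S t F = I.symm (U (I F)) := by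
  have hνs : NullSingletonClass (intensity d z) := nullSingletonClass_intensity hd
  have hvs : NullSingletonClass (volume : Measure (E d)) := by
    have : Nonempty (Fin d) := ⟨⟨0, hd⟩⟩
    exact ⟨fun x => measure_singleton x⟩
  obtain ⟨b, hb, hab⟩ := exists_isJumpKernel_ae_eq ha_nonneg ha
  have hconv : ∀ F γ, KawasakiConverges a F γ ↔ KawasakiConverges b F γ := fun F γ =>
    kawasakiConverges_congr fun x _ => jumpTerm_ae_congr hab F γ x
  have hkaw : kawasaki a = kawasaki b := funext fun F => funext fun γ =>
    kawasaki_congr fun x _ => jumpTerm_ae_congr hab F γ x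
  rw [admissible_congr hab]
  simp only [hconv, hkaw]
  obtain ⟨I, hI⟩ := hπ.exists_fockIso
  obtain ⟨S, hS, hSU⟩ := hπ.exists_isHopSemigroup hb hI
  -- The semigroup of the reflected kernel, the adjoint of `S`, is needed for cylinder functions.
  obtain ⟨S', hS', -⟩ := hπ.exists_isHopSemigroup hb.neg hI
  obtain ⟨L, hdom, hL, hcl, hgraph⟩ := hS.exists_linearPMap
  refine ⟨fun φ h1 h2 => ⟨hπ.ae_summable (memLp_one_iff_integrable.1 h1), hπ.memLp_bogoliubov h1 h2⟩,
    hπ.ae_mem_admissible hb, fun F hF γ hγ => ?_, L, hdom, hL, hcl, fun F hF => ?_,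
    S, hS.isMarkovSemigroup, fun f g => ?_, hb.hopOp, I, hb.isOneParticleOperator.congr hab,
    hπ.isPoissonFockIso hI, hSU⟩
  · obtain ⟨Λ, c, C, hF'⟩ := hF.exists_isCylinderBounded
    exact hF'.kawasakiConverges hb hγ
  · obtain ⟨Λ, c, C, hF'⟩ := hF.exists_isCylinderBounded
    have h1 := MemLp.coeFn_toLp (hF'.memLp hπ)
    have h2 := MemLp.coeFn_toLp (hF'.memLp_kawasaki hπ hb)
    have h3 := hS.mem_graph_of_isCylinderBounded hS' hF' h1 h2
    rw [← hgraph, LinearPMap.mem_graph_iff] at h3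
    obtain ⟨f, hf, hLf⟩ := h3
    exact ⟨f, hf ▸ h1, hLf ▸ h2⟩
  · rw [hgraph]
    exact Iff.rfl
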